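/- Let $n\ge 1$, let $s,s_1,s_2\in(0,1)$ satisfy $s_1+s_2=2s$, and for $K\in L^\infty(\mathbb R^n\times\mathbb R^n)$ (real- or complex-valued) put $$A_{K}(z_1,z_2)=\int_{\mathbb R^n}\int_{\mathbb R^n}K(x,y)\,\frac{\big(|x-z_1|^{s_1-n}-|y-z_1|^{s_1-n}\big)\big(|x-z_2|^{s_2-n}-|y-z_2|^{s_2-n}\big)}{|x-y|^{n+2s}}\,dx\,dy ,\qquad z_1\neq z_2 .$$ Let $T_{K}f(z_1)=\int A_{K}(z_1,z_2)f(z_2)\,dz_2$, understood as the singular integral operator given, for $f,\varphi\in C_c^\infty(\mathbb R^n)$, by $$\int (T_{K}f)\,\varphi=\iint K(x,y)\,\frac{\big(J^{s_1}\varphi(x)-J^{s_1}\varphi(y)\big)\big(J^{s_2}f(x)-J^{s_2}f(y)\big)}{|x-y|^{n+2s}}\,dx\,dy,\qquad J^{t}g(x)=\int_{\mathbb R^n}|x-z|^{t-n}g(z)\,dz .$$ Then there are $\alpha>0$ and $C>0$ depending only on $n,s,s_1,s_2$, and for each $p\in(1,\infty)$ a constant $C_p>0$ depending only on $n,s,s_1,s_2,p$,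 such that for every such $K$ the integral defining $A_K(z_1,z_2)$, $z_1\ne z_2$, and the integral on the right-hand side above converge absolutely, and $T_{K}$ extends to a bounded operator on $L^2(\mathbb R^n)$ which is a Calderón–Zygmund operator with kernel $A_{K}$; that is, with $B=C\|K\|_{L^\infty}$: - $|A_{K}(z_1,z_2)|\le B\,|z_1-z_2|^{-n}$ for all $z_1\neq z_2$, and $|A_{K}(z_1+h,z_2)-A_{K}(z_1,z_2)|$ and $|A_{K}(z_1,z_2+h)-A_{K}(z_1,z_2)|$ are at most $B\,|h|^{\alpha}|z_1-z_2|^{-n-\alpha}$ whenever $z_1\ne z_2$ and $|h|\le\frac12|z_1-z_2|$; - $\|T_{K}f\|_{L^2}\le B\|f\|_{L^2}$ for all $f\in L^2(\mathbb R^n)$; - $T_{K}f(z_1)=\int A_{K}(z_1,z_2)f(z_2)\,dz_2$, with absolute convergence, for a.e. $z_1\notin\operatorname{supp}f$, for every compactly supported $f\in L^2(\mathbb R^n)$. Moreover $T_{K}$ extends linearly from $L^1\cap L^2$ to $L^1$, boundedly from $L^p\cap L^2$ to $L^p$ for every $1<p<\infty$, and (modulo additive constants, and compatibly with its values on $L^2\cap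 L^\infty$) to $L^\infty$, and 1. $\sup_{\lambda>0}\lambda\,|\{|T_{K}f|>\lambda\}|\le C\|K\|_{L^\infty}\|f\|_{L^1}$ for $f\in L^1(\mathbb R^n)$; 2. $\|T_{K}f\|_{L^p}\le C_p\|K\|_{L^\infty}\|f\|_{L^p}$ for $f\in L^p(\mathbb R^n)$, $1<p<\infty$; 3. $[T_{K}f]_{BMO}\le C\|K\|_{L^\infty}\|f\|_{L^\infty}$ for $f\in L^\infty(\mathbb R^n)$, where $[b]_{BMO}=\sup_Q\frac1{|Q|}\int_Q\big|b-\frac1{|Q|}\int_Q b\big|$, the supremum being over all cubes $Q$. In 3, $T_{K}f$ is the locally integrable function, unique up to an additive constant, which for every $R>0$ equals, a.e. on $B(0,R)$ and up to an additive constant, $T_{K}(f1_{B(0,2R)})(z)+\int_{|w|\ge 2R}\big(A_{K}(z,w)-A_{K}(0,w)\big)f(w)\,dw$, the integral converging absolutely. -/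

import Mathlib

open MeasureTheory Set
open scoped ENNReal ContDiff

/-- The Euclidean space `ℝⁿ`. -/
abbrev Rn (n : ℕ) : Type := EuclideanSpace ℝ (Fin n)

/-- The space `L^p(ℝⁿ)` of `𝕜`-valued functions with respect to Lebesgue measure. -/
abbrev LpRn (𝕜 : Type*) [RCLike 𝕜] (n : ℕ) (p : ℝ≥0∞) : Type _ :=
  Lp 𝕜 p (volume : Measure (Rn n))

/-- The (real) function `(x, y) ↦ |x - z|^{t - n} - |y - z|^{t - n}`. -/
noncomputable def powDiff {n : ℕ} (t : ℝ) (x y z : Rn n) : ℝ :=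
  ‖x - z‖ ^ (t - n) - ‖y - z‖ ^ (t - n)

/-- The integrand, as a function of `(x, y)`, in the definition of `A_{K,s₁,s₂}(z₁,z₂)`. -/
noncomputable def kernelIntegrand {𝕜 : Type*} [RCLike 𝕜] {n : ℕ} (K : Rn n × Rn n → 𝕜)
    (s s₁ s₂ : ℝ) (z₁ z₂ : Rn n) (q : Rn n × Rn n) : 𝕜 :=
  K q * ((powDiff s₁ q.1 q.2 z₁ * powDiff s₂ q.1 q.2 z₂ / ‖q.1 - q.2‖ ^ (n + 2 * s) : ℝ) : 𝕜)

/-- The kernel `A_{K,s₁,s₂}(z₁,z₂)`. -/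
noncomputable def kernelA {𝕜 : Type*} [RCLike 𝕜] {n : ℕ} (K : Rn n × Rn n → 𝕜)
    (s s₁ s₂ : ℝ) (z₁ z₂ : Rn n) : 𝕜 :=
  ∫ q : Rn n × Rn n, kernelIntegrand K s s₁ s₂ z₁ z₂ q

/-- The (unnormalised) Riesz potential of order `t`: `x ↦ ∫ |x - z|^{t - n} f(z) dz`. -/
noncomputable def rieszPot {𝕜 : Type*} [RCLike 𝕜] {n : ℕ} (t : ℝ) (f : Rn n → 𝕜)
    (x : Rn n) : 𝕜 :=
  ∫ z : Rn n, ((‖x - z‖ ^ (t - n) : ℝ) : 𝕜) * f z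

/-- The integrand of the bilinear form of `T_{K,s₁,s₂}`. It is obtained from
`A_{K,s₁,s₂}(z₁,z₂) f(z₂) φ(z₁)` by carrying out the integrations in `z₁` and `z₂` first. -/
noncomputable def formIntegrand {𝕜 : Type*} [RCLike 𝕜] {n : ℕ} (K : Rn n × Rn n → 𝕜)
    (s s₁ s₂ : ℝ) (f φ : Rn n → 𝕜) (q : Rn n × Rn n) : 𝕜 :=
  K q * (rieszPot s₁ φ q.1 - rieszPot s₁ φ q.2) * (rieszPot s₂ f q.1 - rieszPot s₂ f q.2) *
    (((‖q.1 - q.2‖ ^ (n + 2 * s))⁻¹ : ℝ) : 𝕜)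

/-- Test functions are in every `L^p`. -/
theorem memLp_of_test {𝕜 : Type*} [RCLike 𝕜] {n : ℕ} {f : Rn n → 𝕜} (hf : ContDiff ℝ ∞ f)
    (hc : HasCompactSupport f) (p : ℝ≥0∞) : MemLp f p volume :=
  hf.continuous.memLp_of_hasCompactSupport hc

/-- A bounded function truncated to a ball is in `L²`. -/
theorem memLp_two_indicator_ball {𝕜 : Type*} [RCLike 𝕜] {n : ℕ} {f : Rn n → 𝕜}
    (hf : MemLp f ∞ volume) (R : ℝ) :
    MemLp ((Metric.ball (0 : Rn n) R).indicator f) 2 volume := by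
  rw [memLp_indicator_iff_restrict Metric.isOpen_ball.measurableSet]
  have : IsFiniteMeasure ((volume : Measure (Rn n)).restrict (Metric.ball 0 R)) :=
    ⟨by simpa using measure_ball_lt_top⟩
  exact (hf.restrict _).mono_exponent le_top

/-- The bounded operator `T` on `L²(ℝⁿ)` is the operator `T_{K,s₁,s₂}`: for all test functions
`f, φ ∈ C_c^∞(ℝⁿ)` the bilinear form of `T_{K,s₁,s₂}` converges absolutely and equals
`∫ (T f) φ`. As `C_c^∞` is dense in `L²`, at most one `T` has this property. -/
def IsOperatorT {𝕜 : Type*} [RCLike 𝕜] {n : ℕ} (K : Rn n × Rn n → 𝕜) (s s₁ s₂ : ℝ)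
    (T : LpRn 𝕜 n 2 →L[𝕜] LpRn 𝕜 n 2) : Prop :=
  ∀ (f φ : Rn n → 𝕜) (hf : ContDiff ℝ ∞ f) (hfc : HasCompactSupport f),
    ContDiff ℝ ∞ φ → HasCompactSupport φ →
      Integrable (formIntegrand K s s₁ s₂ f φ) volume ∧
      ∫ z : Rn n, T ((memLp_of_test hf hfc 2).toLp f) z * φ z =
        ∫ q : Rn n × Rn n, formIntegrand K s s₁ s₂ f φ q

/-- `A` is a standard kernel with Hölder exponent `α` and constant `B`. -/
structure IsStandardKernel {𝕜 : Type*} [RCLike 𝕜] {n : ℕ} (A : Rn n → Rn n → 𝕜)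
    (α B : ℝ) : Prop where
  size : ∀ z₁ z₂ : Rn n, z₁ ≠ z₂ → ‖A z₁ z₂‖ ≤ B / ‖z₁ - z₂‖ ^ (n : ℝ)
  regularity_left : ∀ z₁ z₂ h : Rn n, z₁ ≠ z₂ → ‖h‖ ≤ ‖z₁ - z₂‖ / 2 →
    ‖A (z₁ + h) z₂ - A z₁ z₂‖ ≤ B * ‖h‖ ^ α / ‖z₁ - z₂‖ ^ (n + α)
  regularity_right : ∀ z₁ z₂ h : Rn n, z₁ ≠ z₂ → ‖h‖ ≤ ‖z₁ - z₂‖ / 2 →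
    ‖A z₁ (z₂ + h) - A z₁ z₂‖ ≤ B * ‖h‖ ^ α / ‖z₁ - z₂‖ ^ (n + α)

/-- `T` is a Calderón–Zygmund operator with kernel `A`: the kernel is standard, `T` is bounded on
`L²`, and `T f (z) = ∫ A(z,w) f(w) dw` for a.e. `z` outside the support of `f`, for every
compactly supported `f ∈ L²`. -/
structure IsCalderonZygmund {𝕜 : Type*} [RCLike 𝕜] {n : ℕ} (A : Rn n → Rn n → 𝕜) (α B : ℝ)
    (T : LpRn 𝕜 n 2 →L[𝕜] LpRn 𝕜 n 2) : Prop where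
  standard : IsStandardKernel A α B
  bounded : ‖T‖ ≤ B
  associated : ∀ (f : Rn n → 𝕜) (hf : MemLp f 2 volume), HasCompactSupport f →
    ∀ᵐ z : Rn n, z ∉ tsupport f →
      Integrable (fun w => A z w * f w) volume ∧ T (hf.toLp f) z = ∫ w : Rn n, A z w * f w

/-- The weak `L¹` quasi-norm `sup_{t > 0} t |{|g| > t}|`. -/
noncomputable def weakL1Norm {𝕜 : Type*} [RCLike 𝕜] {n : ℕ} (g : Rn n → 𝕜) : ℝ≥0∞ :=
  ⨆ (t : ℝ) (_ : 0 < t), ENNReal.ofReal t * volume {x : Rn n | t < ‖g x‖}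

/-- The cube with lower corner `a` and side length `l`. -/
def cube {n : ℕ} (a : Rn n) (l : ℝ) : Set (Rn n) :=
  {x | ∀ i, x i ∈ Icc (a i) (a i + l)}

/-- The BMO seminorm of a locally integrable function. -/
noncomputable def bmoSeminorm {𝕜 : Type*} [RCLike 𝕜] {n : ℕ} (b : Rn n → 𝕜) : ℝ≥0∞ :=
  ⨆ (a : Rn n) (l : ℝ) (_ : 0 < l),
    (volume (cube a l))⁻¹ * ∫⁻ x in cube a l, ‖b x - ⨍ y in cube a l, b y‖ₑ

/-- `T` extends to a linear operator `L¹ → L^{1,∞}` with constant `B`. -/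
def BoundedWeakL1 {𝕜 : Type*} [RCLike 𝕜] {n : ℕ} (T : LpRn 𝕜 n 2 →L[𝕜] LpRn 𝕜 n 2)
    (B : ℝ) : Prop :=
  ∃ T₁ : LpRn 𝕜 n 1 →ₗ[𝕜] (Rn n →ₘ[volume] 𝕜),
    (∀ (f : Rn n → 𝕜) (h₁ : MemLp f 1 volume) (h₂ : MemLp f 2 volume),
      T₁ (h₁.toLp f) =ᵐ[volume] T (h₂.toLp f)) ∧
    ∀ f : LpRn 𝕜 n 1, weakL1Norm (T₁ f) ≤ ENNReal.ofReal (B * ‖f‖)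

/-- `T` extends to a bounded linear operator `L^p → L^p` with constant `B`. -/
def BoundedLp {𝕜 : Type*} [RCLike 𝕜] {n : ℕ} (T : LpRn 𝕜 n 2 →L[𝕜] LpRn 𝕜 n 2)
    (p : ℝ≥0∞) [Fact (1 ≤ p)] (B : ℝ) : Prop :=
  ∃ Tp : LpRn 𝕜 n p →L[𝕜] LpRn 𝕜 n p,
    (∀ (f : Rn n → 𝕜) (hp : MemLp f p volume) (h₂ : MemLp f 2 volume),
      Tp (hp.toLp f) =ᵐ[volume] T (h₂.toLp f)) ∧
    ∀ f : LpRn 𝕜 n p, ‖Tp f‖ ≤ B * ‖f‖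

/-- `g` is (modulo constants) the image of `f ∈ L^∞` under the operator `T` with kernel `A`:
on each ball `B(0,R)`, up to an additive constant,
`g(z) = T(f 1_{B(0,2R)})(z) + ∫_{|w| ≥ 2R} (A(z,w) - A(0,w)) f(w) dw`.
This is the usual definition of `T f` for bounded `f`; it determines `g` up to a constant. -/
def IsLinftyImage {𝕜 : Type*} [RCLike 𝕜] {n : ℕ} (A : Rn n → Rn n → 𝕜)
    (T : LpRn 𝕜 n 2 →L[𝕜] LpRn 𝕜 n 2) (f : Rn n → 𝕜) (hf : MemLp f ∞ volume)
    (g : Rn n → 𝕜) : Prop :=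
  ∀ R : ℝ, 0 < R → ∃ c : 𝕜, ∀ᵐ z : Rn n, ‖z‖ < R →
    IntegrableOn (fun w => (A z w - A 0 w) * f w) (Metric.ball (0 : Rn n) (2 * R))ᶜ volume ∧
    g z = T ((memLp_two_indicator_ball hf (2 * R)).toLp _) z +
      (∫ w in (Metric.ball (0 : Rn n) (2 * R))ᶜ, (A z w - A 0 w) * f w) + c

/-- `T`, with kernel `A`, maps `L^∞` to `BMO` with constant `B`; on `L² ∩ L^∞` the image is the
original `T f`, up to an additive constant. -/
def BoundedLinftyBMO {𝕜 : Type*} [RCLike 𝕜] {n : ℕ} (A : Rn n → Rn n → 𝕜)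
    (T : LpRn 𝕜 n 2 →L[𝕜] LpRn 𝕜 n 2) (B : ℝ) : Prop :=
  ∀ (f : Rn n → 𝕜) (hf : MemLp f ∞ volume), ∃ g : Rn n → 𝕜,
    LocallyIntegrable g volume ∧ IsLinftyImage A T f hf g ∧
    (∀ h₂ : MemLp f 2 volume, ∃ c : 𝕜, ∀ᵐ z : Rn n, g z = T (h₂.toLp f) z + c) ∧
    bmoSeminorm g ≤ ENNReal.ofReal B * eLpNorm f ∞ volume

/-!
The kernel estimates and the `L²` bound are specific to the weight `|x - y|^{-(n+2s)}`; everything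
else is Calderón–Zygmund theory for an arbitrary pair `IsCZOperator A α B T`, with constants that
depend on `B` linearly.

*Kernel.* In the integral defining `A(z₁,z₂)` the factor `| |x-z|^{t-n} - |y-z|^{t-n} |` is at most
`C |x-y|^γ (|x-z|^{t-n-γ} + |y-z|^{t-n-γ})` for every `0 ≤ γ ≤ 1`. For `|x-y| ≥ |z₁-z₂|/8` one takes
`γ = sᵢ/2`, which leaves a power of `|x-y|` integrable at infinity against two locally integrable
Riesz kernels. For `|x-y| < |z₁-z₂|/8` the points `x` and `y` are away from `z₁` or away from `z₂`;
the smooth factor is Lipschitz, and the singular one is integrated in `x` with `x-y` fixed, where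
`∫ | |x+h|^{t-n} - |x|^{t-n} | dx = c |h|^t`. Both the size and the Hölder bound are instances of
`exists_lintegral_mul_powDiff_le`, in which the factor at `z₁` is replaced by a function with the
same bounds: the factor itself, or its increment in `z₁`. Regularity in `z₂` follows, as exchanging
`(s₁,z₁)` and `(s₂,z₂)` does not change the kernel (`exists_isStandardKernel_kernelA`).

*Bound on `L²`.* Since `s₁ + s₂ = 2s`, the weight is the product of the weights
`|x-y|^{-(n/2+sᵢ)}`. By Cauchy–Schwarz it suffices that
`∬ |J^t f(x) - J^t f(y)|² |x-y|^{-n-2t} dx dy ≤ C ‖f‖²` (`exists_lintegral_diffPot_sq_le`). For fixed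
`y - x = h` the difference is a convolution with an `L¹` function whose Fourier transform is at most
`C |ξ|^{-t} min(1, |h||ξ|)`; Plancherel and an integration in `h` give the bound. This defines `T`
(`exists_operator`), and Fubini's theorem identifies its kernel, because
`∬ |A(z₁,z₂) f(z₂) φ(z₁)|` converges when `f` and `φ` have separated supports
(`integral_pairIntegrand_indicator`). The transpose of `T` is the operator with the same `K` and
with `s₁` and `s₂` exchanged, so it is again of this type (`exists_isCZOperator_transpose`).

*Weak type `(1,1)` and `L^p`.* A Vitali covering gives a Calderón–Zygmund decomposition into
finitely many atoms supported in balls, up to a small error in `L²`, and Hörmander's condition gives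
the weak bound (`exists_mul_volume_operator_le`). Interpolation with `L²` covers `1 < p < 2`, and
duality with the transpose covers `p > 2` (`exists_eLpNorm_operator_le`). The bounds on dense
subspaces extend by continuity, in the case of `L¹` for convergence in the weak quasi-norm.

*Bounded functions.* For `f ∈ L^∞` and a ball `B(c,r)`, the function
`T(f 1_{B(c,2r)})(z) + ∫_{|w-c| ≥ 2r} (A(z,w) - A(c,w)) f(w) dw` on that ball has mean absolute value
at most `C B ‖f‖_∞`: the `L²` bound controls the first term and Hörmander's condition the second.
For different balls these functions agree up to constants, so they glue to one function of bounded
mean oscillation (`exists_boundedLinftyBMO`).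
-/

/-! ### Integrals of powers of the norm -/

theorem lintegral_eq_lintegral_comp_affine {n : ℕ} (F : Rn n → ℝ≥0∞) (c : Rn n) {r : ℝ}
    (hr : 0 < r) :
    ∫⁻ x, F x = ENNReal.ofReal (r ^ n) * ∫⁻ u, F (c + r • u) := by
  have h1 : ∫⁻ u, F (c + r • u) = ∫⁻ v, F (c + v) ∂(Measure.map (r • ·) volume) :=
    (lintegral_map_equiv (fun v => F (c + v))
      (Homeomorph.smulOfNeZero r hr.ne').toMeasurableEquiv).symm
  rw [h1, Measure.map_addHaar_smul _ hr.ne', lintegral_smul_measure,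
    lintegral_add_left_eq_self, finrank_euclideanSpace_fin, smul_eq_mul, ← mul_assoc,
    ← ENNReal.ofReal_mul (by positivity), abs_of_pos (by positivity),
    mul_inv_cancel₀ (by positivity), ENNReal.ofReal_one, one_mul]

theorem ofReal_mul_rpow_scale {n : ℕ} {r : ℝ} (hr : 0 < r) (b : ℝ) (u c : Rn n) :
    ENNReal.ofReal (‖c + r • u - c‖ ^ b) = ENNReal.ofReal (r ^ b) * ENNReal.ofReal (‖u‖ ^ b) := by
  rw [add_sub_cancel_left, norm_smul, Real.norm_of_nonneg hr.le,
    Real.mul_rpow hr.le (norm_nonneg _), ENNReal.ofReal_mul (by positivity)]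

/-- Integrating a power of the distance to `c` over a set that scales like `S`. -/
theorem setLIntegral_norm_sub_rpow_scale {n : ℕ} (S : ℝ → Rn n → Set (Rn n))
    (hS : ∀ r c, MeasurableSet (S r c))
    (hSs : ∀ r, 0 < r → ∀ c u, c + r • u ∈ S r c ↔ u ∈ S 1 0) {r : ℝ} (hr : 0 < r) (c : Rn n)
    (b : ℝ) :
    ∫⁻ x in S r c, ENNReal.ofReal (‖x - c‖ ^ b) =
      ENNReal.ofReal (r ^ (b + n)) * ∫⁻ x in S 1 0, ENNReal.ofReal (‖x‖ ^ b) := by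
  rw [← lintegral_indicator (hS _ _), lintegral_eq_lintegral_comp_affine _ c hr,
    ← lintegral_indicator (hS _ _), ← lintegral_const_mul' _ _ ENNReal.ofReal_ne_top,
    ← lintegral_const_mul' _ _ ENNReal.ofReal_ne_top]
  refine lintegral_congr fun u => ?_
  by_cases hu : u ∈ S 1 0
  · rw [indicator_of_mem hu, indicator_of_mem ((hSs r hr c u).2 hu), ofReal_mul_rpow_scale hr,
      ← mul_assoc, ← ENNReal.ofReal_mul (by positivity), Real.rpow_add hr, Real.rpow_natCast,
      mul_comm (r ^ n)]
  · rw [indicator_of_notMem hu, indicator_of_notMem (mt (hSs r hr c u).1 hu)]; simp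

theorem exists_setLIntegral_ball_rpow_le {n : ℕ} (hn : 1 ≤ n) {a : ℝ} (ha : 0 < a) :
    ∃ C : ℝ, 0 < C ∧ ∀ (c : Rn n) (r : ℝ), 0 < r →
      ∫⁻ x in Metric.ball c r, ENNReal.ofReal (‖x - c‖ ^ (a - n)) ≤ ENNReal.ofReal (C * r ^ a) := by
  have hfin : IntegrableOn (fun x : Rn n => ‖x‖ ^ (a - n)) (Metric.ball 0 1) := by
    refine integrableOn_ball_of_norm_le_rpow (C := 1) (α := n - a) ?_ ?_ ?_ ?_
    · simpa using hn
    · simpa using ha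
    · refine Filter.Eventually.of_forall fun x => ?_
      rw [Real.norm_of_nonneg (by positivity), neg_sub, one_mul]
    · exact Measurable.aestronglyMeasurable (by fun_prop)
  have hlt := hfin.lintegral_lt_top
  set I := ∫⁻ x : Rn n in Metric.ball 0 1, ENNReal.ofReal (‖x‖ ^ (a - n)) with hI
  refine ⟨I.toReal + 1, by positivity, fun c r hr => ?_⟩
  rw [setLIntegral_norm_sub_rpow_scale (fun r c => Metric.ball c r)
    (fun r c => measurableSet_ball) (fun r hr c u => by
      simp [norm_smul, abs_of_pos hr, hr]) hr c, ← hI, sub_add_cancel, mul_comm,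
      ENNReal.ofReal_mul (by positivity)]
  gcongr
  rw [← ENNReal.ofReal_toReal hlt.ne]
  exact ENNReal.ofReal_le_ofReal (by simp)

theorem exists_setLIntegral_compl_ball_rpow_le {n : ℕ} {a : ℝ} (ha : 0 < a) :
    ∃ C : ℝ, 0 < C ∧ ∀ (c : Rn n) (r : ℝ), 0 < r →
      ∫⁻ x in (Metric.ball c r)ᶜ, ENNReal.ofReal (‖x - c‖ ^ (-a - n)) ≤
        ENNReal.ofReal (C * r ^ (-a)) := by
  have hfin : IntegrableOn (fun x : Rn n => ‖x‖ ^ (-a - n)) (Metric.ball 0 1)ᶜ := by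
    have h := integrable_one_add_norm (E := Rn n) (μ := volume) (r := a + n) (by simpa using ha)
    refine Integrable.mono' ((h.const_mul (2 ^ (a + n))).integrableOn)
      (Measurable.aestronglyMeasurable (by fun_prop)) ?_
    refine (ae_restrict_iff' measurableSet_ball.compl).2 (Filter.Eventually.of_forall fun x hx => ?_)
    have hx : 1 ≤ ‖x‖ := by simpa using hx
    rw [Real.norm_of_nonneg (by positivity), show -a - (n : ℝ) = -(a + n) by ring,
      Real.rpow_neg (by positivity), Real.rpow_neg (by positivity), ← div_eq_mul_inv,
      inv_eq_one_div, div_le_div_iff₀ (by positivity) (by positivity), one_mul,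
      ← Real.mul_rpow (by positivity) (by positivity)]
    exact Real.rpow_le_rpow (by positivity) (by linarith) (by positivity)
  have hlt := hfin.lintegral_lt_top
  set I := ∫⁻ x : Rn n in (Metric.ball 0 1)ᶜ, ENNReal.ofReal (‖x‖ ^ (-a - n)) with hI
  refine ⟨I.toReal + 1, by positivity, fun c r hr => ?_⟩
  rw [setLIntegral_norm_sub_rpow_scale (fun r c => (Metric.ball c r)ᶜ)
    (fun r c => measurableSet_ball.compl) (fun r hr c u => by
      simp [norm_smul, abs_of_pos hr, hr]) hr c, ← hI, sub_add_cancel, mul_comm,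
      ENNReal.ofReal_mul (by positivity)]
  gcongr
  rw [← ENNReal.ofReal_toReal hlt.ne]
  exact ENNReal.ofReal_le_ofReal (by simp)

/-- The composition formula for Riesz potentials, as an upper bound: the integral is split into two
balls of radius `|u - v| / 2` about the singularities and the complement of both, where the
integrand is at most a multiple of `|x - u|^{a+b-2n}`. -/
theorem exists_lintegral_rpow_mul_rpow_le {n : ℕ} (hn : 1 ≤ n) {a b : ℝ} (ha : 0 < a) (hb : 0 < b)
    (hab : a + b < n) :
    ∃ C : ℝ, 0 < C ∧ ∀ u v : Rn n, u ≠ v →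
      ∫⁻ x, ENNReal.ofReal (‖x - u‖ ^ (a - n)) * ENNReal.ofReal (‖x - v‖ ^ (b - n)) ≤
        ENNReal.ofReal (C * ‖u - v‖ ^ (a + b - n)) := by
  obtain ⟨C₁, hC₁, h₁⟩ := exists_setLIntegral_ball_rpow_le hn ha
  obtain ⟨C₂, hC₂, h₂⟩ := exists_setLIntegral_ball_rpow_le hn hb
  obtain ⟨C₃, hC₃, h₃⟩ := exists_setLIntegral_compl_ball_rpow_le (n := n)
    (a := n - a - b) (by linarith)
  set e : ℝ := a + b - n with he
  refine ⟨C₁ * (1 / 2) ^ a * (1 / 2) ^ (b - n) + C₂ * (1 / 2) ^ b * (1 / 2) ^ (a - n) +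
    C₃ * (1 / 2) ^ e * (1 / 3) ^ (b - n), by positivity, fun u v huv => ?_⟩
  have hd : 0 < ‖u - v‖ := norm_pos_iff.2 (sub_ne_zero.2 huv)
  set d := ‖u - v‖ with hdd
  set F : Rn n → ℝ≥0∞ := fun x =>
    ENNReal.ofReal (‖x - u‖ ^ (a - n)) * ENNReal.ofReal (‖x - v‖ ^ (b - n)) with hF
  have hbn : b - n ≤ 0 := by linarith
  have han : a - n ≤ 0 := by linarith
  have hU : ∫⁻ x in Metric.ball u (d / 2), F x ≤
      ENNReal.ofReal (C₁ * (1 / 2) ^ a * (1 / 2) ^ (b - n) * d ^ e) := by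
    calc ∫⁻ x in Metric.ball u (d / 2), F x
        ≤ ∫⁻ x in Metric.ball u (d / 2), ENNReal.ofReal (‖x - u‖ ^ (a - n)) *
            ENNReal.ofReal ((d / 2) ^ (b - n)) := by
          refine setLIntegral_mono (by fun_prop) fun x hx => ?_
          have hx : ‖x - u‖ < d / 2 := by simpa [dist_eq_norm] using hx
          have : d ≤ ‖x - u‖ + ‖x - v‖ := by
            rw [hdd, norm_sub_rev x u]; simpa using norm_add_le (u - x) (x - v)
          refine mul_le_mul_right (ENNReal.ofReal_le_ofReal ?_) _
          exact Real.rpow_le_rpow_of_nonpos (by positivity) (by linarith) hbn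
      _ ≤ ENNReal.ofReal (C₁ * (d / 2) ^ a) * ENNReal.ofReal ((d / 2) ^ (b - n)) := by
          rw [lintegral_mul_const _ (by fun_prop)]
          gcongr
          exact h₁ u _ (by positivity)
      _ = _ := by
          rw [← ENNReal.ofReal_mul (by positivity)]
          congr 1
          rw [div_eq_mul_one_div, Real.mul_rpow hd.le (by positivity),
            Real.mul_rpow hd.le (by positivity), he, show a + b - n = a + (b - n) by ring,
            Real.rpow_add hd]
          ring
  have hV : ∫⁻ x in Metric.ball v (d / 2), F x ≤
      ENNReal.ofReal (C₂ * (1 / 2) ^ b * (1 / 2) ^ (a - n) * d ^ e) := by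
    calc ∫⁻ x in Metric.ball v (d / 2), F x
        ≤ ∫⁻ x in Metric.ball v (d / 2), ENNReal.ofReal ((d / 2) ^ (a - n)) *
            ENNReal.ofReal (‖x - v‖ ^ (b - n)) := by
          refine setLIntegral_mono (by fun_prop) fun x hx => ?_
          have hx : ‖x - v‖ < d / 2 := by simpa [dist_eq_norm] using hx
          have : d ≤ ‖x - u‖ + ‖x - v‖ := by
            rw [hdd, norm_sub_rev x u]; simpa using norm_add_le (u - x) (x - v)
          refine mul_le_mul_left (ENNReal.ofReal_le_ofReal ?_) _
          exact Real.rpow_le_rpow_of_nonpos (by positivity) (by linarith) han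
      _ ≤ ENNReal.ofReal ((d / 2) ^ (a - n)) * ENNReal.ofReal (C₂ * (d / 2) ^ b) := by
          rw [lintegral_const_mul _ (by fun_prop)]
          gcongr
          exact h₂ v _ (by positivity)
      _ = _ := by
          rw [← ENNReal.ofReal_mul (by positivity)]
          congr 1
          rw [div_eq_mul_one_div, Real.mul_rpow hd.le (by positivity),
            Real.mul_rpow hd.le (by positivity), he, show a + b - n = b + (a - n) by ring,
            Real.rpow_add hd]
          ring
  have hW : ∫⁻ x in (Metric.ball u (d / 2))ᶜ ∩ (Metric.ball v (d / 2))ᶜ, F x ≤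
      ENNReal.ofReal (C₃ * (1 / 2) ^ e * (1 / 3) ^ (b - n) * d ^ e) := by
    calc ∫⁻ x in (Metric.ball u (d / 2))ᶜ ∩ (Metric.ball v (d / 2))ᶜ, F x
        ≤ ∫⁻ x in (Metric.ball u (d / 2))ᶜ ∩ (Metric.ball v (d / 2))ᶜ,
            ENNReal.ofReal ((1 / 3) ^ (b - n)) *
            ENNReal.ofReal (‖x - u‖ ^ (-(n - a - b) - n)) := by
          refine setLIntegral_mono (by fun_prop) fun x hx => ?_
          have hx1 : d / 2 ≤ ‖x - u‖ := by simpa [dist_eq_norm] using hx.1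
          have hx2 : d / 2 ≤ ‖x - v‖ := by simpa [dist_eq_norm] using hx.2
          have h3 : ‖x - u‖ ≤ ‖x - v‖ + d := by
            rw [hdd, norm_sub_rev u v]; simpa using norm_add_le (x - v) (v - u)
          have hpos : 0 < ‖x - u‖ := by linarith
          simp only [hF]
          rw [← ENNReal.ofReal_mul (by positivity), ← ENNReal.ofReal_mul (by positivity)]
          refine ENNReal.ofReal_le_ofReal ?_
          have h4 : ‖x - v‖ ^ (b - n) ≤ (‖x - u‖ * (1 / 3)) ^ (b - n) :=
            Real.rpow_le_rpow_of_nonpos (by positivity) (by linarith) hbn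
          rw [Real.mul_rpow hpos.le (by positivity)] at h4
          calc ‖x - u‖ ^ (a - n) * ‖x - v‖ ^ (b - n)
              ≤ ‖x - u‖ ^ (a - n) * (‖x - u‖ ^ (b - n) * (1 / 3) ^ (b - n)) := by gcongr
            _ = _ := by
              rw [← mul_assoc, ← Real.rpow_add hpos, mul_comm]; congr 2; ring
      _ ≤ ∫⁻ x in (Metric.ball u (d / 2))ᶜ, ENNReal.ofReal ((1 / 3) ^ (b - n)) *
            ENNReal.ofReal (‖x - u‖ ^ (-(n - a - b) - n)) :=
          lintegral_mono_set inter_subset_left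
      _ ≤ ENNReal.ofReal ((1 / 3) ^ (b - n)) * ENNReal.ofReal (C₃ * (d / 2) ^ (-(n - a - b))) := by
          rw [lintegral_const_mul _ (by fun_prop)]
          gcongr
          exact h₃ u _ (by positivity)
      _ = _ := by
          rw [← ENNReal.ofReal_mul (by positivity)]
          congr 1
          rw [show -(n - a - b) = e by rw [he]; ring, show d / 2 = d * (1 / 2) by ring,
            Real.mul_rpow hd.le (by positivity)]
          ring
  have hcov : (univ : Set (Rn n)) ⊆ (Metric.ball u (d / 2) ∪ Metric.ball v (d / 2)) ∪
      ((Metric.ball u (d / 2))ᶜ ∩ (Metric.ball v (d / 2))ᶜ) := by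
    rw [← compl_union, union_compl_self]
  calc ∫⁻ x, F x = ∫⁻ x in univ, F x := by rw [Measure.restrict_univ]
    _ ≤ ∫⁻ x in (Metric.ball u (d / 2) ∪ Metric.ball v (d / 2)) ∪
      ((Metric.ball u (d / 2))ᶜ ∩ (Metric.ball v (d / 2))ᶜ), F x := lintegral_mono_set hcov
    _ ≤ ((∫⁻ x in Metric.ball u (d / 2), F x) + ∫⁻ x in Metric.ball v (d / 2), F x) +
        ∫⁻ x in (Metric.ball u (d / 2))ᶜ ∩ (Metric.ball v (d / 2))ᶜ, F x :=
      (lintegral_union_le _ _ _).trans (add_le_add_left (lintegral_union_le _ _ _) _)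
    _ ≤ _ := by
      refine (add_le_add (add_le_add hU hV) hW).trans_eq ?_
      rw [← ENNReal.ofReal_add (by positivity) (by positivity),
        ← ENNReal.ofReal_add (by positivity) (by positivity)]
      congr 1; ring

/-! ### Differences of Riesz kernels -/

/-- With `b = a (1 + q)` the claim is `1 - (1 + q)^{-m} ≤ N q^γ`: Bernoulli's inequality gives it
for `q ≤ 1`, and for `q ≥ 1` the right-hand side is at least `1`. -/
theorem rpow_neg_sub_rpow_neg_le {a b m γ : ℝ} {N : ℝ} (hm : 0 < m) (hmN : m ≤ N) (hN : 1 ≤ N)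
    (hγ0 : 0 ≤ γ) (hγ1 : γ ≤ 1) (ha : 0 < a) (hab : a ≤ b) :
    a ^ (-m) - b ^ (-m) ≤ N * (b - a) ^ γ * a ^ (-m - γ) := by
  have hb : 0 < b := ha.trans_le hab
  set q := (b - a) / a with hq
  have hq0 : 0 ≤ q := div_nonneg (by linarith) ha.le
  have hbq : b = a * (1 + q) := by rw [hq]; field_simp; ring
  have ham : 0 ≤ a ^ (-m) := by positivity
  have h1 : 1 - m * q ≤ (1 + q) ^ (-m) := by
    rw [Real.rpow_def_of_pos (by positivity)]
    have := Real.add_one_le_exp (Real.log (1 + q) * -m)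
    have h2 := Real.log_le_sub_one_of_pos (show 0 < 1 + q by positivity)
    nlinarith
  have h2 : b ^ (-m) = a ^ (-m) * (1 + q) ^ (-m) := by
    rw [hbq, Real.mul_rpow ha.le (by positivity)]
  have h3 : 0 ≤ (1 + q) ^ (-m) := by positivity
  have h4 : (b - a) ^ γ * a ^ (-m - γ) = a ^ (-m) * q ^ γ := by
    rw [hq, Real.div_rpow (by linarith) ha.le, Real.rpow_sub ha]; field_simp
  rw [mul_assoc, h4, h2]
  have h5 : 1 - (1 + q) ^ (-m) ≤ N * q ^ γ := by
    rcases le_total q 1 with h | h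
    · have : q ≤ q ^ γ := by
        rcases hq0.eq_or_lt with h0 | h0
        · rw [← h0]; positivity
        · simpa using Real.rpow_le_rpow_of_exponent_ge h0 h hγ1
      nlinarith
    · have : 1 ≤ q ^ γ := Real.one_le_rpow h hγ0
      nlinarith
  nlinarith

/-- The symmetric form of `rpow_neg_sub_rpow_neg_le`. It holds also for `a = 0` or `b = 0`, where
negative powers take the value `0`. -/
theorem abs_rpow_neg_sub_rpow_neg_le {a b m γ : ℝ} {N : ℝ} (hm : 0 < m) (hmN : m ≤ N)
    (hN : 1 ≤ N) (hγ0 : 0 ≤ γ) (hγ1 : γ ≤ 1) (ha : 0 ≤ a) (hb : 0 ≤ b) :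
    |a ^ (-m) - b ^ (-m)| ≤ N * |a - b| ^ γ * (a ^ (-m - γ) + b ^ (-m - γ)) := by
  wlog hab : a ≤ b generalizing a b with H
  · have := H hb ha (le_of_not_ge hab)
    rwa [abs_sub_comm, abs_sub_comm a b, add_comm (a ^ _)]
  have e : |a - b| = b - a := by rw [abs_sub_comm, abs_of_nonneg]; linarith
  rw [e]
  have hba : 0 ≤ b - a := by linarith
  rcases ha.eq_or_lt with h0 | h0
  · subst h0
    rw [Real.zero_rpow (by linarith), Real.zero_rpow (by linarith), sub_zero, zero_sub, abs_neg,
      zero_add, abs_of_nonneg (by positivity)]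
    rcases hb.eq_or_lt with h1 | h1
    · subst h1
      rw [Real.zero_rpow (by linarith)]; positivity
    · rw [mul_assoc, ← Real.rpow_add h1, show γ + (-m - γ) = -m by ring]
      have : 0 ≤ b ^ (-m) := by positivity
      nlinarith
  · have h1 := rpow_neg_sub_rpow_neg_le hm hmN hN hγ0 hγ1 h0 hab
    have h2 : b ^ (-m) ≤ a ^ (-m) := Real.rpow_le_rpow_of_nonpos h0 hab (by linarith)
    rw [abs_of_nonneg (by linarith), mul_add]
    have : 0 ≤ N * (b - a) ^ γ * b ^ (-m - γ) := by positivity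
    linarith

/-- The main pointwise bound for differences of the Riesz kernel, interpolating between the size
bound (`γ = 0`) and the mean value theorem (`γ = 1`). -/
theorem abs_powDiff_le {n : ℕ} (hn : 1 ≤ n) {t γ : ℝ} (ht : t ∈ Ioo (0 : ℝ) 1) (hγ0 : 0 ≤ γ)
    (hγ1 : γ ≤ 1) (x y z : Rn n) :
    |powDiff t x y z| ≤
      n * ‖x - y‖ ^ γ * (‖x - z‖ ^ (t - n - γ) + ‖y - z‖ ^ (t - n - γ)) := by
  have hn' : (1 : ℝ) ≤ n := by exact_mod_cast hn
  have h := abs_rpow_neg_sub_rpow_neg_le (m := n - t) (N := n) (by linarith [ht.2])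
    (by linarith [ht.1]) hn' hγ0 hγ1 (norm_nonneg (x - z)) (norm_nonneg (y - z))
  rw [neg_sub] at h
  refine h.trans ?_
  gcongr
  simpa using abs_norm_sub_norm_le (x - z) (y - z)

theorem powDiff_swap {n : ℕ} (t : ℝ) (x y z : Rn n) : powDiff t y x z = -powDiff t x y z := by
  simp [powDiff]

/-- Far from the singularity the difference of Riesz kernels is Lipschitz. -/
theorem abs_powDiff_le_of_le {n : ℕ} (hn : 1 ≤ n) {t ρ : ℝ} (ht : t ∈ Ioo (0 : ℝ) 1) (hρ : 0 < ρ)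
    {x y z : Rn n} (hx : ρ ≤ ‖x - z‖) (hy : ρ ≤ ‖y - z‖) :
    |powDiff t x y z| ≤ 2 * n * ‖x - y‖ * ρ ^ (t - n - 1) := by
  have hn' : (1 : ℝ) ≤ n := by exact_mod_cast hn
  refine (abs_powDiff_le hn ht zero_le_one le_rfl x y z).trans ?_
  have h1 := Real.rpow_le_rpow_of_nonpos hρ hx (show t - n - 1 ≤ 0 by linarith [ht.2])
  have h2 := Real.rpow_le_rpow_of_nonpos hρ hy (show t - n - 1 ≤ 0 by linarith [ht.2])
  rw [Real.rpow_one]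
  have : 0 ≤ n * ‖x - y‖ := by positivity
  nlinarith

theorem measurable_powDiff_comp {α : Type*} [MeasurableSpace α] {n : ℕ} (t : ℝ)
    {x y z : α → Rn n} (hx : Measurable x) (hy : Measurable y) (hz : Measurable z) :
    Measurable fun a => powDiff t (x a) (y a) (z a) := by
  unfold powDiff; fun_prop

/-- The `L¹` modulus of continuity of the Riesz kernel: `‖I(· + h) - I‖₁ ≤ C |h|^t`. -/
theorem exists_lintegral_powDiff_le {n : ℕ} (hn : 1 ≤ n) {t : ℝ} (ht : t ∈ Ioo (0 : ℝ) 1) :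
    ∃ C : ℝ, 0 < C ∧ ∀ h z : Rn n,
      ∫⁻ x, ENNReal.ofReal |powDiff t x (x + h) z| ≤ ENNReal.ofReal (C * ‖h‖ ^ t) := by
  obtain ⟨C₁, hC₁, h₁⟩ := exists_setLIntegral_ball_rpow_le hn ht.1
  obtain ⟨C₂, hC₂, h₂⟩ := exists_setLIntegral_compl_ball_rpow_le (n := n) (a := 1 - t)
    (by linarith [ht.2])
  refine ⟨C₁ * 2 ^ t + C₁ * 3 ^ t + (n * C₂ * 2 ^ (-(1 - t)) + n * C₂), by positivity,
    fun h z => ?_⟩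
  rcases eq_or_ne h 0 with rfl | hh
  · simp [powDiff]
  have hr : 0 < ‖h‖ := norm_pos_iff.2 hh
  set r := ‖h‖ with hrr
  have key : ∀ x : Rn n, x + h - z = x - (z - h) := fun x => by abel
  have hnear : ∫⁻ x in Metric.ball z (2 * r), ENNReal.ofReal |powDiff t x (x + h) z| ≤
      ENNReal.ofReal (C₁ * (2 * r) ^ t) + ENNReal.ofReal (C₁ * (3 * r) ^ t) := by
    calc ∫⁻ x in Metric.ball z (2 * r), ENNReal.ofReal |powDiff t x (x + h) z|
        ≤ ∫⁻ x in Metric.ball z (2 * r), (ENNReal.ofReal (‖x - z‖ ^ (t - n)) +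
            ENNReal.ofReal (‖x - (z - h)‖ ^ (t - n))) := by
          refine lintegral_mono fun x => ?_
          rw [← ENNReal.ofReal_add (by positivity) (by positivity)]
          refine ENNReal.ofReal_le_ofReal ?_
          rw [powDiff, key]
          refine (abs_sub _ _).trans ?_
          rw [abs_of_nonneg (by positivity), abs_of_nonneg (by positivity)]
      _ = (∫⁻ x in Metric.ball z (2 * r), ENNReal.ofReal (‖x - z‖ ^ (t - n))) +
            ∫⁻ x in Metric.ball z (2 * r), ENNReal.ofReal (‖x - (z - h)‖ ^ (t - n)) :=
          lintegral_add_left (by fun_prop) _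
      _ ≤ (∫⁻ x in Metric.ball z (2 * r), ENNReal.ofReal (‖x - z‖ ^ (t - n))) +
            ∫⁻ x in Metric.ball (z - h) (3 * r), ENNReal.ofReal (‖x - (z - h)‖ ^ (t - n)) := by
          gcongr
          refine Metric.ball_subset_ball' ?_
          rw [dist_eq_norm, sub_sub_cancel, ← hrr]; linarith
      _ ≤ _ := add_le_add (h₁ _ _ (by positivity)) (h₁ _ _ (by positivity))
  have hfar : ∫⁻ x in (Metric.ball z (2 * r))ᶜ, ENNReal.ofReal |powDiff t x (x + h) z| ≤
      ENNReal.ofReal (n * r) * (ENNReal.ofReal (C₂ * (2 * r) ^ (-(1 - t))) +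
        ENNReal.ofReal (C₂ * r ^ (-(1 - t)))) := by
    calc ∫⁻ x in (Metric.ball z (2 * r))ᶜ, ENNReal.ofReal |powDiff t x (x + h) z|
        ≤ ∫⁻ x in (Metric.ball z (2 * r))ᶜ, ENNReal.ofReal (n * r) *
            (ENNReal.ofReal (‖x - z‖ ^ (-(1 - t) - n)) +
            ENNReal.ofReal (‖x - (z - h)‖ ^ (-(1 - t) - n))) := by
          refine lintegral_mono fun x => ?_
          rw [← ENNReal.ofReal_add (by positivity) (by positivity),
            ← ENNReal.ofReal_mul (by positivity)]
          refine ENNReal.ofReal_le_ofReal ?_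
          have := abs_powDiff_le hn ht zero_le_one le_rfl x (x + h) z
          rw [key, sub_add_cancel_left, norm_neg, Real.rpow_one, ← hrr] at this
          rwa [show -(1 - t) - (n : ℝ) = t - n - 1 by ring]
      _ = ENNReal.ofReal (n * r) *
          ((∫⁻ x in (Metric.ball z (2 * r))ᶜ, ENNReal.ofReal (‖x - z‖ ^ (-(1 - t) - n))) +
            ∫⁻ x in (Metric.ball z (2 * r))ᶜ, ENNReal.ofReal (‖x - (z - h)‖ ^ (-(1 - t) - n))) := by
          rw [lintegral_const_mul' _ _ ENNReal.ofReal_ne_top, lintegral_add_left (by fun_prop)]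
      _ ≤ ENNReal.ofReal (n * r) *
          ((∫⁻ x in (Metric.ball z (2 * r))ᶜ, ENNReal.ofReal (‖x - z‖ ^ (-(1 - t) - n))) +
            ∫⁻ x in (Metric.ball (z - h) r)ᶜ,
              ENNReal.ofReal (‖x - (z - h)‖ ^ (-(1 - t) - n))) := by
          gcongr
          refine Metric.ball_subset_ball' ?_
          rw [dist_eq_norm, sub_sub_cancel_left, norm_neg, ← hrr]; linarith
      _ ≤ _ := by
          gcongr
          · exact h₂ _ _ (by positivity)
          · exact h₂ _ _ hr
  rw [← lintegral_add_compl _ (measurableSet_ball (x := z) (ε := 2 * r))]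
  refine (add_le_add hnear hfar).trans_eq ?_
  rw [← ENNReal.ofReal_add (by positivity) (by positivity),
    ← ENNReal.ofReal_add (by positivity) (by positivity), ← ENNReal.ofReal_mul (by positivity),
    ← ENNReal.ofReal_add (by positivity) (by positivity)]
  congr 1
  have e : r * r ^ (-(1 - t)) = r ^ t := by
    nth_rewrite 1 [← Real.rpow_one r]
    rw [← Real.rpow_add hr]; congr 1; ring
  rw [Real.mul_rpow (by norm_num) hr.le, Real.mul_rpow (by norm_num) hr.le,
    Real.mul_rpow (by norm_num) hr.le, ← e]
  ring

/-! ### The main double integral estimate -/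

/-- Integration over pairs along the fibres `y = x + h`. -/
theorem lintegral_prod_eq_lintegral_diff {n : ℕ} {F : Rn n × Rn n → ℝ≥0∞} (hF : Measurable F) :
    ∫⁻ q, F q = ∫⁻ h, ∫⁻ x, F (x, x + h) := by
  rw [Measure.volume_eq_prod, lintegral_prod _ hF.aemeasurable,
    lintegral_lintegral_swap (f := fun h x => F (x, x + h))]
  · exact lintegral_congr fun x => (lintegral_add_left_eq_self (fun y => F (x, y)) x).symm
  · exact (hF.comp (measurable_snd.prodMk (measurable_snd.add measurable_fst))).aemeasurable

/-- The off-diagonal weight: `|x - y|^{-c-n}` for `|x - y| ≥ ρ`, and `0` otherwise. -/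
noncomputable def farWeight {n : ℕ} (c ρ : ℝ) (x y : Rn n) : ℝ≥0∞ :=
  (Metric.ball x ρ)ᶜ.indicator (fun y => ENNReal.ofReal (‖y - x‖ ^ (-c - n))) y

theorem farWeight_eq {n : ℕ} (c ρ : ℝ) (x y : Rn n) :
    farWeight c ρ x y = {q : Rn n × Rn n | ρ ≤ ‖q.1 - q.2‖}.indicator
      (fun q => ENNReal.ofReal (‖q.1 - q.2‖ ^ (-c - n))) (x, y) := by
  by_cases h : ρ ≤ ‖x - y‖
  · rw [farWeight, indicator_of_mem (by simpa [dist_eq_norm, norm_sub_rev y x] using h),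
      indicator_of_mem (by simpa using h), norm_sub_rev]
  · rw [farWeight, indicator_of_notMem (by simpa [dist_eq_norm, norm_sub_rev y x] using h),
      indicator_of_notMem (by simpa using h)]

theorem farWeight_comm {n : ℕ} (c ρ : ℝ) (x y : Rn n) :
    farWeight c ρ x y = farWeight c ρ y x := by
  simp only [farWeight, indicator, mem_compl_iff, Metric.mem_ball, dist_comm y x,
    norm_sub_rev y x]

theorem measurable_farWeight {n : ℕ} (c ρ : ℝ) :
    Measurable fun q : Rn n × Rn n => farWeight c ρ q.1 q.2 := by
  simp only [farWeight_eq]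
  refine Measurable.indicator (by fun_prop) (measurableSet_le (by fun_prop) (by fun_prop))

theorem lintegral_farWeight_le {n : ℕ} {c : ℝ} (hc : 0 < c) :
    ∃ C : ℝ, 0 < C ∧ ∀ (ρ : ℝ) (x : Rn n), 0 < ρ →
      ∫⁻ y, farWeight c ρ x y ≤ ENNReal.ofReal (C * ρ ^ (-c)) := by
  obtain ⟨C, hC, h⟩ := exists_setLIntegral_compl_ball_rpow_le (n := n) hc
  refine ⟨C, hC, fun ρ x hρ => ?_⟩
  simp only [farWeight]
  rw [lintegral_indicator measurableSet_ball.compl]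
  exact h x ρ hρ

/-- The weight may be exchanged for a Riesz kernel of any small order `ε`. -/
theorem farWeight_le {n : ℕ} {c ε ρ : ℝ} (hc : 0 < c) (hε : 0 < ε) (hρ : 0 < ρ)
    (x y : Rn n) :
    farWeight c ρ x y ≤ ENNReal.ofReal (ρ ^ (-c - ε)) * ENNReal.ofReal (‖y - x‖ ^ (ε - n)) := by
  rw [farWeight]
  by_cases h : y ∈ (Metric.ball x ρ)ᶜ
  · rw [indicator_of_mem h, ← ENNReal.ofReal_mul (by positivity)]
    have h : ρ ≤ ‖y - x‖ := by simpa [dist_eq_norm] using h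
    refine ENNReal.ofReal_le_ofReal ?_
    rw [show -c - (n : ℝ) = (-c - ε) + (ε - n) by ring, Real.rpow_add (by linarith)]
    gcongr ?_ * _
    exact Real.rpow_le_rpow_of_nonpos hρ h (by linarith)
  · rw [indicator_of_notMem h]; exact zero_le

/-- Both singularities in the variable `x`: integrate the weight in `y` first. -/
theorem exists_lintegral_farWeight_mul_same_le {n : ℕ} (hn : 1 ≤ n) {a b c : ℝ} (ha : 0 < a)
    (hb : 0 < b) (hab : a + b < n) (hc : 0 < c) :
    ∃ C : ℝ, 0 < C ∧ ∀ (u v : Rn n) (d : ℝ), 0 < d → d / 2 ≤ ‖u - v‖ →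
      ∫⁻ x, ∫⁻ y, farWeight c (d / 8) x y *
        (ENNReal.ofReal (‖x - u‖ ^ (a - n)) * ENNReal.ofReal (‖x - v‖ ^ (b - n))) ≤
        ENNReal.ofReal (C * d ^ (a + b - n - c)) := by
  obtain ⟨C₁, hC₁, h₁⟩ := exists_lintegral_rpow_mul_rpow_le hn ha hb hab
  obtain ⟨C₂, hC₂, h₂⟩ := lintegral_farWeight_le (n := n) hc
  refine ⟨C₂ * (1 / 8) ^ (-c) * (C₁ * (1 / 2) ^ (a + b - n)), by positivity,
    fun u v d hd huv => ?_⟩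
  calc ∫⁻ x, ∫⁻ y, farWeight c (d / 8) x y *
        (ENNReal.ofReal (‖x - u‖ ^ (a - n)) * ENNReal.ofReal (‖x - v‖ ^ (b - n)))
      ≤ ∫⁻ x, ENNReal.ofReal (C₂ * (d / 8) ^ (-c)) *
        (ENNReal.ofReal (‖x - u‖ ^ (a - n)) * ENNReal.ofReal (‖x - v‖ ^ (b - n))) := by
        refine lintegral_mono fun x => ?_
        rw [lintegral_mul_const' _ _ (by finiteness)]
        gcongr
        exact h₂ _ _ (by positivity)
    _ ≤ ENNReal.ofReal (C₂ * (d / 8) ^ (-c)) *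
        ENNReal.ofReal (C₁ * (d / 2) ^ (a + b - n)) := by
        rw [lintegral_const_mul' _ _ (by finiteness)]
        gcongr
        refine (h₁ u v ?_).trans (ENNReal.ofReal_le_ofReal ?_)
        · rintro rfl; simp at huv; linarith
        · gcongr C₁ * ?_
          exact Real.rpow_le_rpow_of_nonpos (by positivity) huv (by linarith)
    _ = _ := by
        rw [← ENNReal.ofReal_mul (by positivity)]
        congr 1
        rw [show d / 8 = d * (1 / 8) by ring, show d / 2 = d * (1 / 2) by ring,
          Real.mul_rpow hd.le (by positivity), Real.mul_rpow hd.le (by positivity),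
          show a + b - (n : ℝ) - c = -c + (a + b - n) by ring, Real.rpow_add hd]
        ring

/-- The singularities in different variables: replacing the weight by a Riesz kernel makes the
integral a twofold composition of Riesz kernels. -/
theorem exists_lintegral_farWeight_mul_cross_le {n : ℕ} (hn : 1 ≤ n) {a b c : ℝ} (ha : 0 < a)
    (hb : 0 < b) (hab : a + b < n) (hc : 0 < c) :
    ∃ C : ℝ, 0 < C ∧ ∀ (u v : Rn n) (d : ℝ), 0 < d → d / 2 ≤ ‖u - v‖ →
      ∫⁻ x, ∫⁻ y, farWeight c (d / 8) x y *
        (ENNReal.ofReal (‖x - u‖ ^ (a - n)) * ENNReal.ofReal (‖y - v‖ ^ (b - n))) ≤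
        ENNReal.ofReal (C * d ^ (a + b - n - c)) := by
  obtain ⟨ε, hε, hεn⟩ : ∃ ε : ℝ, 0 < ε ∧ a + b + ε < n :=
    ⟨(n - a - b) / 2, by linarith, by linarith⟩
  obtain ⟨C₁, hC₁, h₁⟩ := exists_lintegral_rpow_mul_rpow_le hn hε hb (by linarith)
  obtain ⟨C₂, hC₂, h₂⟩ := exists_lintegral_rpow_mul_rpow_le hn ha (add_pos hε hb) (by linarith)
  refine ⟨(1 / 8) ^ (-c - ε) * C₁ * (C₂ * (1 / 2) ^ (a + (ε + b) - n)), by positivity,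
    fun u v d hd huv => ?_⟩
  have : Nontrivial (Rn n) := Module.nontrivial_of_finrank_pos (R := ℝ) (by simpa using Nat.succ_le_iff.1 hn)
  calc ∫⁻ x, ∫⁻ y, farWeight c (d / 8) x y *
        (ENNReal.ofReal (‖x - u‖ ^ (a - n)) * ENNReal.ofReal (‖y - v‖ ^ (b - n)))
      ≤ ∫⁻ x, ENNReal.ofReal ((d / 8) ^ (-c - ε)) * ENNReal.ofReal C₁ *
        (ENNReal.ofReal (‖x - u‖ ^ (a - n)) * ENNReal.ofReal (‖x - v‖ ^ (ε + b - n))) := by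
        refine lintegral_mono_ae ?_
        filter_upwards [Measure.ae_ne volume v] with x hx
        calc ∫⁻ y, farWeight c (d / 8) x y *
              (ENNReal.ofReal (‖x - u‖ ^ (a - n)) * ENNReal.ofReal (‖y - v‖ ^ (b - n)))
            ≤ ∫⁻ y, ENNReal.ofReal ((d / 8) ^ (-c - ε)) * ENNReal.ofReal (‖x - u‖ ^ (a - n)) *
              (ENNReal.ofReal (‖y - x‖ ^ (ε - n)) * ENNReal.ofReal (‖y - v‖ ^ (b - n))) := by
              refine lintegral_mono fun y => ?_
              refine (mul_le_mul_left (farWeight_le hc hε (by positivity) x y) _).trans_eq ?_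
              ring
          _ ≤ ENNReal.ofReal ((d / 8) ^ (-c - ε)) * ENNReal.ofReal (‖x - u‖ ^ (a - n)) *
              ENNReal.ofReal (C₁ * ‖x - v‖ ^ (ε + b - n)) := by
              rw [lintegral_const_mul' _ _ (by finiteness)]
              gcongr
              exact h₁ x v hx
          _ = _ := by rw [ENNReal.ofReal_mul hC₁.le]; ring
    _ ≤ ENNReal.ofReal ((d / 8) ^ (-c - ε)) * ENNReal.ofReal C₁ *
        ENNReal.ofReal (C₂ * (d / 2) ^ (a + (ε + b) - n)) := by
        rw [lintegral_const_mul' _ _ (by finiteness)]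
        gcongr
        refine (h₂ u v ?_).trans (ENNReal.ofReal_le_ofReal ?_)
        · rintro rfl; simp at huv; linarith
        · gcongr C₂ * ?_
          exact Real.rpow_le_rpow_of_nonpos (by positivity) huv (by linarith)
    _ = _ := by
        rw [← ENNReal.ofReal_mul (by positivity), ← ENNReal.ofReal_mul (by positivity)]
        congr 1
        rw [show d / 8 = d * (1 / 8) by ring, show d / 2 = d * (1 / 2) by ring,
          Real.mul_rpow hd.le (by positivity), Real.mul_rpow hd.le (by positivity),
          show a + b - (n : ℝ) - c = (-c - ε) + (a + (ε + b) - n) by ring, Real.rpow_add hd]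
        ring

/-- The off-diagonal part `|x - y| ≥ d / 8` of the double integral. -/
theorem exists_lintegral_farWeight_mul_le {n : ℕ} (hn : 1 ≤ n) {a b c : ℝ} (ha : 0 < a)
    (hb : 0 < b) (hab : a + b < n) (hc : 0 < c) :
    ∃ C : ℝ, 0 < C ∧ ∀ (u v : Rn n) (d : ℝ), 0 < d → d / 2 ≤ ‖u - v‖ →
      ∫⁻ q : Rn n × Rn n, farWeight c (d / 8) q.1 q.2 *
        ((ENNReal.ofReal (‖q.1 - u‖ ^ (a - n)) + ENNReal.ofReal (‖q.2 - u‖ ^ (a - n))) *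
        (ENNReal.ofReal (‖q.1 - v‖ ^ (b - n)) + ENNReal.ofReal (‖q.2 - v‖ ^ (b - n)))) ≤
        ENNReal.ofReal (C * d ^ (a + b - n - c)) := by
  obtain ⟨C₁, hC₁, h₁⟩ := exists_lintegral_farWeight_mul_same_le hn ha hb hab hc
  obtain ⟨C₂, hC₂, h₂⟩ := exists_lintegral_farWeight_mul_cross_le hn ha hb hab hc
  refine ⟨C₁ + C₂ + (C₁ + C₂), by positivity, fun u v d hd huv => ?_⟩
  have hW := measurable_farWeight (n := n) c (d / 8)
  set G : Rn n × Rn n → ℝ≥0∞ := fun q => farWeight c (d / 8) q.1 q.2 *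
    (ENNReal.ofReal (‖q.1 - u‖ ^ (a - n)) * ENNReal.ofReal (‖q.1 - v‖ ^ (b - n))) +
    farWeight c (d / 8) q.1 q.2 *
    (ENNReal.ofReal (‖q.1 - u‖ ^ (a - n)) * ENNReal.ofReal (‖q.2 - v‖ ^ (b - n))) with hG
  have hGm : Measurable G := by
    refine Measurable.add (hW.mul ?_) (hW.mul ?_) <;> fun_prop
  have hint : ∫⁻ q, G q ≤ ENNReal.ofReal (C₁ * d ^ (a + b - n - c)) +
      ENNReal.ofReal (C₂ * d ^ (a + b - n - c)) := by
    simp only [hG]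
    rw [lintegral_add_left (by exact hW.mul (by fun_prop)), Measure.volume_eq_prod,
      lintegral_prod _ (by exact (hW.mul (by fun_prop)).aemeasurable),
      lintegral_prod _ (by exact (hW.mul (by fun_prop)).aemeasurable)]
    exact add_le_add (h₁ u v d hd huv) (h₂ u v d hd huv)
  have hswap : ∫⁻ q : Rn n × Rn n, G q.swap = ∫⁻ q, G q := by
    rw [Measure.volume_eq_prod]; exact lintegral_prod_swap G
  calc _ = ∫⁻ q : Rn n × Rn n, (G q + G q.swap) := by
        refine lintegral_congr fun q => ?_
        simp only [hG, Prod.fst_swap, Prod.snd_swap, farWeight_comm c (d / 8) q.2 q.1]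
        ring
    _ = (∫⁻ q, G q) + ∫⁻ q, G q := by rw [lintegral_add_left hGm, hswap]
    _ ≤ _ := by
        refine (add_le_add hint hint).trans_eq ?_
        rw [← ENNReal.ofReal_add (by positivity) (by positivity),
          ← ENNReal.ofReal_add (by positivity) (by positivity)]
        congr 1; ring

/-- The near-diagonal part `|x - y| < d / 8` of the double integral. There `x` and `y` are both far
from `z₂`, and then the difference `powDiff s₂` is Lipschitz, or both far from `z₁` and `z₁'`, and
then `E` satisfies its pointwise bound. On the fibre `y = x + h` the other factor is integrated in
`x`, which leaves the integrable powers `|h|^{1-s₂-α-n}` and `|h|^{1-s₁-α-n}`. -/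
theorem exists_setLIntegral_near_diagonal_le {n : ℕ} (hn : 1 ≤ n) {s s₁ s₂ α : ℝ}
    (hs₁ : s₁ ∈ Ioo (0 : ℝ) 1) (hs₂ : s₂ ∈ Ioo (0 : ℝ) 1) (hsum : s₁ + s₂ = 2 * s)
    (hα₁ : α < 1 - s₁) (hα₂ : α < 1 - s₂) :
    ∃ C : ℝ, 0 < C ∧ ∀ (E : Rn n × Rn n → ℝ) (M d : ℝ) (z₁ z₁' z₂ : Rn n), Measurable E →
      0 ≤ M → 0 < d → d / 2 ≤ ‖z₁ - z₂‖ → d / 2 ≤ ‖z₁' - z₂‖ →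
      (∀ h, ∫⁻ x, ENNReal.ofReal |E (x, x + h)| ≤ ENNReal.ofReal (M * ‖h‖ ^ (s₁ - α))) →
      (∀ x y : Rn n, d / 8 ≤ ‖x - z₁‖ → d / 8 ≤ ‖x - z₁'‖ → d / 8 ≤ ‖y - z₁‖ →
        d / 8 ≤ ‖y - z₁'‖ → |E (x, y)| ≤ M * ‖x - y‖ ^ (1 - α) * d ^ (s₁ - n - 1)) →
      ∫⁻ q in {q : Rn n × Rn n | ‖q.1 - q.2‖ < d / 8},
        ENNReal.ofReal (|E q| * |powDiff s₂ q.1 q.2 z₂| / ‖q.1 - q.2‖ ^ (n + 2 * s)) ≤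
        ENNReal.ofReal (C * M * d ^ (-(n : ℝ) - α)) := by
  obtain ⟨C₁, hC₁, h₁⟩ := exists_lintegral_powDiff_le hn hs₂
  obtain ⟨C₂, hC₂, h₂⟩ := exists_setLIntegral_ball_rpow_le hn (a := 1 - s₂ - α) (by linarith)
  obtain ⟨C₃, hC₃, h₃⟩ := exists_setLIntegral_ball_rpow_le hn (a := 1 - s₁ - α) (by linarith)
  have hn1 : (1 : ℝ) ≤ n := by exact_mod_cast hn
  refine ⟨2 * n * (1 / 8) ^ (s₂ - n - 1) * C₂ * (1 / 8) ^ (1 - s₂ - α) +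
    C₁ * C₃ * (1 / 8) ^ (1 - s₁ - α), by positivity,
    fun E M d z₁ z₁' z₂ hE hM hd hz₁ hz₁' hb hc => ?_⟩
  set L : ℝ := 2 * n * (d / 8) ^ (s₂ - n - 1) with hL
  have hL0 : 0 ≤ L := by positivity
  have hset : MeasurableSet {q : Rn n × Rn n | ‖q.1 - q.2‖ < d / 8} :=
    measurableSet_lt (by fun_prop) (by fun_prop)
  have hpd : Measurable fun q : Rn n × Rn n => powDiff s₂ q.1 q.2 z₂ :=
    measurable_powDiff_comp _ measurable_fst measurable_snd measurable_const
  have hpt : ∀ h : Rn n, ‖h‖ < d / 8 → ∀ x : Rn n,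
      |E (x, x + h)| * |powDiff s₂ x (x + h) z₂| ≤ L * ‖h‖ * |E (x, x + h)| +
        M * ‖h‖ ^ (1 - α) * d ^ (s₁ - n - 1) * |powDiff s₂ x (x + h) z₂| := by
    intro h hh x
    have hxh : ‖x - (x + h)‖ = ‖h‖ := by simp
    rcases le_or_gt (d / 4) ‖x - z₂‖ with hx | hx
    · have hy : d / 8 ≤ ‖x + h - z₂‖ := by
        have : ‖x - z₂‖ ≤ ‖x + h - z₂‖ + ‖h‖ := by
          calc ‖x - z₂‖ = ‖(x + h - z₂) - h‖ := by congr 1; abel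
            _ ≤ _ := norm_sub_le _ _
        linarith
      have := abs_powDiff_le_of_le hn hs₂ (ρ := d / 8) (by positivity)
        (show d / 8 ≤ ‖x - z₂‖ by linarith) hy
      rw [hxh] at this
      have h0 : 0 ≤ M * ‖h‖ ^ (1 - α) * d ^ (s₁ - n - 1) * |powDiff s₂ x (x + h) z₂| := by
        positivity
      have h2 := mul_le_mul_of_nonneg_left this (abs_nonneg (E (x, x + h)))
      have h3 : |E (x, x + h)| * (2 * n * ‖h‖ * (d / 8) ^ (s₂ - n - 1)) =
          L * ‖h‖ * |E (x, x + h)| := by rw [hL]; ring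
      linarith
    · have e1 : ∀ z : Rn n, d / 2 ≤ ‖z - z₂‖ → d / 8 ≤ ‖x - z‖ ∧ d / 8 ≤ ‖x + h - z‖ := by
        intro z hz
        have h1 : ‖z - z₂‖ ≤ ‖x - z‖ + ‖x - z₂‖ := by
          calc ‖z - z₂‖ = ‖(x - z₂) - (x - z)‖ := by congr 1; abel
            _ ≤ _ := by rw [add_comm]; exact norm_sub_le _ _
        have h2 : ‖x - z‖ ≤ ‖x + h - z‖ + ‖h‖ := by
          calc ‖x - z‖ = ‖(x + h - z) - h‖ := by congr 1; abel
            _ ≤ _ := norm_sub_le _ _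
        constructor <;> linarith
      have := hc x (x + h) (e1 _ hz₁).1 (e1 _ hz₁').1 (e1 _ hz₁).2 (e1 _ hz₁').2
      rw [hxh] at this
      have h0 : 0 ≤ L * ‖h‖ * |E (x, x + h)| := by positivity
      have h2 := mul_le_mul_of_nonneg_right this (abs_nonneg (powDiff s₂ x (x + h) z₂))
      linarith
  -- an inequality only, because at `r = 0` the right-hand side may be `0 ^ 0 = 1`
  have hsc : ∀ r : ℝ, 0 ≤ r → ∀ e a : ℝ, a - 2 * s = e →
      (r ^ (n + 2 * s))⁻¹ * r ^ a ≤ r ^ (e - n) := by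
    intro r hr e a hae
    rcases hr.eq_or_lt with h0 | h0
    · rw [← h0, Real.zero_rpow (x := n + 2 * s) (by
        have := hs₁.1; have := hs₂.1; linarith), inv_zero, zero_mul]; positivity
    · rw [← Real.rpow_neg hr, ← Real.rpow_add h0]
      apply le_of_eq; congr 1; linarith
  calc _ = ∫⁻ h, ∫⁻ x, {q : Rn n × Rn n | ‖q.1 - q.2‖ < d / 8}.indicator (fun q =>
        ENNReal.ofReal (|E q| * |powDiff s₂ q.1 q.2 z₂| / ‖q.1 - q.2‖ ^ (n + 2 * s)))
          (x, x + h) := by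
        rw [← lintegral_indicator hset, lintegral_prod_eq_lintegral_diff]
        exact Measurable.indicator (by fun_prop) hset
    _ ≤ ∫⁻ h, (Metric.ball (0 : Rn n) (d / 8)).indicator (fun h =>
        ENNReal.ofReal (L * M) * ENNReal.ofReal (‖h - 0‖ ^ (1 - s₂ - α - n)) +
        ENNReal.ofReal (M * d ^ (s₁ - n - 1) * C₁) *
          ENNReal.ofReal (‖h - 0‖ ^ (1 - s₁ - α - n))) h := by
        refine lintegral_mono fun h => ?_
        by_cases hh : ‖h‖ < d / 8
        · rw [indicator_of_mem (by simpa using hh)]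
          calc ∫⁻ x, {q : Rn n × Rn n | ‖q.1 - q.2‖ < d / 8}.indicator (fun q =>
                ENNReal.ofReal (|E q| * |powDiff s₂ q.1 q.2 z₂| / ‖q.1 - q.2‖ ^ (n + 2 * s)))
                  (x, x + h)
              ≤ ∫⁻ x, ENNReal.ofReal (‖h‖ ^ (n + 2 * s))⁻¹ *
                (ENNReal.ofReal (L * ‖h‖) * ENNReal.ofReal |E (x, x + h)| +
                ENNReal.ofReal (M * ‖h‖ ^ (1 - α) * d ^ (s₁ - n - 1)) *
                  ENNReal.ofReal |powDiff s₂ x (x + h) z₂|) := by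
                refine lintegral_mono fun x => ?_
                rw [indicator_of_mem (by simpa using hh),
                  ← ENNReal.ofReal_mul (by positivity), ← ENNReal.ofReal_mul (by positivity),
                  ← ENNReal.ofReal_add (by positivity) (by positivity),
                  ← ENNReal.ofReal_mul (by positivity)]
                refine ENNReal.ofReal_le_ofReal ?_
                rw [sub_add_cancel_left, norm_neg, div_eq_inv_mul]
                gcongr
                exact hpt h hh x
            _ ≤ ENNReal.ofReal (‖h‖ ^ (n + 2 * s))⁻¹ *
                (ENNReal.ofReal (L * ‖h‖) * ENNReal.ofReal (M * ‖h‖ ^ (s₁ - α)) +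
                ENNReal.ofReal (M * ‖h‖ ^ (1 - α) * d ^ (s₁ - n - 1)) *
                  ENNReal.ofReal (C₁ * ‖h‖ ^ s₂)) := by
                rw [lintegral_const_mul' _ _ ENNReal.ofReal_ne_top, lintegral_add_left (by
                    have : Measurable fun x => E (x, x + h) := hE.comp (by fun_prop)
                    fun_prop),
                  lintegral_const_mul' _ _ ENNReal.ofReal_ne_top,
                  lintegral_const_mul' _ _ ENNReal.ofReal_ne_top]
                gcongr
                · exact hb h
                · exact h₁ h z₂
            _ ≤ _ := by
                rw [← ENNReal.ofReal_mul (by positivity), ← ENNReal.ofReal_mul (by positivity),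
                  ← ENNReal.ofReal_add (by positivity) (by positivity),
                  ← ENNReal.ofReal_mul (by positivity), ← ENNReal.ofReal_mul (by positivity),
                  ← ENNReal.ofReal_mul (by positivity),
                  ← ENNReal.ofReal_add (by positivity) (by positivity), sub_zero]
                refine ENNReal.ofReal_le_ofReal ?_
                have k1 : ‖h‖ * ‖h‖ ^ (s₁ - α) = ‖h‖ ^ (1 + s₁ - α) := by
                  rcases (norm_nonneg h).eq_or_lt with h0 | h0
                  · rw [← h0, zero_mul, Real.zero_rpow]; have := hs₁.1; have := hs₂.2; linarith
                  · nth_rewrite 1 [← Real.rpow_one ‖h‖]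
                    rw [← Real.rpow_add h0]; congr 1; ring
                have k2 : ‖h‖ ^ (1 - α) * ‖h‖ ^ s₂ = ‖h‖ ^ (1 + s₂ - α) := by
                  rcases (norm_nonneg h).eq_or_lt with h0 | h0
                  · rw [← h0, Real.zero_rpow (x := s₂) hs₂.1.ne', mul_zero, Real.zero_rpow]
                    have := hs₁.2; have := hs₂.1; linarith
                  · rw [← Real.rpow_add h0]; congr 1; ring
                have m1 := hsc ‖h‖ (norm_nonneg _) (1 - s₂ - α)
                  (1 + s₁ - α) (by linarith)
                have m2 := hsc ‖h‖ (norm_nonneg _) (1 - s₁ - α)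
                  (1 + s₂ - α) (by linarith)
                rw [← k1] at m1
                rw [← k2] at m2
                calc _ = L * M * ((‖h‖ ^ (n + 2 * s))⁻¹ * (‖h‖ * ‖h‖ ^ (s₁ - α))) +
                    M * d ^ (s₁ - n - 1) * C₁ *
                      ((‖h‖ ^ (n + 2 * s))⁻¹ * (‖h‖ ^ (1 - α) * ‖h‖ ^ s₂)) := by ring
                  _ ≤ _ := by gcongr
        · rw [indicator_of_notMem (by simpa using hh)]
          refine (lintegral_eq_zero_of_ae_eq_zero ?_).le
          refine Filter.Eventually.of_forall fun x => ?_
          exact indicator_of_notMem (by simpa using hh) _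
    _ ≤ ENNReal.ofReal (L * M) * ENNReal.ofReal (C₂ * (d / 8) ^ (1 - s₂ - α)) +
        ENNReal.ofReal (M * d ^ (s₁ - n - 1) * C₁) *
          ENNReal.ofReal (C₃ * (d / 8) ^ (1 - s₁ - α)) := by
        rw [lintegral_indicator measurableSet_ball, lintegral_add_left (by fun_prop),
          lintegral_const_mul' _ _ ENNReal.ofReal_ne_top,
          lintegral_const_mul' _ _ ENNReal.ofReal_ne_top]
        gcongr
        · exact h₂ _ _ (by positivity)
        · exact h₃ _ _ (by positivity)
    _ = _ := by
        rw [← ENNReal.ofReal_mul (by positivity), ← ENNReal.ofReal_mul (by positivity),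
          ← ENNReal.ofReal_add (by positivity) (by positivity)]
        congr 1
        have hd' : d ^ (-(n : ℝ) - α) = d ^ (s₂ - n - 1) * d ^ (1 - s₂ - α) := by
          rw [← Real.rpow_add hd]; congr 1; ring
        have hd'' : d ^ (-(n : ℝ) - α) = d ^ (s₁ - n - 1) * d ^ (1 - s₁ - α) := by
          rw [← Real.rpow_add hd]; congr 1; ring
        rw [hL, show d / 8 = d * (1 / 8) by ring, Real.mul_rpow hd.le (by positivity),
          Real.mul_rpow hd.le (by positivity), Real.mul_rpow hd.le (by positivity), add_mul,
          add_mul]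
        congr 1
        · rw [hd']; ring
        · rw [hd'']; ring

/-- The double integral of `|E(x,y)| ||x-z₂|^{s₂-n} - |y-z₂|^{s₂-n}| / |x-y|^{n+2s}` for a function
`E` that behaves like `|h|^α` times a difference of Riesz kernels with poles `z₁` and `z₁'`, all at
distance comparable to `d` from `z₂`. The size of the kernel is the case `α = 0`; its regularity is
the case where `E` is the increment of such a difference in its pole. -/
theorem exists_lintegral_mul_powDiff_le {n : ℕ} (hn : 1 ≤ n) {s s₁ s₂ α : ℝ}
    (hs₁ : s₁ ∈ Ioo (0 : ℝ) 1) (hs₂ : s₂ ∈ Ioo (0 : ℝ) 1) (hsum : s₁ + s₂ = 2 * s)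
    (hα : 0 ≤ α) (hα₁ : α < 1 - s₁) (hα₂ : α < 1 - s₂) :
    ∃ C : ℝ, 0 < C ∧ ∀ (E : Rn n × Rn n → ℝ) (M d : ℝ) (z₁ z₁' z₂ : Rn n), Measurable E →
      0 ≤ M → 0 < d → d / 2 ≤ ‖z₁ - z₂‖ → d / 2 ≤ ‖z₁' - z₂‖ →
      (∀ x y : Rn n, |E (x, y)| ≤ M * ‖x - y‖ ^ (s₁ / 2 - α) *
        ((‖x - z₁‖ ^ (s₁ / 2 - n) + ‖y - z₁‖ ^ (s₁ / 2 - n)) +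
          (‖x - z₁'‖ ^ (s₁ / 2 - n) + ‖y - z₁'‖ ^ (s₁ / 2 - n)))) →
      (∀ h, ∫⁻ x, ENNReal.ofReal |E (x, x + h)| ≤ ENNReal.ofReal (M * ‖h‖ ^ (s₁ - α))) →
      (∀ x y : Rn n, d / 8 ≤ ‖x - z₁‖ → d / 8 ≤ ‖x - z₁'‖ → d / 8 ≤ ‖y - z₁‖ →
        d / 8 ≤ ‖y - z₁'‖ → |E (x, y)| ≤ M * ‖x - y‖ ^ (1 - α) * d ^ (s₁ - n - 1)) →
      ∫⁻ q : Rn n × Rn n,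
        ENNReal.ofReal (|E q| * |powDiff s₂ q.1 q.2 z₂| / ‖q.1 - q.2‖ ^ (n + 2 * s)) ≤
        ENNReal.ofReal (C * M * d ^ (-(n : ℝ) - α)) := by
  have hn1 : (1 : ℝ) ≤ n := by exact_mod_cast hn
  obtain ⟨C₁, hC₁, h₁⟩ := exists_setLIntegral_near_diagonal_le hn hs₁ hs₂ hsum hα₁ hα₂
  obtain ⟨C₂, hC₂, h₂⟩ := exists_lintegral_farWeight_mul_le hn (half_pos hs₁.1) (half_pos hs₂.1)
    (by linarith [hs₁.2, hs₂.2]) (c := s + α) (by linarith [hs₁.1, hs₂.1])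
  refine ⟨C₁ + n * (C₂ + C₂), by positivity,
    fun E M d z₁ z₁' z₂ hE hM hd hz₁ hz₁' ha hb hc => ?_⟩
  have hset : MeasurableSet {q : Rn n × Rn n | ‖q.1 - q.2‖ < d / 8} :=
    measurableSet_lt (by fun_prop) (by fun_prop)
  have hW := measurable_farWeight (n := n) (s + α) (d / 8)
  have hfar : ∫⁻ q in {q : Rn n × Rn n | ‖q.1 - q.2‖ < d / 8}ᶜ,
      ENNReal.ofReal (|E q| * |powDiff s₂ q.1 q.2 z₂| / ‖q.1 - q.2‖ ^ (n + 2 * s)) ≤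
      ENNReal.ofReal (n * (C₂ + C₂) * M * d ^ (-(n : ℝ) - α)) := by
    set G : Rn n → Rn n × Rn n → ℝ≥0∞ := fun u q => farWeight (s + α) (d / 8) q.1 q.2 *
        ((ENNReal.ofReal (‖q.1 - u‖ ^ (s₁ / 2 - n)) + ENNReal.ofReal (‖q.2 - u‖ ^ (s₁ / 2 - n))) *
        (ENNReal.ofReal (‖q.1 - z₂‖ ^ (s₂ / 2 - n)) +
          ENNReal.ofReal (‖q.2 - z₂‖ ^ (s₂ / 2 - n)))) with hG
    have hGm : ∀ u, Measurable (G u) := fun u => by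
      refine hW.mul ?_
      fun_prop
    -- the exponent `γ = s₂ / 2` leaves `|x - y|^{-n-s-α}`, integrable off the diagonal, and
    -- Riesz kernels of the orders `s₁ / 2` and `s₂ / 2`, which are locally integrable
    calc _ ≤ ∫⁻ q in {q : Rn n × Rn n | ‖q.1 - q.2‖ < d / 8}ᶜ,
          ENNReal.ofReal (M * n) * (G z₁ q + G z₁' q) := by
          refine setLIntegral_mono ?_ fun q hq => ?_
          · exact ((hGm z₁).add (hGm z₁')).const_mul _
          have hq : d / 8 ≤ ‖q.1 - q.2‖ := by simpa using hq
          have hr : 0 < ‖q.1 - q.2‖ := by linarith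
          have hWq : farWeight (s + α) (d / 8) q.1 q.2 =
              ENNReal.ofReal (‖q.1 - q.2‖ ^ (-(s + α) - n)) := by
            rw [farWeight_eq, indicator_of_mem (by simpa using hq)]
          simp only [hG, hWq]
          rw [← mul_add, ← add_mul]
          rw [← ENNReal.ofReal_add (by positivity) (by positivity),
            ← ENNReal.ofReal_add (by positivity) (by positivity),
            ← ENNReal.ofReal_add (by positivity) (by positivity),
            ← ENNReal.ofReal_add (by positivity) (by positivity),
            ← ENNReal.ofReal_mul (by positivity), ← ENNReal.ofReal_mul (by positivity),
            ← ENNReal.ofReal_mul (by positivity)]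
          refine ENNReal.ofReal_le_ofReal ?_
          have hD := abs_powDiff_le hn hs₂ (γ := s₂ / 2) (by linarith [hs₂.1])
            (by linarith [hs₂.2]) q.1 q.2 z₂
          rw [show s₂ - n - s₂ / 2 = s₂ / 2 - (n : ℝ) by ring] at hD
          have hpow : ‖q.1 - q.2‖ ^ (s₁ / 2 - α) * ‖q.1 - q.2‖ ^ (s₂ / 2) =
              ‖q.1 - q.2‖ ^ (-(s + α) - n) * ‖q.1 - q.2‖ ^ (n + 2 * s) := by
            rw [← Real.rpow_add hr, ← Real.rpow_add hr]; congr 1; linarith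
          rw [div_le_iff₀ (by positivity)]
          refine (mul_le_mul (ha q.1 q.2) hD (abs_nonneg _) (by positivity)).trans_eq ?_
          generalize ((‖q.1 - z₁‖ ^ (s₁ / 2 - n) + ‖q.2 - z₁‖ ^ (s₁ / 2 - n)) +
            (‖q.1 - z₁'‖ ^ (s₁ / 2 - n) + ‖q.2 - z₁'‖ ^ (s₁ / 2 - n)) : ℝ) = S
          generalize (‖q.1 - z₂‖ ^ (s₂ / 2 - n) + ‖q.2 - z₂‖ ^ (s₂ / 2 - n) : ℝ) = S'
          calc _ = M * n * S * S' * (‖q.1 - q.2‖ ^ (s₁ / 2 - α) * ‖q.1 - q.2‖ ^ (s₂ / 2)) := by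
                ring
            _ = _ := by rw [hpow]; ring
      _ ≤ ∫⁻ q, ENNReal.ofReal (M * n) * (G z₁ q + G z₁' q) := setLIntegral_le_lintegral _ _
      _ ≤ ENNReal.ofReal (M * n) *
          (ENNReal.ofReal (C₂ * d ^ (s₁ / 2 + s₂ / 2 - n - (s + α))) +
            ENNReal.ofReal (C₂ * d ^ (s₁ / 2 + s₂ / 2 - n - (s + α)))) := by
          rw [lintegral_const_mul' _ _ ENNReal.ofReal_ne_top, lintegral_add_left (hGm _)]
          gcongr
          · exact h₂ _ _ _ hd hz₁
          · exact h₂ _ _ _ hd hz₁'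
      _ = _ := by
          rw [← ENNReal.ofReal_add (by positivity) (by positivity),
            ← ENNReal.ofReal_mul (by positivity),
            show s₁ / 2 + s₂ / 2 - n - (s + α) = -(n : ℝ) - α by linarith]
          congr 1; ring
  rw [← lintegral_add_compl _ hset]
  refine (add_le_add (h₁ E M d z₁ z₁' z₂ hE hM hd hz₁ hz₁' hb hc) hfar).trans_eq ?_
  rw [← ENNReal.ofReal_add (by positivity) (by positivity)]
  congr 1; ring

/-! ### Size and regularity of the kernel -/

theorem exists_lintegral_kernel_size_le {n : ℕ} (hn : 1 ≤ n) {s s₁ s₂ : ℝ}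
    (hs₁ : s₁ ∈ Ioo (0 : ℝ) 1) (hs₂ : s₂ ∈ Ioo (0 : ℝ) 1) (hsum : s₁ + s₂ = 2 * s) :
    ∃ C : ℝ, 0 < C ∧ ∀ z₁ z₂ : Rn n, z₁ ≠ z₂ →
      ∫⁻ q : Rn n × Rn n, ENNReal.ofReal
        (|powDiff s₁ q.1 q.2 z₁| * |powDiff s₂ q.1 q.2 z₂| / ‖q.1 - q.2‖ ^ (n + 2 * s)) ≤
        ENNReal.ofReal (C * ‖z₁ - z₂‖ ^ (-(n : ℝ))) := by
  obtain ⟨C₁, hC₁, h₁⟩ := exists_lintegral_mul_powDiff_le hn hs₁ hs₂ hsum le_rfl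
    (by linarith [hs₁.2]) (by linarith [hs₂.2])
  obtain ⟨C₂, hC₂, h₂⟩ := exists_lintegral_powDiff_le hn hs₁
  set M : ℝ := n + C₂ + 2 * n * (1 / 8) ^ (s₁ - n - 1) with hM
  have hM1 : n ≤ M := by rw [hM]; have : 0 ≤ 2 * n * (1 / 8 : ℝ) ^ (s₁ - n - 1) := by positivity
                         linarith
  have hM2 : C₂ ≤ M := by rw [hM]; have : 0 ≤ 2 * n * (1 / 8 : ℝ) ^ (s₁ - n - 1) := by positivity
                          have : (0 : ℝ) ≤ n := by positivity
                          linarith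
  have hM3 : 2 * n * (1 / 8) ^ (s₁ - n - 1) ≤ M := by
    rw [hM]; have : (0 : ℝ) ≤ n := by positivity
    linarith
  have hM0 : 0 < M := by linarith
  refine ⟨C₁ * M, by positivity, fun z₁ z₂ hz => ?_⟩
  have hd : 0 < ‖z₁ - z₂‖ := norm_pos_iff.2 (sub_ne_zero.2 hz)
  have := h₁ (fun q => powDiff s₁ q.1 q.2 z₁) M ‖z₁ - z₂‖ z₁ z₁ z₂
    (measurable_powDiff_comp _ measurable_fst measurable_snd measurable_const) hM0.le hd
    (by linarith) (by linarith) ?_ ?_ ?_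
  · simpa using this
  · intro x y
    refine (abs_powDiff_le hn hs₁ (γ := s₁ / 2) (by linarith [hs₁.1])
            (by linarith [hs₁.2]) x y z₁).trans ?_
    rw [show s₁ - n - s₁ / 2 = s₁ / 2 - (n : ℝ) by ring, sub_zero]
    exact mul_le_mul (by gcongr) (le_add_of_nonneg_right (by positivity)) (by positivity)
      (by positivity)
  · intro h
    refine (h₂ h z₁).trans (ENNReal.ofReal_le_ofReal ?_)
    rw [sub_zero]; gcongr
  · intro x y hx _ hy _
    refine (abs_powDiff_le_of_le hn hs₁ (by positivity) hx hy).trans ?_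
    rw [show ‖z₁ - z₂‖ / 8 = ‖z₁ - z₂‖ * (1 / 8) by ring, Real.mul_rpow hd.le (by norm_num),
      sub_zero, Real.rpow_one]
    calc _ = 2 * n * (1 / 8 : ℝ) ^ (s₁ - n - 1) * ‖x - y‖ * ‖z₁ - z₂‖ ^ (s₁ - n - 1) := by ring
      _ ≤ _ := by gcongr

/-- If a quantity is at most `K r^p` and at most `K η^p`, it is at most `K η^α r^{p-α}`. -/
theorem le_mul_rpow_mul_rpow {X K r η p α : ℝ} (hK : 0 ≤ K) (hr : 0 ≤ r) (hη : 0 ≤ η)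
    (hα : 0 ≤ α) (hαp : α ≤ p) (h₁ : X ≤ K * r ^ p) (h₂ : X ≤ K * η ^ p) :
    X ≤ K * η ^ α * r ^ (p - α) := by
  rw [mul_assoc]
  rcases le_total r η with h | h
  · refine h₁.trans (mul_le_mul_of_nonneg_left ?_ hK)
    have : r ^ p = r ^ α * r ^ (p - α) := by
      rw [← Real.rpow_add_of_nonneg hr hα (by linarith)]; congr 1; ring
    rw [this]
    gcongr
  · refine h₂.trans (mul_le_mul_of_nonneg_left ?_ hK)
    have : η ^ p = η ^ α * η ^ (p - α) := by
      rw [← Real.rpow_add_of_nonneg hη hα (by linarith)]; congr 1; ring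
    rw [this]
    gcongr

theorem ofReal_le_mul_rpow_mul_rpow {X : ℝ≥0∞} {K r η p α : ℝ} (hK : 0 ≤ K) (hr : 0 ≤ r)
    (hη : 0 ≤ η) (hα : 0 ≤ α) (hαp : α ≤ p) (h₁ : X ≤ ENNReal.ofReal (K * r ^ p))
    (h₂ : X ≤ ENNReal.ofReal (K * η ^ p)) : X ≤ ENNReal.ofReal (K * η ^ α * r ^ (p - α)) := by
  have hX : X ≠ ⊤ := ne_top_of_le_ne_top ENNReal.ofReal_ne_top h₁
  rw [ENNReal.le_ofReal_iff_toReal_le hX (by positivity)] at h₁ h₂ ⊢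
  exact le_mul_rpow_mul_rpow hK hr hη hα hαp h₁ h₂

/-- The regularity of the kernel in its first variable. The increment `E` of `powDiff s₁` in the
pole is a mixed second difference of the Riesz kernel, with steps `x - y` and `h`; each of the three
bounds that `exists_lintegral_mul_powDiff_le` requires is obtained with either step and
interpolated. -/
theorem exists_lintegral_kernel_regularity_le {n : ℕ} (hn : 1 ≤ n) {s s₁ s₂ α : ℝ}
    (hs₁ : s₁ ∈ Ioo (0 : ℝ) 1) (hs₂ : s₂ ∈ Ioo (0 : ℝ) 1) (hsum : s₁ + s₂ = 2 * s)
    (hα : 0 ≤ α) (hα₁ : α < 1 - s₁) (hα₂ : α < 1 - s₂) (hα₃ : α ≤ s₁ / 2) :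
    ∃ C : ℝ, 0 < C ∧ ∀ z₁ z₂ h : Rn n, z₁ ≠ z₂ → ‖h‖ ≤ ‖z₁ - z₂‖ / 2 →
      ∫⁻ q : Rn n × Rn n, ENNReal.ofReal
        (|powDiff s₁ q.1 q.2 (z₁ + h) - powDiff s₁ q.1 q.2 z₁| * |powDiff s₂ q.1 q.2 z₂| /
          ‖q.1 - q.2‖ ^ (n + 2 * s)) ≤
        ENNReal.ofReal (C * ‖h‖ ^ α * ‖z₁ - z₂‖ ^ (-(n : ℝ) - α)) := by
  obtain ⟨C₁, hC₁, h₁⟩ := exists_lintegral_mul_powDiff_le hn hs₁ hs₂ hsum hα hα₁ hα₂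
  obtain ⟨C₂, hC₂, h₂⟩ := exists_lintegral_powDiff_le hn hs₁
  have hn1 : (1 : ℝ) ≤ n := by exact_mod_cast hn
  set c8 : ℝ := 4 * n * (1 / 8) ^ (s₁ - n - 1) with hc8
  have hc80 : 0 ≤ c8 := by positivity
  set N : ℝ := n + 2 * C₂ + c8 with hN
  refine ⟨C₁ * N, by positivity, fun z₁ z₂ h hz hh => ?_⟩
  have hd : 0 < ‖z₁ - z₂‖ := norm_pos_iff.2 (sub_ne_zero.2 hz)
  set d := ‖z₁ - z₂‖ with hdd
  have hz' : d / 2 ≤ ‖z₁ + h - z₂‖ := by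
    have : d ≤ ‖z₁ + h - z₂‖ + ‖h‖ := by
      calc d = ‖(z₁ + h - z₂) - h‖ := by rw [hdd]; congr 1; abel
        _ ≤ _ := norm_sub_le _ _
    linarith
  set E : Rn n × Rn n → ℝ := fun q => powDiff s₁ q.1 q.2 (z₁ + h) - powDiff s₁ q.1 q.2 z₁ with hE
  have hEm : Measurable E :=
    (measurable_powDiff_comp _ measurable_fst measurable_snd measurable_const).sub
    (measurable_powDiff_comp _ measurable_fst measurable_snd measurable_const)
  -- moving the pole by `h` is moving both points by `-h`
  have hE2 : ∀ x y, E (x, y) = powDiff s₁ (x - h) x z₁ - powDiff s₁ (y - h) y z₁ := by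
    intro x y
    simp only [hE, powDiff, show ∀ x : Rn n, x - (z₁ + h) = x - h - z₁ from fun x => by abel]
    ring
  have hxh : ∀ x : Rn n, ‖x - h - x‖ = ‖h‖ := fun x => by simp
  have hxz : ∀ x : Rn n, x - h - z₁ = x - (z₁ + h) := fun x => by abel
  have := h₁ E (N * ‖h‖ ^ α) d z₁ (z₁ + h) z₂ hEm (by positivity) hd (by linarith) hz' ?_ ?_ ?_
  · refine this.trans_eq ?_
    congr 1; ring
  · intro x y
    set S : ℝ := (‖x - z₁‖ ^ (s₁ / 2 - n) + ‖y - z₁‖ ^ (s₁ / 2 - n)) +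
      (‖x - (z₁ + h)‖ ^ (s₁ / 2 - n) + ‖y - (z₁ + h)‖ ^ (s₁ / 2 - n)) with hS
    have hS0 : 0 ≤ S := by positivity
    have hp : ∀ x y z : Rn n, |powDiff s₁ x y z| ≤ n * ‖x - y‖ ^ (s₁ / 2) *
        (‖x - z‖ ^ (s₁ / 2 - n) + ‖y - z‖ ^ (s₁ / 2 - n)) := fun x y z => by
      have := abs_powDiff_le hn hs₁ (γ := s₁ / 2) (by linarith [hs₁.1])
            (by linarith [hs₁.2]) x y z
      rwa [show s₁ - n - s₁ / 2 = s₁ / 2 - (n : ℝ) by ring] at this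
    have b1 : |E (x, y)| ≤ (n * S) * ‖x - y‖ ^ (s₁ / 2) := by
      calc |E (x, y)| ≤ |powDiff s₁ x y (z₁ + h)| + |powDiff s₁ x y z₁| := abs_sub _ _
        _ ≤ _ := add_le_add (hp _ _ _) (hp _ _ _)
        _ = _ := by rw [hS]; ring
    have b2 : |E (x, y)| ≤ (n * S) * ‖h‖ ^ (s₁ / 2) := by
      calc |E (x, y)| ≤ |powDiff s₁ (x - h) x z₁| + |powDiff s₁ (y - h) y z₁| := by
            rw [hE2]; exact abs_sub _ _
        _ ≤ _ := add_le_add (hp _ _ _) (hp _ _ _)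
        _ = _ := by rw [hxh, hxh, hxz, hxz, hS]; ring
    have b3 := le_mul_rpow_mul_rpow (by positivity) (norm_nonneg _) (norm_nonneg _) hα hα₃ b1 b2
    calc _ ≤ _ := b3
      _ = n * ‖h‖ ^ α * ‖x - y‖ ^ (s₁ / 2 - α) * S := by ring
      _ ≤ _ := by
        gcongr
        linarith
  · intro k
    have b1 : ∫⁻ x, ENNReal.ofReal |E (x, x + k)| ≤ ENNReal.ofReal (2 * C₂ * ‖k‖ ^ s₁) := by
      calc ∫⁻ x, ENNReal.ofReal |E (x, x + k)|
          ≤ ∫⁻ x, (ENNReal.ofReal |powDiff s₁ x (x + k) (z₁ + h)| +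
            ENNReal.ofReal |powDiff s₁ x (x + k) z₁|) := by
            refine lintegral_mono fun x => ?_
            rw [← ENNReal.ofReal_add (abs_nonneg _) (abs_nonneg _)]
            exact ENNReal.ofReal_le_ofReal (abs_sub _ _)
        _ ≤ ENNReal.ofReal (C₂ * ‖k‖ ^ s₁) + ENNReal.ofReal (C₂ * ‖k‖ ^ s₁) := by
            rw [lintegral_add_left (Measurable.ennreal_ofReal (measurable_powDiff_comp s₁
              (x := fun x : Rn n => x) (y := fun x => x + k) (z := fun _ => z₁ + h)
              (by fun_prop) (by fun_prop) (by fun_prop)).abs)]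
            exact add_le_add (h₂ _ _) (h₂ _ _)
        _ = _ := by
            rw [← ENNReal.ofReal_add (by positivity) (by positivity)]; congr 1; ring
    have b2 : ∫⁻ x, ENNReal.ofReal |E (x, x + k)| ≤ ENNReal.ofReal (2 * C₂ * ‖h‖ ^ s₁) := by
      have hF : ∫⁻ x, ENNReal.ofReal |powDiff s₁ (x - h) x z₁| ≤
          ENNReal.ofReal (C₂ * ‖h‖ ^ s₁) := by
        rw [← lintegral_add_right_eq_self _ h]
        simpa using h₂ h z₁
      have hF' : ∫⁻ x, ENNReal.ofReal |powDiff s₁ (x + k - h) (x + k) z₁| ≤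
          ENNReal.ofReal (C₂ * ‖h‖ ^ s₁) :=
        (lintegral_add_right_eq_self
          (fun x => ENNReal.ofReal |powDiff s₁ (x - h) x z₁|) k).trans_le hF
      calc ∫⁻ x, ENNReal.ofReal |E (x, x + k)|
          ≤ ∫⁻ x, (ENNReal.ofReal |powDiff s₁ (x - h) x z₁| +
            ENNReal.ofReal |powDiff s₁ (x + k - h) (x + k) z₁|) := by
            refine lintegral_mono fun x => ?_
            rw [← ENNReal.ofReal_add (abs_nonneg _) (abs_nonneg _), hE2]
            exact ENNReal.ofReal_le_ofReal (abs_sub _ _)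
        _ ≤ ENNReal.ofReal (C₂ * ‖h‖ ^ s₁) + ENNReal.ofReal (C₂ * ‖h‖ ^ s₁) := by
            rw [lintegral_add_left (Measurable.ennreal_ofReal (measurable_powDiff_comp s₁
              (x := fun x : Rn n => x - h) (y := fun x => x) (z := fun _ => z₁)
              (by fun_prop) (by fun_prop) (by fun_prop)).abs)]
            exact add_le_add hF hF'
        _ = _ := by
            rw [← ENNReal.ofReal_add (by positivity) (by positivity)]; congr 1; ring
    refine (ofReal_le_mul_rpow_mul_rpow (by positivity) (norm_nonneg _) (norm_nonneg _) hα
      (by linarith [hs₁.1]) b1 b2).trans (ENNReal.ofReal_le_ofReal ?_)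
    gcongr
    linarith
  · intro x y hx hx' hy hy'
    have e8 : (d / 8) ^ (s₁ - n - 1) = (1 / 8) ^ (s₁ - n - 1) * d ^ (s₁ - n - 1) := by
      rw [show d / 8 = (1 / 8) * d by ring, Real.mul_rpow (by norm_num) hd.le]
    have b1 : |E (x, y)| ≤ (c8 * d ^ (s₁ - n - 1)) * ‖x - y‖ ^ (1 : ℝ) := by
      calc |E (x, y)| ≤ |powDiff s₁ x y (z₁ + h)| + |powDiff s₁ x y z₁| := abs_sub _ _
        _ ≤ _ := add_le_add (abs_powDiff_le_of_le hn hs₁ (by positivity) hx' hy')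
          (abs_powDiff_le_of_le hn hs₁ (by positivity) hx hy)
        _ = _ := by rw [e8, Real.rpow_one, hc8]; ring
    have b2 : |E (x, y)| ≤ (c8 * d ^ (s₁ - n - 1)) * ‖h‖ ^ (1 : ℝ) := by
      rw [← hxz] at hx' hy'
      calc |E (x, y)| ≤ |powDiff s₁ (x - h) x z₁| + |powDiff s₁ (y - h) y z₁| := by
            rw [hE2]; exact abs_sub _ _
        _ ≤ _ := add_le_add (abs_powDiff_le_of_le hn hs₁ (by positivity) hx' hx)
          (abs_powDiff_le_of_le hn hs₁ (by positivity) hy' hy)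
        _ = _ := by rw [hxh, hxh, e8, Real.rpow_one, hc8]; ring
    have b3 := le_mul_rpow_mul_rpow (by positivity) (norm_nonneg _) (norm_nonneg _) hα
      (by linarith [hs₁.1]) b1 b2
    calc _ ≤ _ := b3
      _ = c8 * ‖h‖ ^ α * ‖x - y‖ ^ (1 - α) * d ^ (s₁ - n - 1) := by ring
      _ ≤ _ := by
        gcongr
        linarith

/-! ### The Fourier transform of the difference of Riesz kernels -/

/-- The difference `u ↦ |u + h|^{t-n} - |u|^{t-n}` of Riesz kernels, as a complex function. -/
noncomputable def rieszDiff {n : ℕ} (t : ℝ) (h u : Rn n) : ℂ := (powDiff t (u + h) u 0 : ℝ)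

theorem measurable_rieszDiff {n : ℕ} (t : ℝ) (h : Rn n) : Measurable (rieszDiff t h) :=
  Complex.measurable_ofReal.comp (measurable_powDiff_comp t (x := fun u : Rn n => u + h)
    (y := fun u => u) (z := fun _ => 0) (by fun_prop) (by fun_prop) (by fun_prop))

theorem exists_lintegral_rieszDiff_le {n : ℕ} (hn : 1 ≤ n) {t : ℝ} (ht : t ∈ Ioo (0 : ℝ) 1) :
    ∃ C : ℝ, 0 < C ∧ ∀ h : Rn n, ∫⁻ u, ‖rieszDiff t h u‖ₑ ≤ ENNReal.ofReal (C * ‖h‖ ^ t) := by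
  obtain ⟨C, hC, h⟩ := exists_lintegral_powDiff_le hn ht
  refine ⟨C, hC, fun k => (lintegral_congr fun u => ?_).trans_le (h k 0)⟩
  rw [rieszDiff, powDiff_swap, ← ofReal_norm, Complex.norm_real, norm_neg,
    Real.norm_eq_abs]

theorem integrable_rieszDiff {n : ℕ} (hn : 1 ≤ n) {t : ℝ} (ht : t ∈ Ioo (0 : ℝ) 1) (h : Rn n) :
    Integrable (rieszDiff t h) := by
  obtain ⟨C, hC, hh⟩ := exists_lintegral_rieszDiff_le hn ht
  exact ⟨(measurable_rieszDiff t h).aestronglyMeasurable,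
    (hh h).trans_lt ENNReal.ofReal_lt_top⟩

open FourierTransform Real in
theorem fourier_comp_add_right {n : ℕ} (f : Rn n → ℂ) (a ξ : Rn n) :
    𝓕 (fun v => f (v + a)) ξ = (𝐞 (inner ℝ a ξ) : ℂ) * 𝓕 f ξ := by
  have := congrFun (VectorFourier.fourierIntegral_comp_add_right 𝐞 (volume : Measure (Rn n))
    (innerₗ (Rn n)) f a) ξ
  simpa [Circle.smul_def] using! this

open FourierTransform Real in
/-- Both sides are the Fourier transform of the mixed second difference of the Riesz kernel. -/
theorem fourier_rieszDiff_mul_comm {n : ℕ} (hn : 1 ≤ n) {t : ℝ} (ht : t ∈ Ioo (0 : ℝ) 1)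
    (h k ξ : Rn n) :
    ((𝐞 (inner ℝ k ξ) : ℂ) - 1) * 𝓕 (rieszDiff t h) ξ =
      ((𝐞 (inner ℝ h ξ) : ℂ) - 1) * 𝓕 (rieszDiff t k) ξ := by
  have key : ∀ h k : Rn n, ((𝐞 (inner ℝ k ξ) : ℂ) - 1) * 𝓕 (rieszDiff t h) ξ =
      𝓕 (fun u => rieszDiff t h (u + k) - rieszDiff t h u) ξ := by
    intro h k
    have h1 := integrable_rieszDiff hn ht h
    have h2 := h1.comp_add_right k
    rw [sub_mul, one_mul, ← fourier_comp_add_right, Real.fourier_eq, Real.fourier_eq,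
      Real.fourier_eq, ← integral_sub]
    · simp only [smul_sub]
    · exact (Real.fourierIntegral_convergent_iff ξ).2 h2
    · exact (Real.fourierIntegral_convergent_iff ξ).2 h1
  rw [key, key]
  refine congrArg (fun f : Rn n → ℂ => 𝓕 f ξ) (funext fun u => ?_)
  simp only [rieszDiff, powDiff]
  rw [show u + k + h = u + h + k by abel]
  push_cast
  ring

open FourierTransform Real in
theorem norm_fourierChar_sub_one_le (x : ℝ) : ‖(𝐞 x : ℂ) - 1‖ ≤ 2 * π * |x| := by
  have := @Real.norm_exp_I_mul_ofReal_sub_one_le (2 * π * x)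
  rw [Real.fourierChar_apply, mul_comm]
  refine this.trans_eq ?_
  rw [norm_mul, Real.norm_of_nonneg (by positivity), Real.norm_eq_abs]

open FourierTransform Real in
/-- The decay of the Fourier transform of the difference of Riesz kernels, without computing the
transform: `fourier_rieszDiff_mul_comm` allows the shift `h` to be exchanged for one of length
`1 / (2|ξ|)`, for which the `L¹` bound on the difference suffices. -/
theorem exists_norm_fourier_rieszDiff_le {n : ℕ} (hn : 1 ≤ n) {t : ℝ} (ht : t ∈ Ioo (0 : ℝ) 1) :
    ∃ C : ℝ, 0 < C ∧ ∀ h ξ : Rn n, ξ ≠ 0 →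
      ‖𝓕 (rieszDiff t h) ξ‖ ≤ C * (‖ξ‖ ^ (-t) * min 1 (‖h‖ * ‖ξ‖)) := by
  obtain ⟨C, hC, hC'⟩ := exists_lintegral_rieszDiff_le hn ht
  have hbd : ∀ h ξ : Rn n, ‖𝓕 (rieszDiff t h) ξ‖ ≤ C * ‖h‖ ^ t := by
    intro h ξ
    refine (VectorFourier.norm_fourierIntegral_le_integral_norm _ _ _ _ _).trans ?_
    rw [integral_norm_eq_lintegral_enorm (measurable_rieszDiff t h).aestronglyMeasurable]
    exact ENNReal.toReal_le_of_le_ofReal (by positivity) (hC' h)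
  refine ⟨C * 2 ^ (-t) * π, by positivity, fun h ξ hξ => ?_⟩
  have hξ0 : 0 < ‖ξ‖ := norm_pos_iff.2 hξ
  -- the shift `k` with `⟪k, ξ⟫ = 1 / 2`, for which the multiplier `e^{2πi⟪k, ξ⟫} - 1` is `-2`
  set k : Rn n := (2 * ‖ξ‖ ^ 2)⁻¹ • ξ with hk
  have hki : inner ℝ k ξ = 1 / 2 := by
    rw [hk, inner_smul_left, real_inner_self_eq_norm_sq]
    simp only [conj_trivial]
    field_simp
  have hkn : ‖k‖ = (2 * ‖ξ‖)⁻¹ := by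
    rw [hk, norm_smul, Real.norm_of_nonneg (by positivity)]
    field_simp
  have hek : (𝐞 (inner ℝ k ξ) : ℂ) - 1 = -2 := by
    rw [hki, Real.fourierChar_apply]
    have : ((2 * π * (1 / 2) : ℝ) : ℂ) * Complex.I = π * Complex.I := by push_cast; ring
    rw [this, Complex.exp_pi_mul_I]; norm_num
  have h1 := fourier_rieszDiff_mul_comm hn ht h k ξ
  rw [hek] at h1
  have h2 : ‖𝓕 (rieszDiff t h) ξ‖ * 2 = ‖(𝐞 (inner ℝ h ξ) : ℂ) - 1‖ * ‖𝓕 (rieszDiff t k) ξ‖ := by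
    rw [← norm_mul, ← h1, norm_mul, norm_neg]; norm_num [mul_comm]
  have h3 : ‖(𝐞 (inner ℝ h ξ) : ℂ) - 1‖ ≤ 2 * π * min 1 (‖h‖ * ‖ξ‖) := by
    rw [mul_min_of_nonneg _ _ (by positivity)]
    refine le_min ?_ ((norm_fourierChar_sub_one_le _).trans ?_)
    · refine (norm_sub_le _ _).trans ?_
      simp only [Circle.norm_coe, norm_one]
      linarith [Real.pi_gt_three]
    · gcongr
      exact abs_real_inner_le_norm h ξ
  have h4 : ‖𝓕 (rieszDiff t k) ξ‖ ≤ C * (2 ^ (-t) * ‖ξ‖ ^ (-t)) := by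
    refine (hbd k ξ).trans_eq ?_
    rw [hkn, Real.inv_rpow (by positivity), ← Real.rpow_neg (by positivity),
      Real.mul_rpow (by positivity) (by positivity)]
  have h5 := mul_le_mul h3 h4 (norm_nonneg _) (by positivity)
  rw [← h2] at h5
  linarith

/-- The square function estimate on the Fourier side. The integral over `|h| < 1/|ξ|` converges
because `t < 1`, the one over `|h| ≥ 1/|ξ|` because `t > 0`. -/
theorem exists_lintegral_symbol_le {n : ℕ} (hn : 1 ≤ n) {t : ℝ} (ht : t ∈ Ioo (0 : ℝ) 1) :
    ∃ C : ℝ, 0 < C ∧ ∀ ξ : Rn n, ξ ≠ 0 →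
      ∫⁻ h : Rn n, ENNReal.ofReal ((‖ξ‖ ^ (-t) * min 1 (‖h‖ * ‖ξ‖)) ^ 2 *
        (‖h‖ ^ (n + 2 * t))⁻¹) ≤ ENNReal.ofReal C := by
  obtain ⟨C₁, hC₁, h₁⟩ := exists_setLIntegral_ball_rpow_le hn (a := 2 - 2 * t)
    (by linarith [ht.2])
  obtain ⟨C₂, hC₂, h₂⟩ := exists_setLIntegral_compl_ball_rpow_le (n := n) (a := 2 * t)
    (by linarith [ht.1])
  refine ⟨C₁ + C₂, by positivity, fun ξ hξ => ?_⟩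
  have hξ0 : 0 < ‖ξ‖ := norm_pos_iff.2 hξ
  have e2 : (‖ξ‖ ^ (-t)) ^ 2 = ‖ξ‖ ^ (-(2 * t)) := by
    rw [← Real.rpow_natCast, ← Real.rpow_mul hξ0.le]; congr 1; push_cast; ring
  rw [← lintegral_add_compl _ (measurableSet_ball (x := (0 : Rn n)) (ε := ‖ξ‖⁻¹)),
    ENNReal.ofReal_add hC₁.le hC₂.le]
  refine add_le_add ?_ ?_
  · calc _ ≤ ∫⁻ h in Metric.ball (0 : Rn n) ‖ξ‖⁻¹, ENNReal.ofReal (‖ξ‖ ^ (2 - 2 * t)) *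
          ENNReal.ofReal (‖h - 0‖ ^ (2 - 2 * t - n)) := by
          refine lintegral_mono fun h => ?_
          rw [← ENNReal.ofReal_mul (by positivity), sub_zero]
          refine ENNReal.ofReal_le_ofReal ?_
          rcases (norm_nonneg h).eq_or_lt with h0 | h0
          · rw [← h0]; simp; positivity
          calc _ ≤ (‖ξ‖ ^ (-t) * (‖h‖ * ‖ξ‖)) ^ 2 * (‖h‖ ^ (n + 2 * t))⁻¹ := by
                gcongr; exact min_le_right _ _
            _ = (‖ξ‖ ^ (-(2 * t)) * ‖ξ‖ ^ 2) * (‖h‖ ^ 2 * ‖h‖ ^ (-(n + 2 * t))) := by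
                rw [Real.rpow_neg h0.le, ← e2]; ring
            _ = _ := by
                rw [← Real.rpow_natCast, ← Real.rpow_natCast, ← Real.rpow_add h0,
                  ← Real.rpow_add hξ0]
                congr 2 <;> push_cast <;> ring
      _ ≤ ENNReal.ofReal (‖ξ‖ ^ (2 - 2 * t)) * ENNReal.ofReal (C₁ * ‖ξ‖⁻¹ ^ (2 - 2 * t)) := by
          rw [lintegral_const_mul' _ _ ENNReal.ofReal_ne_top]
          gcongr
          exact h₁ _ _ (by positivity)
      _ = _ := by
          rw [← ENNReal.ofReal_mul (by positivity), Real.inv_rpow hξ0.le]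
          congr 1
          field_simp
  · calc _ ≤ ∫⁻ h in (Metric.ball (0 : Rn n) ‖ξ‖⁻¹)ᶜ, ENNReal.ofReal (‖ξ‖ ^ (-(2 * t))) *
          ENNReal.ofReal (‖h - 0‖ ^ (-(2 * t) - n)) := by
          refine lintegral_mono fun h => ?_
          rw [← ENNReal.ofReal_mul (by positivity), sub_zero]
          refine ENNReal.ofReal_le_ofReal ?_
          calc _ ≤ (‖ξ‖ ^ (-t) * 1) ^ 2 * (‖h‖ ^ (n + 2 * t))⁻¹ := by
                gcongr; exact min_le_left _ _
            _ = _ := by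
                rw [mul_one, e2, ← Real.rpow_neg (norm_nonneg _)]; congr 2; ring
      _ ≤ ENNReal.ofReal (‖ξ‖ ^ (-(2 * t))) * ENNReal.ofReal (C₂ * ‖ξ‖⁻¹ ^ (-(2 * t))) := by
          rw [lintegral_const_mul' _ _ ENNReal.ofReal_ne_top]
          gcongr
          exact h₂ _ _ (by positivity)
      _ = _ := by
          rw [← ENNReal.ofReal_mul (by positivity), Real.inv_rpow hξ0.le]
          congr 1
          field_simp

open FourierTransform Real in
/-- Plancherel's identity for a continuous integrable function with integrable Fourier transform. -/
theorem lintegral_enorm_fourier_sq {n : ℕ} {g : Rn n → ℂ} (hg : Continuous g)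
    (hgi : Integrable g) (hgf : Integrable (𝓕 g)) :
    ∫⁻ x, ‖g x‖ₑ ^ 2 = ∫⁻ ξ, ‖𝓕 g ξ‖ₑ ^ 2 := by
  have hcont : Continuous (𝓕 g) := VectorFourier.fourierIntegral_continuous
    Real.continuous_fourierChar (by exact continuous_inner) hgi
  have hb1 : ∀ ξ, ‖𝓕 g ξ‖ ≤ ∫ x, ‖g x‖ := fun ξ =>
    VectorFourier.norm_fourierIntegral_le_integral_norm _ _ _ _ _
  have hinv : 𝓕⁻ (𝓕 g) = g := hg.fourierInv_fourier_eq hgi hgf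
  have hb2 : ∀ x, ‖g x‖ ≤ ∫ ξ, ‖𝓕 g ξ‖ := fun x => by
    conv_lhs => rw [← hinv]
    exact VectorFourier.norm_fourierIntegral_le_integral_norm _ _ _ _ _
  have h1 : Integrable fun x => ‖g x‖ ^ 2 := by
    have := hgi.norm.bdd_mul (c := ∫ ξ, ‖𝓕 g ξ‖) hg.norm.aestronglyMeasurable
      (Filter.Eventually.of_forall fun x => by simpa using hb2 x)
    simpa [sq] using this
  have h2 : Integrable fun ξ => ‖𝓕 g ξ‖ ^ 2 := by
    have := hgf.norm.bdd_mul (c := ∫ x, ‖g x‖) hcont.norm.aestronglyMeasurable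
      (Filter.Eventually.of_forall fun x => by simpa using hb1 x)
    simpa [sq] using this
  have key : ∫ ξ, ‖𝓕 g ξ‖ ^ 2 = ∫ x, ‖g x‖ ^ 2 := by
    have := VectorFourier.integral_sesq_fourierIntegral_eq_neg_flip (innerSL ℂ (E := ℂ))
      (L := innerₗ (Rn n)) (μ := volume) (ν := volume) Real.continuous_fourierChar
      (by exact continuous_inner) hgi hgf
    have e : ∀ x, VectorFourier.fourierIntegral 𝐞 volume (-(innerₗ (Rn n)).flip) (𝓕 g) x =
        g x := fun x => by
      conv_rhs => rw [← hinv]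
      simp [VectorFourier.fourierIntegral, Real.fourierInv_eq]
    simp only [e] at this
    have l : ∀ z : ℂ, ((‖z‖ ^ 2 : ℝ) : ℂ) = innerSL ℂ z z := fun z => by
      rw [innerSL_apply_apply, inner_self_eq_norm_sq_to_K]; simp
    apply Complex.ofReal_injective
    rw [← integral_complex_ofReal, ← integral_complex_ofReal]
    simp only [l]
    exact this
  have e3 : ∀ f : Rn n → ℂ, (fun x => ‖f x‖ₑ ^ 2) = fun x => ENNReal.ofReal (‖f x‖ ^ 2) := by
    intro f; ext x
    rw [ENNReal.ofReal_pow (norm_nonneg _), ofReal_norm]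
  rw [e3, e3, ← ofReal_integral_eq_lintegral_ofReal h1 (Filter.Eventually.of_forall fun _ => by
    positivity), ← ofReal_integral_eq_lintegral_ofReal h2 (Filter.Eventually.of_forall fun _ => by
    positivity), key]

/-! ### The square function of the differences of Riesz potentials -/

/-- The difference `J^t f(x) - J^t f(y)` of Riesz potentials, written as one integral. It converges
for almost every `(x, y)` for every `f ∈ L²`, which `J^t f` itself need not do. -/
noncomputable def diffPot {𝕜 : Type*} [RCLike 𝕜] {n : ℕ} (t : ℝ) (f : Rn n → 𝕜) (x y : Rn n) : 𝕜 :=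
  ∫ z : Rn n, ((powDiff t x y z : ℝ) : 𝕜) * f z

theorem diffPot_congr_ae {𝕜 : Type*} [RCLike 𝕜] {n : ℕ} {t : ℝ} {f g : Rn n → 𝕜}
    (h : f =ᵐ[volume] g) (x y : Rn n) : diffPot t f x y = diffPot t g x y :=
  integral_congr_ae (h.mono fun z hz => by simp only [hz])

theorem diffPot_swap {𝕜 : Type*} [RCLike 𝕜] {n : ℕ} (t : ℝ) (f : Rn n → 𝕜) (x y : Rn n) :
    diffPot t f y x = -diffPot t f x y := by
  rw [diffPot, diffPot, ← integral_neg]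
  refine integral_congr_ae (Filter.Eventually.of_forall fun z => ?_)
  simp only [powDiff_swap t x y z]
  push_cast
  ring

theorem measurable_powDiff_uncurry {n : ℕ} (t : ℝ) :
    Measurable fun p : (Rn n × Rn n) × Rn n => powDiff t p.1.1 p.1.2 p.2 :=
  measurable_powDiff_comp t (by fun_prop) (by fun_prop) (by fun_prop)

theorem stronglyMeasurable_diffPot {𝕜 : Type*} [RCLike 𝕜] {n : ℕ} (t : ℝ) {f : Rn n → 𝕜}
    (hf : AEStronglyMeasurable f volume) :
    StronglyMeasurable fun q : Rn n × Rn n => diffPot t f q.1 q.2 := by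
  have : (fun q : Rn n × Rn n => diffPot t f q.1 q.2) = fun q => diffPot t (hf.mk f) q.1 q.2 := by
    ext q; exact diffPot_congr_ae hf.ae_eq_mk _ _
  rw [this]
  simp only [diffPot]
  refine StronglyMeasurable.integral_prod_right' (f := fun p : (Rn n × Rn n) × Rn n =>
    ((powDiff t p.1.1 p.1.2 p.2 : ℝ) : 𝕜) * hf.mk f p.2) ?_
  exact (RCLike.continuous_ofReal.measurable.comp (measurable_powDiff_uncurry
    t)).stronglyMeasurable.mul (hf.stronglyMeasurable_mk.comp_measurable measurable_snd)

/-- Young's inequality `‖φ * F‖₂ ≤ ‖φ‖₁ ‖F‖₂` for nonnegative functions. -/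
theorem lintegral_lconvolution_sq_le {n : ℕ} {φ F : Rn n → ℝ≥0∞} (hφ : Measurable φ)
    (hF : Measurable F) :
    ∫⁻ x, (∫⁻ z, φ (x - z) * F z) ^ 2 ≤ (∫⁻ u, φ u) ^ 2 * ∫⁻ z, F z ^ 2 := by
  have hφ2 : Measurable fun p : Rn n × Rn n => φ (p.1 - p.2) := hφ.comp (by fun_prop)
  have hint : ∀ x, (∫⁻ z, φ (x - z) * F z) ^ 2 ≤
      (∫⁻ u, φ u) * ∫⁻ z, φ (x - z) * F z ^ 2 := by
    intro x
    have hm : Measurable fun z => φ (x - z) := hφ.comp (by fun_prop)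
    have h := ENNReal.lintegral_mul_norm_pow_le (μ := (volume : Measure (Rn n)))
      (f := fun z => φ (x - z)) (g := fun z => φ (x - z) * F z ^ 2)
      hm.aemeasurable (hm.mul (hF.pow_const 2)).aemeasurable
      (p := 1 / 2) (q := 1 / 2) (by norm_num) (by norm_num) (by norm_num)
    have e : ∀ z, φ (x - z) ^ (1 / 2 : ℝ) * (φ (x - z) * F z ^ 2) ^ (1 / 2 : ℝ) =
        φ (x - z) * F z := by
      intro z
      rw [ENNReal.mul_rpow_of_nonneg _ _ (by norm_num), ← mul_assoc,
        ← ENNReal.rpow_add_of_nonneg _ _ (by norm_num) (by norm_num), ← ENNReal.rpow_natCast,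
        ← ENNReal.rpow_mul]
      norm_num
    simp only [e] at h
    rw [lintegral_sub_left_eq_self φ x] at h
    calc _ ≤ ((∫⁻ u, φ u) ^ (1 / 2 : ℝ) * (∫⁻ z, φ (x - z) * F z ^ 2) ^ (1 / 2 : ℝ)) ^ 2 := by
          gcongr
      _ = _ := by
          rw [mul_pow, ← ENNReal.rpow_natCast, ← ENNReal.rpow_natCast, ← ENNReal.rpow_mul,
            ← ENNReal.rpow_mul]
          norm_num
  calc ∫⁻ x, (∫⁻ z, φ (x - z) * F z) ^ 2
      ≤ ∫⁻ x, (∫⁻ u, φ u) * ∫⁻ z, φ (x - z) * F z ^ 2 := lintegral_mono hint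
    _ = (∫⁻ u, φ u) * ∫⁻ x, ∫⁻ z, φ (x - z) * F z ^ 2 := by
        rw [lintegral_const_mul]
        exact Measurable.lintegral_prod_right'
          (f := fun p : Rn n × Rn n => φ (p.1 - p.2) * F p.2 ^ 2)
          (hφ2.mul ((hF.comp measurable_snd).pow_const 2))
    _ = (∫⁻ u, φ u) * ∫⁻ z, (∫⁻ u, φ u) * F z ^ 2 := by
        rw [lintegral_lintegral_swap]
        · congr 1
          refine lintegral_congr fun z => ?_
          rw [lintegral_mul_const _ (show Measurable fun x => φ (x - z) from hφ.comp (by fun_prop)),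
            lintegral_sub_right_eq_self φ z]
        · exact (hφ2.mul ((hF.comp measurable_snd).pow_const 2)).aemeasurable
    _ = _ := by rw [lintegral_const_mul _ (hF.pow_const 2)]; ring

/-- The integral `∫ ||x-z|^{t-n} - |y-z|^{t-n}| F(z) dz`, which dominates `diffPot t f x y` when
`F = |f|`. -/
noncomputable def absDiffPot {n : ℕ} (t : ℝ) (F : Rn n → ℝ≥0∞) (x y : Rn n) : ℝ≥0∞ :=
  ∫⁻ z, ENNReal.ofReal |powDiff t x y z| * F z

theorem measurable_absDiffPot {n : ℕ} (t : ℝ) {F : Rn n → ℝ≥0∞} (hF : Measurable F) :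
    Measurable fun q : Rn n × Rn n => absDiffPot t F q.1 q.2 :=
  Measurable.lintegral_prod_right' (f := fun p : (Rn n × Rn n) × Rn n =>
    ENNReal.ofReal |powDiff t p.1.1 p.1.2 p.2| * F p.2)
    ((measurable_powDiff_uncurry t).abs.ennreal_ofReal.mul (hF.comp measurable_snd))

theorem enorm_ofReal_mul {𝕜 : Type*} [RCLike 𝕜] (a : ℝ) (b : 𝕜) :
    ‖(a : 𝕜) * b‖ₑ = ENNReal.ofReal |a| * ‖b‖ₑ := by
  rw [enorm_mul, ← ofReal_norm (a : 𝕜), RCLike.norm_ofReal]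

theorem enorm_diffPot_le {𝕜 : Type*} [RCLike 𝕜] {n : ℕ} (t : ℝ) (f : Rn n → 𝕜) (x y : Rn n) :
    ‖diffPot t f x y‖ₑ ≤ absDiffPot t (fun z => ‖f z‖ₑ) x y := by
  refine (enorm_integral_le_lintegral_enorm _).trans_eq ?_
  simp only [enorm_ofReal_mul, absDiffPot]

/-- On each fibre `y = x + h` the difference of potentials is a convolution with the difference of
Riesz kernels, whose `L¹` norm is `O(|h|^t)`. -/
theorem exists_lintegral_absDiffPot_sq_le {n : ℕ} (hn : 1 ≤ n) {t : ℝ}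
    (ht : t ∈ Ioo (0 : ℝ) 1) :
    ∃ C : ℝ, 0 < C ∧ ∀ (F : Rn n → ℝ≥0∞) (_ : Measurable F) (h : Rn n),
      ∫⁻ x, absDiffPot t F x (x + h) ^ 2 ≤ ENNReal.ofReal (C * ‖h‖ ^ t) ^ 2 * ∫⁻ z, F z ^ 2 := by
  obtain ⟨C, hC, hC'⟩ := exists_lintegral_powDiff_le hn ht
  refine ⟨C, hC, fun F hF h => ?_⟩
  have e : ∀ x z : Rn n, powDiff t x (x + h) z = powDiff t (x - z) (x - z + h) 0 := by
    intro x z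
    simp only [powDiff, sub_zero]
    congr 3; abel
  have e' : ∀ x, absDiffPot t F x (x + h) =
      ∫⁻ z, ENNReal.ofReal |powDiff t (x - z) (x - z + h) 0| * F z := fun x =>
    lintegral_congr fun z => by rw [e]
  simp only [e']
  refine (lintegral_lconvolution_sq_le (φ := fun u => ENNReal.ofReal |powDiff t u (u + h) 0|)
    ?_ hF).trans ?_
  · exact (measurable_powDiff_comp t (by fun_prop) (by fun_prop) (by fun_prop)).abs.ennreal_ofReal
  · gcongr
    exact hC' h 0

theorem ae_absDiffPot_lt_top {n : ℕ} (hn : 1 ≤ n) {t : ℝ} (ht : t ∈ Ioo (0 : ℝ) 1)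
    {F : Rn n → ℝ≥0∞} (hF : Measurable F) (hF2 : ∫⁻ z, F z ^ 2 ≠ ⊤) :
    ∀ᵐ q : Rn n × Rn n, absDiffPot t F q.1 q.2 < ⊤ := by
  obtain ⟨C, hC, hC'⟩ := exists_lintegral_absDiffPot_sq_le hn ht
  have hm := measurable_absDiffPot t hF
  have hs : MeasurableSet {q : Rn n × Rn n | ¬ absDiffPot t F q.1 q.2 < ⊤} :=
    (measurableSet_lt hm measurable_const).compl
  rw [ae_iff, ← lintegral_indicator_one hs, lintegral_prod_eq_lintegral_diff
    (measurable_one.indicator hs)]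
  refine (lintegral_congr fun h => ?_).trans lintegral_zero
  have hm2 : Measurable fun x : Rn n => absDiffPot t F x (x + h) :=
    hm.comp (f := fun x : Rn n => (x, x + h)) (by fun_prop)
  have : ∀ᵐ x : Rn n, absDiffPot t F x (x + h) ^ 2 < ⊤ := by
    refine ae_lt_top (hm2.pow_const 2) (ne_top_of_le_ne_top ?_ (hC' F hF h))
    finiteness
  refine lintegral_eq_zero_of_ae_eq_zero (this.mono fun x hx => ?_)
  refine indicator_of_notMem ?_ _
  simpa using ((ENNReal.pow_lt_top_iff).1 hx).resolve_right (by norm_num) |>.ne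

theorem ae_integrable_powDiff_mul {𝕜 : Type*} [RCLike 𝕜] {n : ℕ} (hn : 1 ≤ n) {t : ℝ}
    (ht : t ∈ Ioo (0 : ℝ) 1) {f : Rn n → 𝕜} (hf : MemLp f 2 volume) :
    ∀ᵐ q : Rn n × Rn n, Integrable fun z => ((powDiff t q.1 q.2 z : ℝ) : 𝕜) * f z := by
  have hmk := hf.1.stronglyMeasurable_mk
  have h2 : ∫⁻ z, ‖hf.1.mk f z‖ₑ ^ 2 ≠ ⊤ := by
    have := (hf.ae_eq hf.1.ae_eq_mk).eLpNorm_lt_top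
    rw [eLpNorm_lt_top_iff_lintegral_rpow_enorm_lt_top (by norm_num) (by norm_num)] at this
    simpa using this.ne
  filter_upwards [ae_absDiffPot_lt_top hn ht hmk.enorm h2] with q hq
  have hm : Measurable fun z => powDiff t q.1 q.2 z :=
    measurable_powDiff_comp t (by fun_prop) (by fun_prop) (by fun_prop)
  have : Integrable fun z => ((powDiff t q.1 q.2 z : ℝ) : 𝕜) * hf.1.mk f z := by
    refine ⟨((RCLike.continuous_ofReal.measurable.comp hm).stronglyMeasurable.mul
      hmk).aestronglyMeasurable, ?_⟩
    simp only [HasFiniteIntegral, enorm_ofReal_mul]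
    exact hq
  exact this.congr (hf.1.ae_eq_mk.mono fun z hz => by simp only [hz])

theorem ae_diffPot_add {𝕜 : Type*} [RCLike 𝕜] {n : ℕ} (hn : 1 ≤ n) {t : ℝ}
    (ht : t ∈ Ioo (0 : ℝ) 1) {f g : Rn n → 𝕜} (hf : MemLp f 2 volume) (hg : MemLp g 2 volume) :
    ∀ᵐ q : Rn n × Rn n,
      diffPot t (f + g) q.1 q.2 = diffPot t f q.1 q.2 + diffPot t g q.1 q.2 := by
  filter_upwards [ae_integrable_powDiff_mul hn ht hf, ae_integrable_powDiff_mul hn ht hg]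
    with q h1 h2
  simp only [diffPot, Pi.add_apply, mul_add]
  exact integral_add h1 h2

theorem diffPot_smul {𝕜 : Type*} [RCLike 𝕜] {n : ℕ} {t : ℝ} (c : 𝕜) (f : Rn n → 𝕜)
    (x y : Rn n) : diffPot t (c • f) x y = c * diffPot t f x y := by
  simp only [diffPot, Pi.smul_apply, smul_eq_mul]
  rw [← integral_const_mul]
  congr 1; ext z; ring

open FourierTransform Real Convolution in
/-- The square function estimate for Schwartz functions: Plancherel on each fibre `y = x + h`, then
integration over `h` on the Fourier side. -/
theorem exists_lintegral_diffPot_schwartz_le {n : ℕ} (hn : 1 ≤ n) {t : ℝ}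
    (ht : t ∈ Ioo (0 : ℝ) 1) :
    ∃ C : ℝ, 0 < C ∧ ∀ f : SchwartzMap (Rn n) ℂ,
      ∫⁻ h : Rn n, ENNReal.ofReal (‖h‖ ^ (n + 2 * t))⁻¹ *
        ∫⁻ x, ‖diffPot t f x (x + h)‖ₑ ^ 2 ≤ ENNReal.ofReal C * ∫⁻ z, ‖f z‖ₑ ^ 2 := by
  obtain ⟨C₁, hC₁, h₁⟩ := exists_norm_fourier_rieszDiff_le hn ht
  obtain ⟨C₂, hC₂, h₂⟩ := exists_lintegral_symbol_le hn ht
  refine ⟨C₁ ^ 2 * C₂, by positivity, fun f => ?_⟩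
  have : Nontrivial (Rn n) :=
    Module.nontrivial_of_finrank_pos (R := ℝ) (by simpa using Nat.succ_le_iff.1 hn)
  have hff : Integrable (𝓕 (f : Rn n → ℂ)) := by
    rw [← SchwartzMap.fourier_coe]; exact SchwartzMap.integrable _
  have hfb : BddAbove (range fun x => ‖f x‖) := by
    refine ⟨SchwartzMap.seminorm ℝ 0 0 f, ?_⟩
    rintro _ ⟨x, rfl⟩
    exact SchwartzMap.norm_le_seminorm ℝ f x
  have hpl : ∫⁻ z, ‖f z‖ₑ ^ 2 = ∫⁻ ξ, ‖𝓕 (f : Rn n → ℂ) ξ‖ₑ ^ 2 :=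
    lintegral_enorm_fourier_sq f.continuous f.integrable hff
  have hfc : Continuous (𝓕 (f : Rn n → ℂ)) := by
    rw [← SchwartzMap.fourier_coe]; exact SchwartzMap.continuous _
  have hconv : ∀ h x : Rn n, ‖diffPot t f x (x + h)‖ₑ =
      ‖(rieszDiff t h ⋆[ContinuousLinearMap.mul ℂ ℂ] f) x‖ₑ := by
    intro h x
    rw [convolution_mul_swap, diffPot_swap, enorm_neg, diffPot]
    congr 2
    ext z
    simp only [rieszDiff, powDiff, sub_zero]
    rw [show x + h - z = x - z + h by abel]
    rfl
  have hone : ∀ h : Rn n, ∫⁻ x, ‖diffPot t f x (x + h)‖ₑ ^ 2 ≤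
      ∫⁻ ξ, ENNReal.ofReal ((C₁ * (‖ξ‖ ^ (-t) * min 1 (‖h‖ * ‖ξ‖))) ^ 2) *
        ‖𝓕 (f : Rn n → ℂ) ξ‖ₑ ^ 2 := by
    intro h
    have hk := integrable_rieszDiff hn ht h
    have hF : 𝓕 (rieszDiff t h ⋆[ContinuousLinearMap.mul ℂ ℂ] f) =
        fun ξ => 𝓕 (rieszDiff t h) ξ * 𝓕 (f : Rn n → ℂ) ξ := by
      ext ξ; exact Real.fourier_mul_convolution_eq hk f.integrable ξ
    have hkc : Continuous (𝓕 (rieszDiff t h)) := VectorFourier.fourierIntegral_continuous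
      Real.continuous_fourierChar (by exact continuous_inner) hk
    simp only [hconv]
    rw [lintegral_enorm_fourier_sq
      (hfb.continuous_convolution_right_of_integrable _ hk f.continuous)
      (hk.integrable_convolution _ f.integrable), hF]
    · refine lintegral_mono_ae ?_
      filter_upwards [Measure.ae_ne volume (0 : Rn n)] with ξ hξ
      rw [enorm_mul, mul_pow]
      gcongr
      rw [← ofReal_norm, ← ENNReal.ofReal_pow (norm_nonneg _)]
      refine ENNReal.ofReal_le_ofReal ?_
      gcongr
      exact h₁ h ξ hξ
    · rw [hF]
      refine hff.bdd_mul (c := ∫ u, ‖rieszDiff t h u‖) hkc.aestronglyMeasurable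
        (Filter.Eventually.of_forall fun ξ => ?_)
      exact VectorFourier.norm_fourierIntegral_le_integral_norm _ _ _ _ _
  calc _ ≤ ∫⁻ h : Rn n, ENNReal.ofReal (‖h‖ ^ (n + 2 * t))⁻¹ *
        ∫⁻ ξ, ENNReal.ofReal ((C₁ * (‖ξ‖ ^ (-t) * min 1 (‖h‖ * ‖ξ‖))) ^ 2) *
          ‖𝓕 (f : Rn n → ℂ) ξ‖ₑ ^ 2 := by
        exact lintegral_mono fun h => mul_le_mul_right (hone h) _
    _ = ∫⁻ h : Rn n, ∫⁻ ξ, ENNReal.ofReal (C₁ ^ 2) * (ENNReal.ofReal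
          ((‖ξ‖ ^ (-t) * min 1 (‖h‖ * ‖ξ‖)) ^ 2 * (‖h‖ ^ (n + 2 * t))⁻¹) *
          ‖𝓕 (f : Rn n → ℂ) ξ‖ₑ ^ 2) := by
        refine lintegral_congr fun h => ?_
        rw [← lintegral_const_mul' _ _ ENNReal.ofReal_ne_top]
        refine lintegral_congr fun ξ => ?_
        simp only [← mul_assoc]
        rw [← ENNReal.ofReal_mul (by positivity), ← ENNReal.ofReal_mul (by positivity)]
        congr 2; ring
    _ = ∫⁻ ξ, ∫⁻ h : Rn n, ENNReal.ofReal (C₁ ^ 2) * (ENNReal.ofReal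
          ((‖ξ‖ ^ (-t) * min 1 (‖h‖ * ‖ξ‖)) ^ 2 * (‖h‖ ^ (n + 2 * t))⁻¹) *
          ‖𝓕 (f : Rn n → ℂ) ξ‖ₑ ^ 2) := by
        refine lintegral_lintegral_swap ?_
        have : Measurable fun p : Rn n × Rn n => ‖𝓕 (f : Rn n → ℂ) p.2‖ₑ :=
          (hfc.measurable.comp measurable_snd).enorm
        exact Measurable.aemeasurable (by unfold Function.uncurry; fun_prop)
    _ ≤ ∫⁻ ξ, ENNReal.ofReal (C₁ ^ 2) * (ENNReal.ofReal C₂ * ‖𝓕 (f : Rn n → ℂ) ξ‖ₑ ^ 2) := by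
        refine lintegral_mono_ae ?_
        filter_upwards [Measure.ae_ne volume (0 : Rn n)] with ξ hξ
        rw [lintegral_const_mul' _ _ ENNReal.ofReal_ne_top,
          lintegral_mul_const' _ _ (by finiteness)]
        gcongr
        exact h₂ ξ hξ
    _ = _ := by
        rw [lintegral_const_mul' _ _ ENNReal.ofReal_ne_top,
          lintegral_const_mul' _ _ ENNReal.ofReal_ne_top, hpl, ← mul_assoc,
          ← ENNReal.ofReal_mul (by positivity)]

theorem enorm_add_sq_le {E : Type*} [NormedAddCommGroup E] (a b : E) :
    ‖a + b‖ₑ ^ 2 ≤ 2 * ‖a‖ₑ ^ 2 + 2 * ‖b‖ₑ ^ 2 := by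
  have h := ENNReal.rpow_add_le_mul_rpow_add_rpow ‖a‖ₑ ‖b‖ₑ (p := 2) (by norm_num)
  norm_num at h
  rw [← mul_add]
  exact (pow_le_pow_left₀ zero_le (enorm_add_le a b) 2).trans h

theorem lintegral_enorm_sq_eq_eLpNorm {α E : Type*} [MeasurableSpace α] {μ : Measure α}
    [NormedAddCommGroup E] (f : α → E) : ∫⁻ x, ‖f x‖ₑ ^ 2 ∂μ = eLpNorm f 2 μ ^ 2 := by
  rw [eLpNorm_eq_lintegral_rpow_enorm_toReal (by norm_num) (by norm_num), ← ENNReal.rpow_natCast,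
    ← ENNReal.rpow_mul]
  simp

theorem exists_lintegral_diffPot_fiber_sq_le {𝕜 : Type*} [RCLike 𝕜] {n : ℕ} (hn : 1 ≤ n) {t : ℝ}
    (ht : t ∈ Ioo (0 : ℝ) 1) :
    ∃ C : ℝ, 0 < C ∧ ∀ f : Rn n → 𝕜, MemLp f 2 volume → ∀ h : Rn n,
      ∫⁻ x, ‖diffPot t f x (x + h)‖ₑ ^ 2 ≤
        ENNReal.ofReal (C * ‖h‖ ^ t) ^ 2 * ∫⁻ z, ‖f z‖ₑ ^ 2 := by
  obtain ⟨C, hC, hC'⟩ := exists_lintegral_absDiffPot_sq_le hn ht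
  refine ⟨C, hC, fun f hf h => ?_⟩
  have e : ∫⁻ z, ‖f z‖ₑ ^ 2 = ∫⁻ z, ‖hf.1.mk f z‖ₑ ^ 2 :=
    lintegral_congr_ae (hf.1.ae_eq_mk.mono fun z hz => by simp only [hz])
  rw [e]
  refine le_trans (lintegral_mono fun x => ?_) (hC' _ hf.1.stronglyMeasurable_mk.enorm h)
  rw [diffPot_congr_ae hf.1.ae_eq_mk]
  gcongr
  exact enorm_diffPot_le _ _ _ _

/-- Subtraction of potentials on almost every fibre `{(x, x + h)}`, for every `h`. -/
theorem ae_diffPot_sub_fiber {𝕜 : Type*} [RCLike 𝕜] {n : ℕ} (hn : 1 ≤ n) {t : ℝ}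
    (ht : t ∈ Ioo (0 : ℝ) 1) {f g : Rn n → 𝕜} (hf : MemLp f 2 volume) (hg : MemLp g 2 volume)
    (h : Rn n) :
    ∀ᵐ x : Rn n, diffPot t f x (x + h) = diffPot t g x (x + h) + diffPot t (f - g) x (x + h) := by
  have key : ∀ f : Rn n → 𝕜, MemLp f 2 volume →
      ∀ᵐ x : Rn n, Integrable fun z => ((powDiff t x (x + h) z : ℝ) : 𝕜) * f z := by
    intro f hf
    obtain ⟨C, hC, hC'⟩ := exists_lintegral_absDiffPot_sq_le hn ht
    have hmk := hf.1.stronglyMeasurable_mk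
    have h2 : ∫⁻ z, ‖hf.1.mk f z‖ₑ ^ 2 ≠ ⊤ := by
      rw [lintegral_enorm_sq_eq_eLpNorm, eLpNorm_congr_ae hf.1.ae_eq_mk.symm]
      exact ENNReal.pow_ne_top hf.2.ne
    have hm2 : Measurable fun x : Rn n => absDiffPot t (fun z => ‖hf.1.mk f z‖ₑ) x (x + h) :=
      (measurable_absDiffPot t hmk.enorm).comp (f := fun x : Rn n => (x, x + h)) (by fun_prop)
    have : ∀ᵐ x : Rn n, absDiffPot t (fun z => ‖hf.1.mk f z‖ₑ) x (x + h) ^ 2 < ⊤ := by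
      refine ae_lt_top (hm2.pow_const 2) (ne_top_of_le_ne_top ?_ (hC' _ hmk.enorm h))
      finiteness
    filter_upwards [this] with x hx
    have hx := ((ENNReal.pow_lt_top_iff).1 hx).resolve_right (by norm_num)
    have hm : Measurable fun z => powDiff t x (x + h) z :=
      measurable_powDiff_comp t (by fun_prop) (by fun_prop) (by fun_prop)
    have : Integrable fun z => ((powDiff t x (x + h) z : ℝ) : 𝕜) * hf.1.mk f z := by
      refine ⟨((RCLike.continuous_ofReal.measurable.comp hm).stronglyMeasurable.mul
        hmk).aestronglyMeasurable, ?_⟩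
      simp only [HasFiniteIntegral, enorm_ofReal_mul]
      exact hx
    exact this.congr (hf.1.ae_eq_mk.mono fun z hz => by simp only [hz])
  filter_upwards [key g hg, key (f - g) (hf.sub hg)] with x h1 h2
  simp only [diffPot]
  rw [← integral_add h1 h2]
  congr 1; ext z; simp only [Pi.sub_apply]; ring

theorem measurable_lintegral_diffPot_sq {𝕜 : Type*} [RCLike 𝕜] {n : ℕ} (t : ℝ) {f : Rn n → 𝕜}
    (hf : AEStronglyMeasurable f volume) :
    Measurable fun h : Rn n => ∫⁻ x, ‖diffPot t f x (x + h)‖ₑ ^ 2 :=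
  Measurable.lintegral_prod_right' (f := fun p : Rn n × Rn n =>
    ‖diffPot t f p.2 (p.2 + p.1)‖ₑ ^ 2)
    (((stronglyMeasurable_diffPot t hf).measurable.comp
      (g := fun q : Rn n × Rn n => diffPot t f q.1 q.2)
      (f := fun p : Rn n × Rn n => (p.2, p.2 + p.1)) (by fun_prop)).enorm.pow_const 2)

open Filter Topology in
/-- The square function estimate on `L²`, by density of the Schwartz functions: on a fixed fibre the
difference of potentials is continuous on `L²`, so that Fatou's lemma in `h` applies. -/
theorem exists_lintegral_diffPot_complex_le {n : ℕ} (hn : 1 ≤ n) {t : ℝ}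
    (ht : t ∈ Ioo (0 : ℝ) 1) :
    ∃ C : ℝ, 0 < C ∧ ∀ f : Rn n → ℂ, MemLp f 2 volume →
      ∫⁻ h : Rn n, ENNReal.ofReal (‖h‖ ^ (n + 2 * t))⁻¹ *
        ∫⁻ x, ‖diffPot t f x (x + h)‖ₑ ^ 2 ≤ ENNReal.ofReal C * ∫⁻ z, ‖f z‖ₑ ^ 2 := by
  obtain ⟨C₁, hC₁, h₁⟩ := exists_lintegral_diffPot_schwartz_le hn ht
  obtain ⟨C₂, hC₂, h₂⟩ := exists_lintegral_diffPot_fiber_sq_le (𝕜 := ℂ) hn ht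
  refine ⟨4 * C₁, by positivity, fun f hf => ?_⟩
  have hex : ∀ k : ℕ, ∃ g : SchwartzMap (Rn n) ℂ,
      eLpNorm (f - ⇑g) 2 volume ≤ ENNReal.ofReal (1 / (k + 1)) := by
    intro k
    obtain ⟨g, hg₁, hg₂, hg₃⟩ := MemLp.exist_eLpNorm_sub_le (p := 2) (by norm_num) (by norm_num) hf
      (ε := 1 / (k + 1)) (by positivity)
    exact ⟨hg₁.toSchwartzMap hg₂, hg₃⟩
  choose g hg using hex
  have hgm : ∀ k, MemLp (g k) 2 volume := fun k => (g k).memLp 2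
  set δ : ℕ → ℝ≥0∞ := fun k => ∫⁻ z, ‖(f - ⇑(g k)) z‖ₑ ^ 2 with hδ
  have hδ0 : Tendsto δ atTop (𝓝 0) := by
    have h0 : Tendsto (fun k : ℕ => ENNReal.ofReal (1 / ((k : ℝ) + 1)) ^ 2) atTop (𝓝 0) := by
      have h1 : Tendsto (fun k : ℕ => ENNReal.ofReal (1 / ((k : ℝ) + 1))) atTop (𝓝 0) := by
        simpa using ENNReal.tendsto_ofReal tendsto_one_div_add_atTop_nhds_zero_nat
      simpa using ENNReal.Tendsto.pow (n := 2) h1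
    refine tendsto_of_tendsto_of_tendsto_of_le_of_le tendsto_const_nhds h0 (fun _ => zero_le) ?_
    intro k
    simp only [hδ, lintegral_enorm_sq_eq_eLpNorm]
    gcongr
    exact hg k
  set w : Rn n → ℝ≥0∞ := fun h => ENNReal.ofReal (‖h‖ ^ (n + 2 * t))⁻¹ with hw
  set b : ℕ → Rn n → ℝ≥0∞ := fun k h => ∫⁻ x, ‖diffPot t (g k) x (x + h)‖ₑ ^ 2 with hb
  have hpt : ∀ h : Rn n, w h * ∫⁻ x, ‖diffPot t f x (x + h)‖ₑ ^ 2 ≤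
      liminf (fun k => w h * (2 * b k h)) atTop := by
    intro h
    have hle : ∀ k, w h * ∫⁻ x, ‖diffPot t f x (x + h)‖ₑ ^ 2 ≤
        w h * (2 * b k h) + w h * 2 * ENNReal.ofReal (C₂ * ‖h‖ ^ t) ^ 2 * δ k := by
      intro k
      have hm : Measurable fun x => ‖diffPot t (g k) x (x + h)‖ₑ ^ 2 :=
        ((stronglyMeasurable_diffPot t (hgm k).1).measurable.comp
          (g := fun q : Rn n × Rn n => diffPot t (g k) q.1 q.2)
          (f := fun x : Rn n => (x, x + h)) (by fun_prop)).enorm.pow_const 2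
      calc _ ≤ w h * ∫⁻ x, (2 * ‖diffPot t (g k) x (x + h)‖ₑ ^ 2 +
            2 * ‖diffPot t (f - ⇑(g k)) x (x + h)‖ₑ ^ 2) := by
            refine mul_le_mul_right (lintegral_mono_ae ?_) _
            filter_upwards [ae_diffPot_sub_fiber hn ht hf (hgm k) h] with x hx
            rw [hx]
            exact enorm_add_sq_le _ _
        _ = w h * (2 * b k h + 2 * ∫⁻ x, ‖diffPot t (f - ⇑(g k)) x (x + h)‖ₑ ^ 2) := by
            rw [lintegral_add_left (hm.const_mul 2), lintegral_const_mul' _ _ (by norm_num),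
              lintegral_const_mul' _ _ (by norm_num)]
        _ ≤ w h * (2 * b k h + 2 * (ENNReal.ofReal (C₂ * ‖h‖ ^ t) ^ 2 * δ k)) := by
            gcongr
            exact h₂ _ (hf.sub (hgm k)) h
        _ = _ := by ring
    have hz : Tendsto (fun k => w h * 2 * ENNReal.ofReal (C₂ * ‖h‖ ^ t) ^ 2 * δ k) atTop
        (𝓝 0) := by
      have := ENNReal.Tendsto.const_mul (a := w h * 2 * ENNReal.ofReal (C₂ * ‖h‖ ^ t) ^ 2) hδ0
        (Or.inr (by finiteness))
      simpa using this
    rw [← ENNReal.liminf_add_of_right_tendsto_zero hz]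
    exact le_liminf_of_le (by isBoundedDefault) (Eventually.of_forall hle)
  have hwm : Measurable w := by fun_prop
  have hbm : ∀ k, Measurable (b k) := fun k => measurable_lintegral_diffPot_sq t (hgm k).1
  calc ∫⁻ h, w h * ∫⁻ x, ‖diffPot t f x (x + h)‖ₑ ^ 2
      ≤ ∫⁻ h, liminf (fun k => w h * (2 * b k h)) atTop := lintegral_mono hpt
    _ ≤ liminf (fun k => ∫⁻ h, w h * (2 * b k h)) atTop :=
        lintegral_liminf_le fun k => hwm.mul ((hbm k).const_mul 2)
    _ ≤ liminf (fun k => ENNReal.ofReal (4 * C₁) * (∫⁻ z, ‖f z‖ₑ ^ 2) +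
          ENNReal.ofReal (4 * C₁) * δ k) atTop := by
        refine liminf_le_liminf (Eventually.of_forall fun k => ?_)
        calc ∫⁻ h, w h * (2 * b k h) = 2 * ∫⁻ h, w h * b k h := by
              rw [← lintegral_const_mul' _ _ (by norm_num)]
              exact lintegral_congr fun h => by ring
          _ ≤ 2 * (ENNReal.ofReal C₁ * ∫⁻ z, ‖g k z‖ₑ ^ 2) := by
              gcongr
              exact h₁ (g k)
          _ ≤ 2 * (ENNReal.ofReal C₁ * ∫⁻ z, (2 * ‖f z‖ₑ ^ 2 + 2 * ‖(f - ⇑(g k)) z‖ₑ ^ 2)) := by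
              gcongr with z
              have : g k z = f z + -((f - ⇑(g k)) z) := by simp
              rw [this]
              refine (enorm_add_sq_le _ _).trans_eq ?_
              rw [enorm_neg]
          _ = _ := by
              rw [lintegral_add_left' (by have := hf.1.enorm; fun_prop),
                lintegral_const_mul' _ _ (by norm_num), lintegral_const_mul' _ _ (by norm_num),
                ENNReal.ofReal_mul (by norm_num)]
              simp only [ENNReal.ofReal_ofNat, hδ]
              ring
    _ = _ := by
        have hz : Tendsto (fun k => ENNReal.ofReal (4 * C₁) * δ k) atTop (𝓝 0) := by
          have := ENNReal.Tendsto.const_mul (a := ENNReal.ofReal (4 * C₁)) hδ0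
            (Or.inr (by finiteness))
          simpa using this
        exact (ENNReal.liminf_add_of_right_tendsto_zero hz _).trans (by simp)

/-- The isometric embedding of `ℝ` or `ℂ` in `ℂ`. -/
noncomputable def rclikeToComplex (𝕜 : Type*) [RCLike 𝕜] : 𝕜 →ₗᵢ[ℝ] ℂ where
  toLinearMap := ((RCLike.map 𝕜 ℂ : 𝕜 →L[ℝ] ℂ) : 𝕜 →ₗ[ℝ] ℂ)
  norm_map' z := by
    have h1 : (((RCLike.map 𝕜 ℂ : 𝕜 →L[ℝ] ℂ) : 𝕜 →ₗ[ℝ] ℂ) z : ℂ) =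
        ⟨RCLike.re z, RCLike.im z⟩ := by
      simp [RCLike.map_apply, Complex.ext_iff]
    rw [h1, ← sq_eq_sq₀ (norm_nonneg _) (norm_nonneg _), Complex.sq_norm, Complex.normSq_mk,
      RCLike.norm_sq_eq_def]

theorem diffPot_comp_rclikeToComplex {𝕜 : Type*} [RCLike 𝕜] {n : ℕ} (t : ℝ) (f : Rn n → 𝕜)
    (x y : Rn n) :
    diffPot t (fun z => rclikeToComplex 𝕜 (f z)) x y = rclikeToComplex 𝕜 (diffPot t f x y) := by
  rw [diffPot, diffPot, ← LinearIsometry.integral_comp_comm]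
  congr 1; ext z
  rw [← RCLike.real_smul_eq_coe_mul (powDiff t x y z) (f z), map_smul]
  exact (RCLike.real_smul_eq_coe_mul (K := ℂ) _ _).symm

/-- **The fractional Sobolev bound** `∬ |J^t f(x) - J^t f(y)|² / |x - y|^{n+2t} ≤ C ‖f‖₂²`. The real
case is read off from the complex one. -/
theorem exists_lintegral_diffPot_sq_le (𝕜 : Type*) [RCLike 𝕜] {n : ℕ} (hn : 1 ≤ n) {t : ℝ}
    (ht : t ∈ Ioo (0 : ℝ) 1) :
    ∃ C : ℝ, 0 < C ∧ ∀ f : Rn n → 𝕜, MemLp f 2 volume →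
      ∫⁻ q : Rn n × Rn n, ENNReal.ofReal (‖q.1 - q.2‖ ^ (n + 2 * t))⁻¹ *
        ‖diffPot t f q.1 q.2‖ₑ ^ 2 ≤ ENNReal.ofReal C * ∫⁻ z, ‖f z‖ₑ ^ 2 := by
  obtain ⟨C, hC, h⟩ := exists_lintegral_diffPot_complex_le hn ht
  refine ⟨C, hC, fun f hf => ?_⟩
  have hi : ∀ z : 𝕜, ‖rclikeToComplex 𝕜 z‖ₑ = ‖z‖ₑ := fun z => by
    rw [← ofReal_norm, ← ofReal_norm, LinearIsometry.norm_map]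
  have hf' : MemLp (fun z => rclikeToComplex 𝕜 (f z)) 2 volume :=
    (rclikeToComplex 𝕜).toContinuousLinearMap.comp_memLp' hf
  have := h _ hf'
  simp only [diffPot_comp_rclikeToComplex, hi] at this
  refine le_trans (le_of_eq ?_) this
  have hm : Measurable fun q : Rn n × Rn n => ‖diffPot t f q.1 q.2‖ₑ :=
    (stronglyMeasurable_diffPot t hf.1).enorm
  rw [lintegral_prod_eq_lintegral_diff (by fun_prop)]
  refine lintegral_congr fun k => ?_
  rw [← lintegral_const_mul' _ _ ENNReal.ofReal_ne_top]
  simp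

/-! ### The operator on `L²` -/

/-- The function `(x, y) ↦ m(x, y) (J^t f(x) - J^t f(y)) / |x - y|^{n/2+t}`. The bilinear form of
the operator is the pairing of two such functions, one with `m = K` and one with `m = 1`. -/
noncomputable def sqFun {𝕜 : Type*} [RCLike 𝕜] {n : ℕ} (m : Rn n × Rn n → 𝕜) (t : ℝ)
    (f : Rn n → 𝕜) (q : Rn n × Rn n) : 𝕜 :=
  m q * ((((‖q.1 - q.2‖ ^ ((n + 2 * t) / 2))⁻¹ : ℝ) : 𝕜) * diffPot t f q.1 q.2)

theorem exists_eLpNorm_sqFun_le (𝕜 : Type*) [RCLike 𝕜] {n : ℕ} (hn : 1 ≤ n) {t : ℝ}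
    (ht : t ∈ Ioo (0 : ℝ) 1) :
    ∃ C : ℝ, 0 < C ∧ ∀ (m : Rn n × Rn n → 𝕜) (f : Rn n → 𝕜), MemLp m ∞ volume →
      MemLp f 2 volume → MemLp (sqFun m t f) 2 volume ∧
      eLpNorm (sqFun m t f) 2 volume ≤
        ENNReal.ofReal C * eLpNorm m ∞ volume * eLpNorm f 2 volume := by
  obtain ⟨C, hC, h⟩ := exists_lintegral_diffPot_sq_le 𝕜 hn ht
  refine ⟨√C, by positivity, fun m f hm hf => ?_⟩
  set g : Rn n × Rn n → 𝕜 := fun q =>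
    (((‖q.1 - q.2‖ ^ ((n + 2 * t) / 2))⁻¹ : ℝ) : 𝕜) * diffPot t f q.1 q.2 with hg
  have hgm : AEStronglyMeasurable g volume := by
    refine (Measurable.stronglyMeasurable ?_).aestronglyMeasurable.mul
      (stronglyMeasurable_diffPot t hf.1).aestronglyMeasurable
    exact RCLike.continuous_ofReal.measurable.comp (by fun_prop)
  have hsq : eLpNorm g 2 volume ^ 2 ≤ (ENNReal.ofReal √C * eLpNorm f 2 volume) ^ 2 := by
    rw [← lintegral_enorm_sq_eq_eLpNorm, mul_pow, ← lintegral_enorm_sq_eq_eLpNorm,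
      ← ENNReal.ofReal_pow (by positivity), Real.sq_sqrt hC.le]
    refine le_trans (le_of_eq (lintegral_congr fun q => ?_)) (h f hf)
    rw [hg, enorm_ofReal_mul, mul_pow, abs_of_nonneg (by positivity),
      ← ENNReal.ofReal_pow (by positivity), inv_pow, ← Real.rpow_natCast,
      ← Real.rpow_mul (by positivity)]
    congr 5; push_cast; ring
  have hle : eLpNorm g 2 volume ≤ ENNReal.ofReal √C * eLpNorm f 2 volume :=
    (ENNReal.pow_le_pow_left_iff (by norm_num)).1 hsq
  have hbound : eLpNorm (sqFun m t f) 2 volume ≤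
      ENNReal.ofReal √C * eLpNorm m ∞ volume * eLpNorm f 2 volume := by
    calc eLpNorm (sqFun m t f) 2 volume ≤ eLpNorm m ∞ volume * eLpNorm g 2 volume :=
          eLpNorm_smul_le_eLpNorm_top_mul_eLpNorm 2 hgm m
      _ ≤ eLpNorm m ∞ volume * (ENNReal.ofReal √C * eLpNorm f 2 volume) := by gcongr
      _ = _ := by ring
  refine ⟨⟨hm.1.mul hgm, hbound.trans_lt ?_⟩, hbound⟩
  have := hm.2
  have := hf.2
  finiteness

/-- The bounded linear map `f ↦ sqFun m t f`. -/
theorem exists_sqFun_clm (𝕜 : Type*) [RCLike 𝕜] {n : ℕ} (hn : 1 ≤ n) {t : ℝ}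
    (ht : t ∈ Ioo (0 : ℝ) 1) :
    ∃ C : ℝ, 0 < C ∧ ∀ m : Rn n × Rn n → 𝕜, MemLp m ∞ volume →
      ∃ V : LpRn 𝕜 n 2 →L[𝕜] Lp 𝕜 2 (volume : Measure (Rn n × Rn n)),
        ‖V‖ ≤ C * (eLpNorm m ∞ volume).toReal ∧
        ∀ f : LpRn 𝕜 n 2, V f =ᵐ[volume] sqFun m t f := by
  obtain ⟨C, hC, h⟩ := exists_eLpNorm_sqFun_le 𝕜 hn ht
  refine ⟨C, hC, fun m hm => ?_⟩
  have hM := fun f : LpRn 𝕜 n 2 => (h m f hm (Lp.memLp f)).1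
  let V₀ : LpRn 𝕜 n 2 →ₗ[𝕜] Lp 𝕜 2 (volume : Measure (Rn n × Rn n)) :=
    { toFun := fun f => (hM f).toLp _
      map_add' := fun f g => by
        rw [← MemLp.toLp_add, MemLp.toLp_eq_toLp_iff]
        filter_upwards [ae_diffPot_add hn ht (Lp.memLp f) (Lp.memLp g)] with q hq
        have : diffPot t (f + g : LpRn 𝕜 n 2) q.1 q.2 = diffPot t (⇑f + ⇑g) q.1 q.2 :=
          diffPot_congr_ae (Lp.coeFn_add f g) _ _
        simp only [sqFun, Pi.add_apply, this, hq]
        ring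
      map_smul' := fun c f => by
        rw [RingHom.id_apply, ← MemLp.toLp_const_smul, MemLp.toLp_eq_toLp_iff]
        refine Filter.Eventually.of_forall fun q => ?_
        have : diffPot t (c • f : LpRn 𝕜 n 2) q.1 q.2 = diffPot t (c • ⇑f) q.1 q.2 :=
          diffPot_congr_ae (Lp.coeFn_smul c f) _ _
        simp only [sqFun, Pi.smul_apply, this, diffPot_smul, smul_eq_mul]
        ring }
  have hb : ∀ f, ‖V₀ f‖ ≤ C * (eLpNorm m ∞ volume).toReal * ‖f‖ := by
    intro f
    have hf := (h m f hm (Lp.memLp f)).2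
    have h1 : ‖V₀ f‖ = (eLpNorm (sqFun m t f) 2 volume).toReal := Lp.norm_toLp _ (hM f)
    rw [h1, Lp.norm_def]
    have := ENNReal.toReal_mono (by
      have := hm.2; have := (Lp.memLp f).2; finiteness) hf
    rwa [ENNReal.toReal_mul, ENNReal.toReal_mul, ENNReal.toReal_ofReal hC.le] at this
  exact ⟨V₀.mkContinuous _ hb, LinearMap.mkContinuous_norm_le _ (by positivity) _,
    fun f => (hM f).coeFn_toLp⟩

/-- The integrand of the bilinear form for `f, φ ∈ L²`; for test functions it agrees with
`formIntegrand`. -/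
noncomputable def pairIntegrand {𝕜 : Type*} [RCLike 𝕜] {n : ℕ} (K : Rn n × Rn n → 𝕜)
    (s s₁ s₂ : ℝ) (f φ : Rn n → 𝕜) (q : Rn n × Rn n) : 𝕜 :=
  K q * diffPot s₁ φ q.1 q.2 * diffPot s₂ f q.1 q.2 * (((‖q.1 - q.2‖ ^ (n + 2 * s))⁻¹ : ℝ) : 𝕜)

theorem pairIntegrand_swap {𝕜 : Type*} [RCLike 𝕜] {n : ℕ} (K : Rn n × Rn n → 𝕜)
    (s s₁ s₂ : ℝ) (f φ : Rn n → 𝕜) :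
    pairIntegrand K s s₁ s₂ f φ = pairIntegrand K s s₂ s₁ φ f := by
  ext q; simp only [pairIntegrand]; ring

theorem pairIntegrand_eq_sqFun_mul {𝕜 : Type*} [RCLike 𝕜] {n : ℕ} (K : Rn n × Rn n → 𝕜)
    {s s₁ s₂ : ℝ} (hs₁ : 0 < s₁) (hs₂ : 0 < s₂) (hsum : s₁ + s₂ = 2 * s) (f φ : Rn n → 𝕜)
    (q : Rn n × Rn n) :
    pairIntegrand K s s₁ s₂ f φ q = sqFun (fun _ => 1) s₁ φ q * sqFun K s₂ f q := by
  have hr : (‖q.1 - q.2‖ ^ (n + 2 * s))⁻¹ =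
      (‖q.1 - q.2‖ ^ ((n + 2 * s₁) / 2))⁻¹ * (‖q.1 - q.2‖ ^ ((n + 2 * s₂) / 2))⁻¹ := by
    rw [← mul_inv, ← Real.rpow_add_of_nonneg (norm_nonneg _) (by positivity) (by positivity)]
    congr 2; linarith
  simp only [pairIntegrand, sqFun, hr]
  push_cast
  ring

theorem diffPot_conj {𝕜 : Type*} [RCLike 𝕜] {n : ℕ} (t : ℝ) (f : Rn n → 𝕜) (x y : Rn n) :
    diffPot t (fun z => starRingEnd 𝕜 (f z)) x y = starRingEnd 𝕜 (diffPot t f x y) := by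
  rw [diffPot, diffPot, ← integral_conj]
  congr 1; ext z
  rw [map_mul, RCLike.conj_ofReal]

theorem memLp_conj {𝕜 : Type*} [RCLike 𝕜] {α : Type*} [MeasurableSpace α] {μ : Measure α}
    {p : ℝ≥0∞} {f : α → 𝕜} (hf : MemLp f p μ) : MemLp (fun z => starRingEnd 𝕜 (f z)) p μ :=
  hf.star

theorem integral_mul_eq_inner {𝕜 : Type*} [RCLike 𝕜] {α : Type*} [MeasurableSpace α]
    {μ : Measure α} (g : Lp 𝕜 2 μ) {φ : α → 𝕜} (hφ : MemLp φ 2 μ) :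
    ∫ z, g z * φ z ∂μ = inner 𝕜 ((memLp_conj hφ).toLp _) g := by
  rw [L2.inner_def]
  refine integral_congr_ae ?_
  filter_upwards [(memLp_conj hφ).coeFn_toLp] with z hz
  rw [RCLike.inner_apply, hz, RCLike.conj_conj]

theorem inner_eq_integral_pairIntegrand {𝕜 : Type*} [RCLike 𝕜] {n : ℕ}
    {K : Rn n × Rn n → 𝕜} {s s₁ s₂ : ℝ} (hs₁ : 0 < s₁) (hs₂ : 0 < s₂) (hsum : s₁ + s₂ = 2 * s)
    {f φ f' φ' : Rn n → 𝕜} (hφ : φ' =ᵐ[volume] fun z => starRingEnd 𝕜 (φ z))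
    (hf : f' =ᵐ[volume] f) {u v : Lp 𝕜 2 (volume : Measure (Rn n × Rn n))}
    (hu : u =ᵐ[volume] sqFun (fun _ => 1) s₁ φ') (hv : v =ᵐ[volume] sqFun K s₂ f') :
    inner 𝕜 u v = ∫ q, pairIntegrand K s s₁ s₂ f φ q := by
  rw [L2.inner_def]
  refine integral_congr_ae ?_
  filter_upwards [hu, hv] with q h1 h2
  rw [RCLike.inner_apply, h1, h2, pairIntegrand_eq_sqFun_mul K hs₁ hs₂ hsum]
  simp only [sqFun]
  rw [diffPot_congr_ae hφ, diffPot_conj, diffPot_congr_ae hf, map_mul, map_mul, map_one,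
    RCLike.conj_conj, RCLike.conj_ofReal]
  ring

/-- The operator is `U* V`, where `V f` is `sqFun K s₂ f` and `U φ` is `sqFun 1 s₁ φ`. The form
pairs `f` with `φ` bilinearly, whence the conjugates when it is read off from the inner product. -/
theorem exists_operator (𝕜 : Type*) [RCLike 𝕜] {n : ℕ} (hn : 1 ≤ n) {s s₁ s₂ : ℝ}
    (hs₁ : s₁ ∈ Ioo (0 : ℝ) 1) (hs₂ : s₂ ∈ Ioo (0 : ℝ) 1) (hsum : s₁ + s₂ = 2 * s) :
    ∃ C : ℝ, 0 < C ∧ ∀ K : Rn n × Rn n → 𝕜, MemLp K ∞ volume →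
      ∃ T : LpRn 𝕜 n 2 →L[𝕜] LpRn 𝕜 n 2, ‖T‖ ≤ C * (eLpNorm K ∞ volume).toReal ∧
        ∀ (f φ : Rn n → 𝕜) (hf : MemLp f 2 volume), MemLp φ 2 volume →
          Integrable (pairIntegrand K s s₁ s₂ f φ) volume ∧
          ∫ z, T (hf.toLp f) z * φ z = ∫ q, pairIntegrand K s s₁ s₂ f φ q := by
  obtain ⟨C₁, hC₁, h₁⟩ := exists_sqFun_clm 𝕜 hn hs₁
  obtain ⟨C₂, hC₂, h₂⟩ := exists_sqFun_clm 𝕜 hn hs₂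
  obtain ⟨D₁, hD₁, k₁⟩ := exists_eLpNorm_sqFun_le 𝕜 hn hs₁
  obtain ⟨D₂, hD₂, k₂⟩ := exists_eLpNorm_sqFun_le 𝕜 hn hs₂
  have hone : MemLp (fun _ : Rn n × Rn n => (1 : 𝕜)) ∞ volume := memLp_top_const 1
  obtain ⟨U, hU, hUf⟩ := h₁ _ hone
  have hone' : (eLpNorm (fun _ : Rn n × Rn n => (1 : 𝕜)) ∞ volume).toReal ≤ 1 := by
    refine ENNReal.toReal_le_of_le_ofReal zero_le_one ?_
    refine (eLpNormEssSup_le_of_ae_bound (C := 1) (Filter.Eventually.of_forall fun q => ?_))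
    simp
  have hU1 : ‖U‖ ≤ C₁ := hU.trans (by nlinarith)
  refine ⟨C₁ * C₂, by positivity, fun K hK => ?_⟩
  obtain ⟨V, hV, hVf⟩ := h₂ K hK
  obtain ⟨T, hT, hTi⟩ : ∃ T : LpRn 𝕜 n 2 →L[𝕜] LpRn 𝕜 n 2,
      ‖T‖ ≤ C₁ * C₂ * (eLpNorm K ∞ volume).toReal ∧ ∀ f φ, inner 𝕜 φ (T f) =
        inner 𝕜 (U φ) (V f) := by
    refine ⟨(ContinuousLinearMap.adjoint U) ∘L V, ?_, fun f φ =>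
      ContinuousLinearMap.adjoint_inner_right U φ (V f)⟩
    refine (ContinuousLinearMap.opNorm_comp_le _ _).trans ?_
    rw [LinearIsometryEquiv.norm_map, mul_assoc]
    exact mul_le_mul hU1 hV (norm_nonneg _) hC₁.le
  refine ⟨T, hT, fun f φ hf hφ => ⟨?_, ?_⟩⟩
  · have := (k₁ _ φ hone hφ).1.integrable_mul (k₂ K f hK hf).1
    exact this.congr (Filter.Eventually.of_forall fun q =>
      (pairIntegrand_eq_sqFun_mul K hs₁.1 hs₂.1 hsum f φ q).symm)
  · obtain ⟨φ', hφ'⟩ : ∃ φ', φ' = (memLp_conj hφ).toLp _ := ⟨_, rfl⟩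
    have hφ'e : φ' =ᵐ[volume] fun z => starRingEnd 𝕜 (φ z) := by
      rw [hφ']; exact (memLp_conj hφ).coeFn_toLp
    obtain ⟨f', hf'⟩ : ∃ f', f' = hf.toLp f := ⟨_, rfl⟩
    have hf'e : f' =ᵐ[volume] f := by rw [hf']; exact hf.coeFn_toLp
    rw [← hf', integral_mul_eq_inner (T f') hφ, ← hφ', hTi]
    exact (inner_eq_integral_pairIntegrand hs₁.1 hs₂.1 hsum hφ'e hf'e (hUf φ') (hVf f'))

theorem integrable_rieszKernel_mul {𝕜 : Type*} [RCLike 𝕜] {n : ℕ} (hn : 1 ≤ n) {t : ℝ}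
    (ht : 0 < t) {f : Rn n → 𝕜} (hf : Continuous f) (hc : HasCompactSupport f) (x : Rn n) :
    Integrable fun z => ((‖x - z‖ ^ (t - n) : ℝ) : 𝕜) * f z := by
  obtain ⟨C, hC, h⟩ := exists_setLIntegral_ball_rpow_le hn ht
  have hm : Measurable fun z : Rn n => ((‖x - z‖ ^ (t - n) : ℝ) : 𝕜) :=
    RCLike.continuous_ofReal.measurable.comp (by fun_prop)
  have hl : LocallyIntegrable (fun z : Rn n => ((‖x - z‖ ^ (t - n) : ℝ) : 𝕜)) volume := by
    rw [locallyIntegrable_iff]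
    intro S hS
    obtain ⟨R, hR, hSR⟩ := hS.isBounded.subset_ball_lt 0 x
    refine IntegrableOn.mono_set (t := Metric.ball x R) ⟨hm.aestronglyMeasurable, ?_⟩ hSR
    refine lt_of_le_of_lt (le_of_eq (lintegral_congr fun z => ?_))
      ((h x R hR).trans_lt ENNReal.ofReal_lt_top)
    rw [← ofReal_norm, RCLike.norm_ofReal, abs_of_nonneg (by positivity), norm_sub_rev]
  simpa [smul_eq_mul] using hl.integrable_smul_right_of_hasCompactSupport hf hc

theorem rieszPot_sub_rieszPot {𝕜 : Type*} [RCLike 𝕜] {n : ℕ} (hn : 1 ≤ n) {t : ℝ}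
    (ht : 0 < t) {f : Rn n → 𝕜} (hf : Continuous f) (hc : HasCompactSupport f) (x y : Rn n) :
    rieszPot t f x - rieszPot t f y = diffPot t f x y := by
  rw [rieszPot, rieszPot, ← integral_sub (integrable_rieszKernel_mul hn ht hf hc x)
    (integrable_rieszKernel_mul hn ht hf hc y), diffPot]
  congr 1; ext z
  rw [powDiff]; push_cast; ring

theorem formIntegrand_eq_pairIntegrand {𝕜 : Type*} [RCLike 𝕜] {n : ℕ} (hn : 1 ≤ n)
    {s s₁ s₂ : ℝ} (hs₁ : 0 < s₁) (hs₂ : 0 < s₂) (K : Rn n × Rn n → 𝕜) {f φ : Rn n → 𝕜}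
    (hf : Continuous f) (hfc : HasCompactSupport f) (hφ : Continuous φ)
    (hφc : HasCompactSupport φ) :
    formIntegrand K s s₁ s₂ f φ = pairIntegrand K s s₁ s₂ f φ := by
  ext q
  rw [formIntegrand, pairIntegrand, rieszPot_sub_rieszPot hn hs₁ hφ hφc,
    rieszPot_sub_rieszPot hn hs₂ hf hfc]

/-! ### The kernel -/

theorem ae_norm_le_toReal_eLpNorm_top {α E : Type*} [MeasurableSpace α] [NormedAddCommGroup E]
    {μ : Measure α} {K : α → E} (hK : MemLp K ∞ μ) :
    ∀ᵐ q ∂μ, ‖K q‖ ≤ (eLpNorm K ∞ μ).toReal := by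
  filter_upwards [ae_le_eLpNormEssSup (f := K) (μ := μ)] with q hq
  rw [← toReal_enorm]
  exact ENNReal.toReal_mono hK.2.ne hq

/-- A weight in `L^∞` against a function with a known bound on the integral of its absolute value.
-/
theorem norm_integral_mul_ofReal_le {𝕜 : Type*} [RCLike 𝕜] {α : Type*} [MeasurableSpace α]
    {μ : Measure α} {K : α → 𝕜} (hK : MemLp K ∞ μ) {G : α → ℝ} (hG : Measurable G) {D : ℝ}
    (hD : 0 ≤ D) (h : ∫⁻ q, ENNReal.ofReal |G q| ∂μ ≤ ENNReal.ofReal D) :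
    Integrable (fun q => K q * ((G q : ℝ) : 𝕜)) μ ∧
      ‖∫ q, K q * ((G q : ℝ) : 𝕜) ∂μ‖ ≤ D * (eLpNorm K ∞ μ).toReal ∧
      ∫⁻ q, ‖K q * ((G q : ℝ) : 𝕜)‖ₑ ∂μ ≤ ENNReal.ofReal (D * (eLpNorm K ∞ μ).toReal) := by
  have hle : ∫⁻ q, ‖K q * ((G q : ℝ) : 𝕜)‖ₑ ∂μ ≤
      ENNReal.ofReal (D * (eLpNorm K ∞ μ).toReal) := by
    calc ∫⁻ q, ‖K q * ((G q : ℝ) : 𝕜)‖ₑ ∂μ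
        ≤ ∫⁻ q, ENNReal.ofReal (eLpNorm K ∞ μ).toReal * ENNReal.ofReal |G q| ∂μ := by
          refine lintegral_mono_ae ?_
          filter_upwards [ae_norm_le_toReal_eLpNorm_top hK] with q hq
          rw [mul_comm, enorm_ofReal_mul, mul_comm, ← ofReal_norm]
          gcongr
      _ = ENNReal.ofReal (eLpNorm K ∞ μ).toReal * ∫⁻ q, ENNReal.ofReal |G q| ∂μ :=
          lintegral_const_mul' _ _ ENNReal.ofReal_ne_top
      _ ≤ _ := by
          rw [mul_comm D, ENNReal.ofReal_mul ENNReal.toReal_nonneg]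
          gcongr
  refine ⟨⟨hK.1.mul (RCLike.continuous_ofReal.measurable.comp hG).aestronglyMeasurable,
    hle.trans_lt ENNReal.ofReal_lt_top⟩, ?_, hle⟩
  have := (enorm_integral_le_lintegral_enorm (μ := μ) fun q => K q * ((G q : ℝ) : 𝕜)).trans hle
  rw [← ofReal_norm] at this
  exact (ENNReal.ofReal_le_ofReal_iff (by positivity)).1 this

theorem measurable_kernelWeight {n : ℕ} (s s₁ s₂ : ℝ) (z₁ z₂ : Rn n) :
    Measurable fun q : Rn n × Rn n =>
      powDiff s₁ q.1 q.2 z₁ * powDiff s₂ q.1 q.2 z₂ / ‖q.1 - q.2‖ ^ (n + 2 * s) := by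
  have h1 := measurable_powDiff_comp s₁ (x := fun q : Rn n × Rn n => q.1) (y := fun q => q.2)
    (z := fun _ => z₁) (by fun_prop) (by fun_prop) (by fun_prop)
  have h2 := measurable_powDiff_comp s₂ (x := fun q : Rn n × Rn n => q.1) (y := fun q => q.2)
    (z := fun _ => z₂) (by fun_prop) (by fun_prop) (by fun_prop)
  exact (h1.mul h2).div (by fun_prop)

theorem kernelA_swap {𝕜 : Type*} [RCLike 𝕜] {n : ℕ} (K : Rn n × Rn n → 𝕜) (s s₁ s₂ : ℝ)
    (z₁ z₂ : Rn n) : kernelA K s s₁ s₂ z₁ z₂ = kernelA K s s₂ s₁ z₂ z₁ := by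
  rw [kernelA, kernelA]
  congr 1; funext q
  rw [kernelIntegrand, kernelIntegrand, mul_comm (powDiff s₁ _ _ _)]

theorem exists_kernelA_size_le (𝕜 : Type*) [RCLike 𝕜] {n : ℕ} (hn : 1 ≤ n) {s s₁ s₂ : ℝ}
    (hs₁ : s₁ ∈ Ioo (0 : ℝ) 1) (hs₂ : s₂ ∈ Ioo (0 : ℝ) 1) (hsum : s₁ + s₂ = 2 * s) :
    ∃ C : ℝ, 0 < C ∧ ∀ K : Rn n × Rn n → 𝕜, MemLp K ∞ volume → ∀ z₁ z₂ : Rn n, z₁ ≠ z₂ →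
      Integrable (kernelIntegrand K s s₁ s₂ z₁ z₂) volume ∧
      ‖kernelA K s s₁ s₂ z₁ z₂‖ ≤ C * (eLpNorm K ∞ volume).toReal * ‖z₁ - z₂‖ ^ (-(n : ℝ)) ∧
      ∫⁻ q, ‖kernelIntegrand K s s₁ s₂ z₁ z₂ q‖ₑ ≤
        ENNReal.ofReal (C * (eLpNorm K ∞ volume).toReal * ‖z₁ - z₂‖ ^ (-(n : ℝ))) := by
  obtain ⟨C, hC, h⟩ := exists_lintegral_kernel_size_le hn hs₁ hs₂ hsum
  refine ⟨C, hC, fun K hK z₁ z₂ hz => ?_⟩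
  have hb := h z₁ z₂ hz
  have hle : ∫⁻ q : Rn n × Rn n, ENNReal.ofReal |powDiff s₁ q.1 q.2 z₁ * powDiff s₂ q.1 q.2 z₂ /
      ‖q.1 - q.2‖ ^ (n + 2 * s)| ≤ ENNReal.ofReal (C * ‖z₁ - z₂‖ ^ (-(n : ℝ))) := by
    refine le_trans (le_of_eq (lintegral_congr fun q => ?_)) hb
    rw [abs_div, abs_mul, abs_of_nonneg (a := ‖q.1 - q.2‖ ^ _) (by positivity)]
  have := norm_integral_mul_ofReal_le hK (measurable_kernelWeight s s₁ s₂ z₁ z₂)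
    (by positivity) hle
  have e : C * (eLpNorm K ∞ volume).toReal * ‖z₁ - z₂‖ ^ (-(n : ℝ)) =
    C * ‖z₁ - z₂‖ ^ (-(n : ℝ)) * (eLpNorm K ∞ volume).toReal := by ring
  rw [e]
  exact this

theorem add_ne_of_norm_le_half {n : ℕ} {z₁ z₂ h : Rn n} (hz : z₁ ≠ z₂)
    (hh : ‖h‖ ≤ ‖z₁ - z₂‖ / 2) : z₁ + h ≠ z₂ := by
  rintro rfl
  have : 0 < ‖h‖ := norm_pos_iff.2 fun h0 => hz (by simp [h0])
  simp at hh
  linarith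

theorem exists_kernelA_regularity_le (𝕜 : Type*) [RCLike 𝕜] {n : ℕ} (hn : 1 ≤ n) {s s₁ s₂ : ℝ}
    (hs₁ : s₁ ∈ Ioo (0 : ℝ) 1) (hs₂ : s₂ ∈ Ioo (0 : ℝ) 1) (hsum : s₁ + s₂ = 2 * s)
    {α : ℝ} (hα : 0 ≤ α) (hα₁ : α < 1 - s₁) (hα₂ : α < 1 - s₂) (hα₃ : α ≤ s₁ / 2) :
    ∃ C : ℝ, 0 < C ∧ ∀ K : Rn n × Rn n → 𝕜, MemLp K ∞ volume → ∀ z₁ z₂ h : Rn n, z₁ ≠ z₂ →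
      ‖h‖ ≤ ‖z₁ - z₂‖ / 2 → ‖kernelA K s s₁ s₂ (z₁ + h) z₂ - kernelA K s s₁ s₂ z₁ z₂‖ ≤
        C * (eLpNorm K ∞ volume).toReal * ‖h‖ ^ α / ‖z₁ - z₂‖ ^ (n + α) := by
  obtain ⟨C, hC, hr⟩ := exists_lintegral_kernel_regularity_le hn hs₁ hs₂ hsum hα hα₁ hα₂ hα₃
  obtain ⟨_, _, hsz⟩ := exists_kernelA_size_le 𝕜 hn hs₁ hs₂ hsum
  refine ⟨C, hC, fun K hK z₁ z₂ h hz hh => ?_⟩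
  have hle : ∫⁻ q : Rn n × Rn n, ENNReal.ofReal |powDiff s₁ q.1 q.2 (z₁ + h) *
      powDiff s₂ q.1 q.2 z₂ / ‖q.1 - q.2‖ ^ (n + 2 * s) - powDiff s₁ q.1 q.2 z₁ *
      powDiff s₂ q.1 q.2 z₂ / ‖q.1 - q.2‖ ^ (n + 2 * s)| ≤
      ENNReal.ofReal (C * ‖h‖ ^ α * ‖z₁ - z₂‖ ^ (-(n : ℝ) - α)) := by
    refine le_trans (le_of_eq (lintegral_congr fun q => ?_)) (hr z₁ z₂ h hz hh)
    rw [← sub_div, ← sub_mul, abs_div, abs_mul,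
      abs_of_nonneg (a := ‖q.1 - q.2‖ ^ _) (by positivity)]
  have := norm_integral_mul_ofReal_le hK ((measurable_kernelWeight s s₁ s₂ (z₁ + h) z₂).sub
    (measurable_kernelWeight s s₁ s₂ z₁ z₂)) (by positivity) hle
  rw [kernelA, kernelA, ← integral_sub (hsz K hK _ _ (add_ne_of_norm_le_half hz hh)).1
    (hsz K hK _ _ hz).1]
  refine le_trans (le_of_eq ?_) (this.2.1.trans_eq ?_)
  · congr 2; funext q
    simp only [kernelIntegrand, Pi.sub_apply]; push_cast; ring
  · rw [show -(n : ℝ) - α = -(n + α) by ring, Real.rpow_neg (norm_nonneg _)]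
    ring

/-- The exponent `α` has to be below each `1 - sᵢ`, so that the smooth factor keeps enough of its
Lipschitz bound, and at most each `sᵢ / 2`. The regularity in the second variable is that in the
first, after exchanging `s₁` and `s₂`. -/
theorem exists_isStandardKernel_kernelA (𝕜 : Type*) [RCLike 𝕜] {n : ℕ} (hn : 1 ≤ n)
    {s s₁ s₂ : ℝ} (hs₁ : s₁ ∈ Ioo (0 : ℝ) 1) (hs₂ : s₂ ∈ Ioo (0 : ℝ) 1)
    (hsum : s₁ + s₂ = 2 * s) :
    ∃ α C : ℝ, 0 < α ∧ 0 < C ∧ ∀ K : Rn n × Rn n → 𝕜, MemLp K ∞ volume →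
      IsStandardKernel (kernelA K s s₁ s₂) α (C * (eLpNorm K ∞ volume).toReal) := by
  obtain ⟨α, hα, hα1, hα2, hα3, hα4⟩ : ∃ α : ℝ, 0 < α ∧ α < 1 - s₁ ∧ α < 1 - s₂ ∧ α ≤ s₁ / 2 ∧
      α ≤ s₂ / 2 := by
    have h1 := hs₁.1; have h2 := hs₂.1; have h3 := hs₁.2; have h4 := hs₂.2
    refine ⟨min (min (s₁ / 2) (s₂ / 2)) (min ((1 - s₁) / 2) ((1 - s₂) / 2)), ?_, ?_, ?_, ?_, ?_⟩
    · simp only [lt_min_iff]; refine ⟨⟨?_, ?_⟩, ?_, ?_⟩ <;> linarith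
    · exact ((min_le_right _ _).trans (min_le_left _ _)).trans_lt (by linarith)
    · exact ((min_le_right _ _).trans (min_le_right _ _)).trans_lt (by linarith)
    · exact (min_le_left _ _).trans (min_le_left _ _)
    · exact (min_le_left _ _).trans (min_le_right _ _)
  obtain ⟨C₀, hC₀, h₀⟩ := exists_kernelA_size_le 𝕜 hn hs₁ hs₂ hsum
  obtain ⟨C₁, hC₁, h₁⟩ := exists_kernelA_regularity_le 𝕜 hn hs₁ hs₂ hsum hα.le hα1 hα2 hα3
  obtain ⟨C₂, hC₂, h₂⟩ := exists_kernelA_regularity_le 𝕜 hn hs₂ hs₁ (by rw [add_comm, hsum])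
    hα.le hα2 hα1 hα4
  refine ⟨α, C₀ + C₁ + C₂, hα, by positivity, fun K hK => ⟨?_, ?_, ?_⟩⟩
  · intro z₁ z₂ hz
    refine (h₀ K hK z₁ z₂ hz).2.1.trans ?_
    rw [Real.rpow_neg (norm_nonneg _), ← div_eq_mul_inv]
    gcongr
    linarith
  · intro z₁ z₂ h hz hh
    refine (h₁ K hK z₁ z₂ h hz hh).trans ?_
    gcongr
    linarith
  · intro z₁ z₂ h hz hh
    rw [kernelA_swap K, kernelA_swap K s s₁ s₂ z₁, norm_sub_rev z₁]
    refine (h₂ K hK z₂ z₁ h hz.symm (by rwa [norm_sub_rev])).trans ?_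
    gcongr
    linarith

/-- `K` may be replaced by a measurable representative, since this changes no value of the kernel.
-/
theorem stronglyMeasurable_kernelA {𝕜 : Type*} [RCLike 𝕜] {n : ℕ} {K : Rn n × Rn n → 𝕜}
    (hK : AEStronglyMeasurable K volume) (s s₁ s₂ : ℝ) :
    StronglyMeasurable fun p : Rn n × Rn n => kernelA K s s₁ s₂ p.1 p.2 := by
  have e : (fun p : Rn n × Rn n => kernelA K s s₁ s₂ p.1 p.2) =
      fun p : Rn n × Rn n => kernelA (hK.mk K) s s₁ s₂ p.1 p.2 := by
    funext p
    refine integral_congr_ae ?_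
    filter_upwards [hK.ae_eq_mk] with q hq
    simp only [kernelIntegrand, hq]
  rw [e]
  refine StronglyMeasurable.integral_prod_right'
    (f := fun r : (Rn n × Rn n) × (Rn n × Rn n) =>
      kernelIntegrand (hK.mk K) s s₁ s₂ r.1.1 r.1.2 r.2) ?_
  have h1 := measurable_powDiff_comp s₁ (x := fun r : (Rn n × Rn n) × (Rn n × Rn n) => r.2.1)
    (y := fun r => r.2.2) (z := fun r => r.1.1) (by fun_prop) (by fun_prop) (by fun_prop)
  have h2 := measurable_powDiff_comp s₂ (x := fun r : (Rn n × Rn n) × (Rn n × Rn n) => r.2.1)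
    (y := fun r => r.2.2) (z := fun r => r.1.2) (by fun_prop) (by fun_prop) (by fun_prop)
  exact (hK.stronglyMeasurable_mk.comp_measurable measurable_snd).mul
    (RCLike.continuous_ofReal.measurable.comp ((h1.mul h2).div (by fun_prop))).stronglyMeasurable

/-! ### The operator and its kernel -/

theorem ENNReal.mul_le_sq_add_sq (a b : ℝ≥0∞) : a * b ≤ a ^ 2 + b ^ 2 := by
  rcases le_total a b with h | h
  · exact (mul_le_mul_left h b).trans (by rw [← sq]; exact le_add_self)
  · exact (mul_le_mul_right h a).trans (by rw [← sq]; exact le_self_add)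

/-- At distance at least `δ` from the support of `f ∈ L²` the integral `∫ A(z,w) f(w) dw` converges
absolutely, locally uniformly in `z`. -/
theorem exists_lintegral_kernel_mul_le (𝕜 : Type*) [RCLike 𝕜] {n : ℕ} (hn : 1 ≤ n) :
    ∃ C : ℝ, 0 < C ∧ ∀ (A : Rn n → Rn n → 𝕜) (B : ℝ), 0 ≤ B →
      (∀ z w, z ≠ w → ‖A z w‖ ≤ B / ‖z - w‖ ^ (n : ℝ)) → ∀ (δ : ℝ), 0 < δ →
      ∀ (f : Rn n → 𝕜) (z : Rn n), (∀ w, f w ≠ 0 → δ ≤ ‖z - w‖) →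
      ∫⁻ w, ‖A z w * f w‖ₑ ≤ ENNReal.ofReal (B ^ 2 * (C * δ ^ (-(n : ℝ)))) +
        ∫⁻ w, ‖f w‖ₑ ^ 2 := by
  obtain ⟨C, hC, h⟩ := exists_setLIntegral_compl_ball_rpow_le (n := n) (a := n)
    (by exact_mod_cast hn)
  refine ⟨C, hC, fun A B hB hA δ hδ f z hf => ?_⟩
  have hmeas : Measurable fun w : Rn n => (Metric.ball z δ)ᶜ.indicator (fun w =>
      ENNReal.ofReal (B ^ 2) * ENNReal.ofReal (‖w - z‖ ^ (-(n : ℝ) - n))) w :=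
    Measurable.indicator (by fun_prop) measurableSet_ball.compl
  calc ∫⁻ w, ‖A z w * f w‖ₑ
      ≤ ∫⁻ w, ((Metric.ball z δ)ᶜ.indicator (fun w =>
          ENNReal.ofReal (B ^ 2) * ENNReal.ofReal (‖w - z‖ ^ (-(n : ℝ) - n))) w + ‖f w‖ₑ ^ 2) := by
        refine lintegral_mono fun w => ?_
        by_cases hw : f w = 0
        · simp [hw]
        have hd := hf w hw
        have hzw : z ≠ w := by rintro rfl; simp at hd; linarith
        have hmem : w ∈ (Metric.ball z δ)ᶜ := by
          simpa [dist_eq_norm, norm_sub_rev] using hd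
        rw [indicator_of_mem hmem, enorm_mul]
        refine (ENNReal.mul_le_sq_add_sq _ _).trans (add_le_add_left ?_ _)
        rw [← ofReal_norm, ← ENNReal.ofReal_pow (norm_nonneg _), ← ENNReal.ofReal_mul (by positivity)]
        refine ENNReal.ofReal_le_ofReal ?_
        have hpos : 0 < ‖w - z‖ := norm_pos_iff.2 (sub_ne_zero.2 hzw.symm)
        calc ‖A z w‖ ^ 2 ≤ (B / ‖z - w‖ ^ (n : ℝ)) ^ 2 := by gcongr; exact hA z w hzw
          _ = _ := by
            rw [norm_sub_rev z w, sub_eq_add_neg (-(n : ℝ)), Real.rpow_add hpos,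
              Real.rpow_neg hpos.le]
            field_simp
    _ = (∫⁻ w in (Metric.ball z δ)ᶜ, ENNReal.ofReal (B ^ 2) *
          ENNReal.ofReal (‖w - z‖ ^ (-(n : ℝ) - n))) + ∫⁻ w, ‖f w‖ₑ ^ 2 := by
        rw [lintegral_add_left hmeas, lintegral_indicator measurableSet_ball.compl]
    _ ≤ _ := by
        rw [lintegral_const_mul' _ _ ENNReal.ofReal_ne_top, ENNReal.ofReal_mul (by positivity)]
        gcongr
        exact h z δ hδ

/-- The form of the operator, tested against the indicator function of a set `E` at positive
distance from the support of `f`, is computed by the kernel. This is Fubini's theorem, which is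
justified by the absolute size bound of the kernel. -/
theorem integral_pairIntegrand_indicator {𝕜 : Type*} [RCLike 𝕜] {n : ℕ} (hn : 1 ≤ n)
    {s s₁ s₂ : ℝ} (hs₁ : s₁ ∈ Ioo (0 : ℝ) 1) (hs₂ : s₂ ∈ Ioo (0 : ℝ) 1)
    (hsum : s₁ + s₂ = 2 * s) {K : Rn n × Rn n → 𝕜} (hK : MemLp K ∞ volume) {f : Rn n → 𝕜}
    (hf : MemLp f 2 volume) {E : Set (Rn n)} (hE : MeasurableSet E) (hvE : volume E ≠ ⊤)
    {δ : ℝ} (hδ : 0 < δ) (hsep : ∀ z ∈ E, ∀ w, f w ≠ 0 → δ ≤ ‖z - w‖) :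
    ∫ q, pairIntegrand K s s₁ s₂ f (E.indicator fun _ => 1) q =
      ∫ z in E, ∫ w, kernelA K s s₁ s₂ z w * f w := by
  obtain ⟨C, hC, hsz⟩ := exists_kernelA_size_le 𝕜 hn hs₁ hs₂ hsum
  obtain ⟨C', hC', hL⟩ := exists_lintegral_kernel_mul_le 𝕜 hn
  set M := (eLpNorm K ∞ volume).toReal with hM
  set φ : Rn n → 𝕜 := E.indicator fun _ => 1 with hφ
  have hφm : Measurable φ := measurable_const.indicator hE
  set H : (Rn n × Rn n) × (Rn n × Rn n) → 𝕜 := fun r =>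
    kernelIntegrand K s s₁ s₂ r.2.1 r.2.2 r.1 * (f r.2.2 * φ r.2.1) with hH
  have hHm : AEStronglyMeasurable H
      ((volume : Measure (Rn n × Rn n)).prod (volume : Measure (Rn n × Rn n))) := by
    have h1 := measurable_powDiff_comp s₁ (x := fun r : (Rn n × Rn n) × (Rn n × Rn n) => r.1.1)
      (y := fun r => r.1.2) (z := fun r => r.2.1) (by fun_prop) (by fun_prop) (by fun_prop)
    have h2 := measurable_powDiff_comp s₂ (x := fun r : (Rn n × Rn n) × (Rn n × Rn n) => r.1.1)
      (y := fun r => r.1.2) (z := fun r => r.2.2) (by fun_prop) (by fun_prop) (by fun_prop)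
    have h3 : Measurable fun r : (Rn n × Rn n) × (Rn n × Rn n) =>
        powDiff s₁ r.1.1 r.1.2 r.2.1 * powDiff s₂ r.1.1 r.1.2 r.2.2 /
          ‖r.1.1 - r.1.2‖ ^ (n + 2 * s) := (h1.mul h2).div (by fun_prop)
    refine (AEStronglyMeasurable.mul (AEStronglyMeasurable.comp_fst hK.1)
      (RCLike.continuous_ofReal.measurable.comp h3).aestronglyMeasurable).mul ?_
    refine AEStronglyMeasurable.mul ?_ ?_
    · exact AEStronglyMeasurable.comp_snd (AEStronglyMeasurable.comp_snd hf.1)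
    · exact (hφm.comp (by fun_prop)).aestronglyMeasurable
  have hHi : Integrable H
      ((volume : Measure (Rn n × Rn n)).prod (volume : Measure (Rn n × Rn n))) := by
    refine ⟨hHm, ?_⟩
    have hc := hL (fun z w => ((C * M / ‖z - w‖ ^ (n : ℝ) : ℝ) : 𝕜)) (C * M) (by positivity)
      (fun z w _ => by rw [RCLike.norm_ofReal, abs_of_nonneg (by positivity)]) δ hδ f
    have hfin : ENNReal.ofReal ((C * M) ^ 2 * (C' * δ ^ (-(n : ℝ)))) + ∫⁻ w, ‖f w‖ₑ ^ 2 < ⊤ := by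
      rw [lintegral_enorm_sq_eq_eLpNorm]
      have := hf.2
      finiteness
    rw [HasFiniteIntegral, lintegral_prod_symm _ hHm.enorm]
    calc ∫⁻ p : Rn n × Rn n, ∫⁻ q, ‖H (q, p)‖ₑ
        ≤ ∫⁻ p : Rn n × Rn n, E.indicator (fun _ => 1) p.1 *
            ‖((C * M / ‖p.1 - p.2‖ ^ (n : ℝ) : ℝ) : 𝕜) * f p.2‖ₑ := by
          refine lintegral_mono fun p => ?_
          simp only [hH]
          by_cases hp : p.1 ∈ E
          swap
          · simp [hφ, hp]
          by_cases hfp : f p.2 = 0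
          · simp [hfp]
          have hne : p.1 ≠ p.2 := by
            intro he
            have := hsep _ hp _ hfp
            rw [he] at this; simp at this; linarith
          rw [indicator_of_mem hp, one_mul, hφ]
          simp only [indicator_of_mem hp, mul_one, enorm_mul]
          rw [lintegral_mul_const' _ _ (by finiteness)]
          gcongr
          refine (hsz K hK _ _ hne).2.2.trans_eq ?_
          rw [← ofReal_norm (((C * M / ‖p.1 - p.2‖ ^ (n : ℝ) : ℝ) : 𝕜)), RCLike.norm_ofReal,
            abs_of_nonneg (by positivity), div_eq_mul_inv, ← Real.rpow_neg (norm_nonneg _)]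
      _ ≤ ∫⁻ z, ∫⁻ w, E.indicator (fun _ => 1) z *
            ‖((C * M / ‖z - w‖ ^ (n : ℝ) : ℝ) : 𝕜) * f w‖ₑ := by
          rw [Measure.volume_eq_prod, lintegral_prod]
          refine AEMeasurable.mul ?_ (AEStronglyMeasurable.enorm ?_)
          · exact ((measurable_const.indicator hE).comp measurable_fst).aemeasurable
          · refine AEStronglyMeasurable.mul ?_ (AEStronglyMeasurable.comp_snd hf.1)
            exact (RCLike.continuous_ofReal.measurable.comp (by fun_prop)).aestronglyMeasurable
      _ ≤ ∫⁻ z, E.indicator (fun _ => ENNReal.ofReal ((C * M) ^ 2 * (C' * δ ^ (-(n : ℝ)))) +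
            ∫⁻ w, ‖f w‖ₑ ^ 2) z := by
          refine lintegral_mono fun z => ?_
          by_cases hz : z ∈ E
          · simpa only [indicator_of_mem hz, one_mul] using hc z (hsep z hz)
          · simp [hz]
      _ < ⊤ := by
          rw [lintegral_indicator hE, setLIntegral_const]
          exact ENNReal.mul_lt_top hfin hvE.lt_top
  have e1 : ∀ q, pairIntegrand K s s₁ s₂ f φ q = ∫ p, H (q, p) := by
    intro q
    have : ∀ p : Rn n × Rn n, H (q, p) = K q * (((‖q.1 - q.2‖ ^ (n + 2 * s))⁻¹ : ℝ) : 𝕜) *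
        ((((powDiff s₁ q.1 q.2 p.1 : ℝ) : 𝕜) * φ p.1) *
          (((powDiff s₂ q.1 q.2 p.2 : ℝ) : 𝕜) * f p.2)) := by
      intro p
      simp only [hH, kernelIntegrand, div_eq_mul_inv]
      push_cast
      ring
    simp only [this]
    rw [integral_const_mul, Measure.volume_eq_prod, integral_prod_mul
      (fun z => ((powDiff s₁ q.1 q.2 z : ℝ) : 𝕜) * φ z)
      (fun w => ((powDiff s₂ q.1 q.2 w : ℝ) : 𝕜) * f w), pairIntegrand, diffPot, diffPot]
    ring
  have e2 : ∀ p : Rn n × Rn n, ∫ q, H (q, p) = kernelA K s s₁ s₂ p.1 p.2 * (f p.2 * φ p.1) := by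
    intro p
    simp only [hH]
    rw [integral_mul_const, kernelA]
  have hi2 : Integrable (fun p : Rn n × Rn n => kernelA K s s₁ s₂ p.1 p.2 * (f p.2 * φ p.1))
      ((volume : Measure (Rn n)).prod (volume : Measure (Rn n))) := by
    exact hHi.integral_prod_right.congr (Filter.Eventually.of_forall e2)
  simp only [e1]
  rw [integral_integral_swap (f := fun q p => H (q, p)) hHi]
  simp only [e2]
  rw [Measure.volume_eq_prod, integral_prod _ hi2, ← integral_indicator hE]
  refine integral_congr_ae (Filter.Eventually.of_forall fun z => ?_)
  by_cases hz : z ∈ E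
  · simp [hφ, hz]
  · simp [hφ, hz]

/-- `T f` is given by the kernel `A` off every closed set carrying `f`. The support of `f` is not
required to be compact. -/
def IsAssociated {𝕜 : Type*} [RCLike 𝕜] {n : ℕ} (A : Rn n → Rn n → 𝕜)
    (T : LpRn 𝕜 n 2 →L[𝕜] LpRn 𝕜 n 2) : Prop :=
  ∀ (f : Rn n → 𝕜) (hf : MemLp f 2 volume) (F : Set (Rn n)), IsClosed F → (∀ w ∉ F, f w = 0) →
    ∀ᵐ z : Rn n, z ∉ F → T (hf.toLp f) z = ∫ w, A z w * f w

theorem integrable_kernel_mul {𝕜 : Type*} [RCLike 𝕜] {n : ℕ} (hn : 1 ≤ n)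
    {A : Rn n → Rn n → 𝕜} {B : ℝ} (hB : 0 ≤ B)
    (hm : StronglyMeasurable fun p : Rn n × Rn n => A p.1 p.2)
    (hA : ∀ z w, z ≠ w → ‖A z w‖ ≤ B / ‖z - w‖ ^ (n : ℝ)) {f : Rn n → 𝕜}
    (hf : MemLp f 2 volume) {F : Set (Rn n)} (hF : IsClosed F) (hfF : ∀ w ∉ F, f w = 0)
    {z : Rn n} (hz : z ∉ F) : Integrable fun w => A z w * f w := by
  obtain ⟨C, hC, h⟩ := exists_lintegral_kernel_mul_le 𝕜 hn
  obtain ⟨δ, hδ, hd⟩ := Metric.isOpen_iff.1 hF.isOpen_compl z hz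
  refine ⟨((hm.comp_measurable (measurable_prodMk_left (x := z))).aestronglyMeasurable).mul hf.1,
    (h A B hB hA δ hδ f z fun w hw => ?_).trans_lt ?_⟩
  · by_contra! hlt
    exact hw (hfF w (hd (by rwa [Metric.mem_ball, dist_eq_norm, norm_sub_rev])))
  · rw [lintegral_enorm_sq_eq_eLpNorm]
    have := hf.2
    finiteness

/-- A closed set `F` has a complement exhausted by the bounded sets `E k` of points at distance at
least `1 / (k + 1)` from `F`, and two integrable functions on `E k` with the same integrals over all
measurable subsets agree a.e. -/
theorem isAssociated_of_integral_indicator {𝕜 : Type*} [RCLike 𝕜] {n : ℕ} (hn : 1 ≤ n)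
    {A : Rn n → Rn n → 𝕜} {B : ℝ} (hB : 0 ≤ B)
    (hm : StronglyMeasurable fun p : Rn n × Rn n => A p.1 p.2)
    (hA : ∀ z w, z ≠ w → ‖A z w‖ ≤ B / ‖z - w‖ ^ (n : ℝ)) {T : LpRn 𝕜 n 2 →L[𝕜] LpRn 𝕜 n 2}
    (h : ∀ (f : Rn n → 𝕜) (hf : MemLp f 2 volume) (E : Set (Rn n)), MeasurableSet E →
      volume E ≠ ⊤ → ∀ δ : ℝ, 0 < δ → (∀ z ∈ E, ∀ w, f w ≠ 0 → δ ≤ ‖z - w‖) →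
      ∫ z in E, T (hf.toLp f) z = ∫ z in E, ∫ w, A z w * f w) :
    IsAssociated A T := by
  intro f hf F hF hfF
  obtain ⟨C, hC, hL⟩ := exists_lintegral_kernel_mul_le 𝕜 hn
  set E : ℕ → Set (Rn n) := fun k => {z | ∀ w ∈ F, 1 / ((k : ℝ) + 1) ≤ ‖z - w‖} ∩
    Metric.closedBall 0 k with hEdef
  have hEc : ∀ k, IsClosed (E k) := by
    intro k
    refine IsClosed.inter ?_ Metric.isClosed_closedBall
    simp only [ofPred_forall]
    exact isClosed_biInter fun w _ => isClosed_le continuous_const (by fun_prop)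
  have hEv : ∀ k, volume (E k) < ⊤ := fun k =>
    (measure_mono inter_subset_right).trans_lt measure_closedBall_lt_top
  have hsep : ∀ k, ∀ z ∈ E k, ∀ w, f w ≠ 0 → 1 / ((k : ℝ) + 1) ≤ ‖z - w‖ := fun k z hz w hw =>
    hz.1 w (by_contra fun hwF => hw (hfF w hwF))
  have hcov : ∀ z ∉ F, ∃ k, z ∈ E k := by
    intro z hz
    obtain ⟨δ, hδ, hd⟩ := Metric.isOpen_iff.1 hF.isOpen_compl z hz
    obtain ⟨k₁, hk₁⟩ := exists_nat_one_div_lt hδ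
    obtain ⟨k₂, hk₂⟩ := exists_nat_ge ‖z‖
    refine ⟨max k₁ k₂, fun w hw => ?_, ?_⟩
    · have h1 : δ ≤ ‖z - w‖ := by
        by_contra! hlt
        exact hd (by rwa [Metric.mem_ball, dist_eq_norm, norm_sub_rev]) hw
      refine le_trans ?_ (hk₁.le.trans h1)
      have : (k₁ : ℝ) ≤ (max k₁ k₂ : ℕ) := by exact_mod_cast le_max_left _ _
      gcongr
    · rw [mem_closedBall_zero_iff]
      exact hk₂.trans (by exact_mod_cast le_max_right _ _)
  have hk : ∀ k, ∀ᵐ z, z ∈ E k → T (hf.toLp f) z = ∫ w, A z w * f w := by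
    intro k
    have hδ : (0 : ℝ) < 1 / ((k : ℝ) + 1) := by positivity
    rw [← ae_restrict_iff' (hEc k).measurableSet]
    have : IsFiniteMeasure ((volume : Measure (Rn n)).restrict (E k)) :=
      ⟨by simpa using hEv k⟩
    refine Integrable.ae_eq_of_forall_setIntegral_eq _ _ ?_ ?_ ?_
    · exact ((Lp.memLp (T (hf.toLp f))).restrict _).integrable (by norm_num)
    · refine ⟨?_, ?_⟩
      · refine AEStronglyMeasurable.restrict ?_
        exact AEStronglyMeasurable.integral_prod_right'
          (f := fun p : Rn n × Rn n => A p.1 p.2 * f p.2)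
          (hm.aestronglyMeasurable.mul (AEStronglyMeasurable.comp_snd hf.1))
      · refine lt_of_le_of_lt (setLIntegral_mono' (hEc k).measurableSet fun z hz =>
          (enorm_integral_le_lintegral_enorm _).trans
            (hL A B hB hA _ hδ f z (hsep k z hz))) ?_
        rw [setLIntegral_const, lintegral_enorm_sq_eq_eLpNorm]
        have := hf.2
        have := hEv k
        finiteness
    · intro S hS _
      rw [Measure.restrict_restrict hS]
      exact h f hf (S ∩ E k) (hS.inter (hEc k).measurableSet)
        ((measure_mono inter_subset_right).trans_lt (hEv k)).ne _ hδ
        fun z hz => hsep k z hz.2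
  filter_upwards [ae_all_iff.2 hk] with z hz hzF
  obtain ⟨k, hk⟩ := hcov z hzF
  exact hz k hk

/-- The operator `T_{K,s₁,s₂}` on `L²`, with its bilinear form on all of `L²` and its kernel. -/
theorem exists_operator_isAssociated (𝕜 : Type*) [RCLike 𝕜] {n : ℕ} (hn : 1 ≤ n) {s s₁ s₂ : ℝ}
    (hs₁ : s₁ ∈ Ioo (0 : ℝ) 1) (hs₂ : s₂ ∈ Ioo (0 : ℝ) 1) (hsum : s₁ + s₂ = 2 * s) :
    ∃ C : ℝ, 0 < C ∧ ∀ K : Rn n × Rn n → 𝕜, MemLp K ∞ volume →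
      ∃ T : LpRn 𝕜 n 2 →L[𝕜] LpRn 𝕜 n 2, ‖T‖ ≤ C * (eLpNorm K ∞ volume).toReal ∧
        (∀ (f φ : Rn n → 𝕜) (hf : MemLp f 2 volume), MemLp φ 2 volume →
          Integrable (pairIntegrand K s s₁ s₂ f φ) volume ∧
          ∫ z, T (hf.toLp f) z * φ z = ∫ q, pairIntegrand K s s₁ s₂ f φ q) ∧
        IsAssociated (kernelA K s s₁ s₂) T := by
  obtain ⟨C, hC, h⟩ := exists_operator 𝕜 hn hs₁ hs₂ hsum
  obtain ⟨C', hC', hsz⟩ := exists_kernelA_size_le 𝕜 hn hs₁ hs₂ hsum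
  refine ⟨C, hC, fun K hK => ?_⟩
  obtain ⟨T, hT, hTp⟩ := h K hK
  refine ⟨T, hT, hTp, isAssociated_of_integral_indicator hn
    (B := C' * (eLpNorm K ∞ volume).toReal) (by positivity)
    (stronglyMeasurable_kernelA hK.1 s s₁ s₂) (fun z w hzw => ?_)
    fun f hf E hE hvE δ hδ hsep => ?_⟩
  · refine (hsz K hK z w hzw).2.1.trans_eq ?_
    rw [Real.rpow_neg (norm_nonneg _), div_eq_mul_inv]
  · rw [← integral_pairIntegrand_indicator hn hs₁ hs₂ hsum hK hf hE hvE hδ hsep,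
      ← (hTp f (E.indicator fun _ => 1) hf (memLp_indicator_const 2 hE 1 (Or.inr hvE))).2,
      ← integral_indicator hE]
    refine integral_congr_ae (Filter.Eventually.of_forall fun z => ?_)
    by_cases hz : z ∈ E <;> simp [hz]

theorem isOperatorT_of_pairIntegrand {𝕜 : Type*} [RCLike 𝕜] {n : ℕ} (hn : 1 ≤ n)
    {s s₁ s₂ : ℝ} (hs₁ : 0 < s₁) (hs₂ : 0 < s₂) {K : Rn n × Rn n → 𝕜}
    {T : LpRn 𝕜 n 2 →L[𝕜] LpRn 𝕜 n 2}
    (h : ∀ (f φ : Rn n → 𝕜) (hf : MemLp f 2 volume), MemLp φ 2 volume →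
      Integrable (pairIntegrand K s s₁ s₂ f φ) volume ∧
      ∫ z, T (hf.toLp f) z * φ z = ∫ q, pairIntegrand K s s₁ s₂ f φ q) :
    IsOperatorT K s s₁ s₂ T := by
  intro f φ hf hfc hφ hφc
  rw [formIntegrand_eq_pairIntegrand hn hs₁ hs₂ K hf.continuous hfc hφ.continuous hφc]
  exact h f φ (memLp_of_test hf hfc 2) (memLp_of_test hφ hφc 2)

/-! ### Calderón–Zygmund decomposition -/

theorem volume_closedBall_mul {n : ℕ} (x : Rn n) {k r : ℝ} (hk : 0 < k) :
    volume (Metric.closedBall x (k * r)) =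
      ENNReal.ofReal (k ^ n) * volume (Metric.closedBall x r) := by
  rw [Measure.addHaar_closedBall_mul_of_pos volume x hk, finrank_euclideanSpace_fin,
    Measure.addHaar_closedBall_center volume x]

/-- Lebesgue differentiation: if all averages of `‖f‖` over balls centred at `x` are at most `t`,
then `‖f x‖ ≤ t`, for a.e. `x`. -/
theorem ae_norm_le_of_forall_setLIntegral_closedBall_le {E : Type*} [NormedAddCommGroup E] {n : ℕ}
    {f : Rn n → E} (hf : Integrable f) {t : ℝ} (ht : 0 ≤ t) :
    ∀ᵐ x : Rn n, (∀ r > 0, ∫⁻ y in Metric.closedBall x r, ‖f y‖ₑ ≤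
      ENNReal.ofReal t * volume (Metric.closedBall x r)) → ‖f x‖ ≤ t := by
  filter_upwards [IsUnifLocDoublingMeasure.ae_tendsto_average volume
    hf.norm.locallyIntegrable 1] with x hx h
  have hlim := hx (fun _ : ℝ => x) id Filter.tendsto_id (by
    filter_upwards [self_mem_nhdsWithin] with r hr
    have hr' : 0 < r := hr
    simpa using hr'.le)
  refine le_of_tendsto hlim ?_
  filter_upwards [self_mem_nhdsWithin] with r hr
  have hV : 0 < (volume : Measure (Rn n)).real (Metric.closedBall x r) :=
    ENNReal.toReal_pos (Metric.measure_closedBall_pos volume x hr).ne'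
      measure_closedBall_lt_top.ne
  rw [id, setAverage_eq, smul_eq_mul, inv_mul_le_iff₀ hV,
    integral_norm_eq_lintegral_enorm hf.1.restrict]
  refine ENNReal.toReal_le_of_le_ofReal (by positivity) ((h r hr).trans_eq ?_)
  rw [mul_comm, ENNReal.ofReal_mul measureReal_nonneg, ofReal_measureReal
    measure_closedBall_lt_top.ne]

/-- Every integrable function is covered, where it exceeds `t`, by the five-fold enlargements of
disjoint balls on which its average is at least `t`, while its average on the enlargements is at
most `t`. -/
theorem exists_disjoint_closedBall_cover {E : Type*} [NormedAddCommGroup E] {n : ℕ} (hn : 1 ≤ n)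
    {f : Rn n → E} (hf : Integrable f) {t : ℝ} (ht : 0 < t) :
    ∃ (u : Set (Rn n)) (r : Rn n → ℝ), u.Countable ∧ (∀ x ∈ u, 0 < r x) ∧
      u.PairwiseDisjoint (fun x => Metric.closedBall x (r x)) ∧
      (∀ x ∈ u, ENNReal.ofReal t * volume (Metric.closedBall x (r x)) ≤
        ∫⁻ y in Metric.closedBall x (r x), ‖f y‖ₑ) ∧
      (∀ x ∈ u, ∫⁻ y in Metric.closedBall x (5 * r x), ‖f y‖ₑ ≤
        ENNReal.ofReal t * volume (Metric.closedBall x (5 * r x))) ∧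
      ∀ᵐ y : Rn n, y ∉ (⋃ x ∈ u, Metric.closedBall x (5 * r x)) → ‖f y‖ ≤ t := by
  set G : Rn n → Set ℝ := fun x => {r | 0 < r ∧ ENNReal.ofReal t *
    volume (Metric.closedBall x r) < ∫⁻ y in Metric.closedBall x r, ‖f y‖ₑ} with hG
  set V := (volume : Measure (Rn n)).real (Metric.closedBall 0 1) with hV
  have hVpos : 0 < V := ENNReal.toReal_pos
    (Metric.measure_closedBall_pos volume _ one_pos).ne' measure_closedBall_lt_top.ne
  -- the radii of balls with large average are bounded
  obtain ⟨R, hR⟩ : ∃ R : ℝ, ∀ x, ∀ r ∈ G x, r ≤ R := by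
    refine ⟨max 1 ((∫ y, ‖f y‖) / (t * V)), fun x r hr => ?_⟩
    by_contra! hlt
    obtain ⟨h1, h2⟩ := max_lt_iff.1 hlt
    refine hr.2.not_ge ((setLIntegral_le_lintegral _ _).trans ?_)
    rw [← ofReal_integral_norm_eq_lintegral_enorm hf, Measure.addHaar_closedBall' volume x hr.1.le,
      finrank_euclideanSpace_fin, ← ofReal_measureReal measure_closedBall_lt_top.ne,
      ← ENNReal.ofReal_mul (by positivity), ← ENNReal.ofReal_mul ht.le]
    refine ENNReal.ofReal_le_ofReal ?_
    have h3 : ∫ y, ‖f y‖ < r * (t * V) := (div_lt_iff₀ (by positivity)).1 h2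
    have h4 : r ≤ r ^ n := le_self_pow₀ h1.le (by omega)
    calc ∫ y, ‖f y‖ ≤ r * (t * V) := h3.le
      _ ≤ r ^ n * (t * V) := by gcongr
      _ = t * (r ^ n * V) := by ring
  -- a radius above half the supremum is maximal up to the factor `2`
  have hsel : ∀ x, (G x).Nonempty → ∃ r ∈ G x, ∀ ρ, 2 * r ≤ ρ → ρ ∉ G x := by
    intro x hx
    have hb : BddAbove (G x) := ⟨R, fun r hr => hR x r hr⟩
    obtain ⟨r₀, hr₀⟩ := hx
    have hpos : 0 < sSup (G x) := hr₀.1.trans_le (le_csSup hb hr₀)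
    obtain ⟨r, hr, hlt⟩ := exists_lt_of_lt_csSup ⟨r₀, hr₀⟩ (half_lt_self hpos)
    refine ⟨r, hr, fun ρ hρ hρG => ?_⟩
    have := le_csSup hb hρG
    linarith
  choose! r hrG hrρ using hsel
  obtain ⟨u, huS, hdisj, hcov⟩ := Vitali.exists_disjoint_subfamily_covering_enlargement_closedBall
    {x | (G x).Nonempty} (fun x => x) r R (fun x hx => hR x _ (hrG x hx)) 5 (by norm_num)
  have hpos : ∀ x ∈ u, 0 < r x := fun x hx => (hrG x (huS hx)).1
  refine ⟨u, r, hdisj.countable_of_nonempty_interior fun x hx => ?_, hpos, hdisj,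
    fun x hx => (hrG x (huS hx)).2.le, fun x hx => ?_, ?_⟩
  · exact ⟨x, Metric.ball_subset_interior_closedBall (Metric.mem_ball_self (hpos x hx))⟩
  · by_contra! hlt
    have := hpos x hx
    exact hrρ x (huS hx) (5 * r x) (by linarith) ⟨by linarith, hlt⟩
  · filter_upwards [ae_norm_le_of_forall_setLIntegral_closedBall_le hf ht.le] with y hy hyu
    refine hy fun ρ hρ => ?_
    by_contra! hlt
    have hyG : (G y).Nonempty := ⟨ρ, hρ, hlt⟩
    obtain ⟨x, hx, hsub⟩ := hcov y hyG
    exact hyu (mem_biUnion hx (hsub (Metric.mem_closedBall_self (hrG y hyG).1.le)))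

/-- A countable union of measurable sets is a disjoint union of measurable subsets of its members.
-/
theorem Set.Countable.exists_pairwiseDisjoint_subset {ι α : Type*} [MeasurableSpace α]
    {u : Set ι} (hu : u.Countable) {D : ι → Set α} (hD : ∀ x ∈ u, MeasurableSet (D x)) :
    ∃ Q : ι → Set α, (∀ x ∈ u, MeasurableSet (Q x)) ∧ (∀ x ∈ u, Q x ⊆ D x) ∧
      u.PairwiseDisjoint Q ∧ ⋃ x ∈ u, Q x = ⋃ x ∈ u, D x := by
  obtain ⟨e, he⟩ := Set.countable_iff_exists_injOn.1 hu
  refine ⟨fun x => D x \ ⋃ y ∈ {y ∈ u | e y < e x}, D y, fun x hx => ?_,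
    fun x _ => sdiff_subset, fun x hx y hy hxy => ?_, ?_⟩
  · exact (hD x hx).diff (MeasurableSet.biUnion (hu.mono (sep_subset _ _)) fun y hy => hD y hy.1)
  · rw [Function.onFun, Set.disjoint_left]
    intro z hzx hzy
    rcases lt_or_gt_of_ne (fun h => hxy (he hx hy h)) with h | h
    · exact hzy.2 (mem_biUnion (show x ∈ {w ∈ u | e w < e y} from ⟨hx, h⟩) hzx.1)
    · exact hzx.2 (mem_biUnion (show y ∈ {w ∈ u | e w < e x} from ⟨hy, h⟩) hzy.1)
  · refine Subset.antisymm (iUnion₂_mono fun x _ => sdiff_subset) fun z hz => ?_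
    simp only [mem_iUnion, exists_prop] at hz
    obtain ⟨x, hx, hmin⟩ := (InvImage.wf e Nat.lt_wfRel.wf).has_min {x | x ∈ u ∧ z ∈ D x} hz
    refine mem_biUnion hx.1 ⟨hx.2, fun hz' => ?_⟩
    simp only [mem_iUnion, exists_prop] at hz'
    obtain ⟨y, hy, hzy⟩ := hz'
    exact hmin y ⟨hy.1, hzy⟩ hy.2

/-- The restriction of `f` to `Q` becomes a function of mean zero when its integral is subtracted as
a constant multiple of the indicator function of `D`. The set `D` need not contain `Q`. -/
theorem exists_mean_correction {𝕜 : Type*} [RCLike 𝕜] {α : Type*} [MeasurableSpace α]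
    {μ : Measure α} {f : α → 𝕜} (h₁ : MemLp f 1 μ) (h₂ : MemLp f 2 μ) {Q D : Set α}
    (hQ : MeasurableSet Q) (hD : MeasurableSet D) (hD0 : μ D ≠ 0) (hDt : μ D ≠ ⊤) :
    ∃ c : 𝕜, ‖c‖ₑ * μ D ≤ ∫⁻ y in Q, ‖f y‖ₑ ∂μ ∧
      MemLp (Q.indicator f - D.indicator fun _ => c) 2 μ ∧
      Integrable (Q.indicator f - D.indicator fun _ => c) μ ∧
      ∫ y, (Q.indicator f - D.indicator fun _ => c) y ∂μ = 0 ∧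
      ∫⁻ y, ‖(Q.indicator f - D.indicator fun _ => c) y‖ₑ ∂μ ≤ 2 * ∫⁻ y in Q, ‖f y‖ₑ ∂μ := by
  have hV : (μ.real D : 𝕜) ≠ 0 := by
    exact_mod_cast (ENNReal.toReal_pos hD0 hDt).ne'
  have hc : ‖(∫ y in Q, f y ∂μ) / (μ.real D : 𝕜)‖ₑ * μ D ≤ ∫⁻ y in Q, ‖f y‖ₑ ∂μ := by
    refine le_trans (le_of_eq ?_) (enorm_integral_le_lintegral_enorm _)
    have h1 : ‖(μ.real D : 𝕜)‖ₑ = μ D := by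
      rw [← ofReal_norm, RCLike.norm_ofReal, abs_of_nonneg measureReal_nonneg,
        ofReal_measureReal hDt]
    calc _ = ‖(∫ y in Q, f y ∂μ) / (μ.real D : 𝕜)‖ₑ * ‖(μ.real D : 𝕜)‖ₑ := by rw [h1]
      _ = _ := by rw [← enorm_mul, div_mul_cancel₀ _ hV]
  have hi1 := (memLp_one_iff_integrable.1 h₁).indicator hQ
  have hi2 : Integrable (D.indicator fun _ => (∫ y in Q, f y ∂μ) / (μ.real D : 𝕜)) μ :=
    (integrable_indicator_iff hD).2 (integrableOn_const hDt)
  refine ⟨(∫ y in Q, f y ∂μ) / (μ.real D : 𝕜), hc,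
    (h₂.indicator hQ).sub (memLp_indicator_const 2 hD _ (Or.inr hDt)), hi1.sub hi2, ?_, ?_⟩
  · simp only [Pi.sub_apply]
    rw [integral_sub hi1 hi2, integral_indicator hQ, integral_indicator hD, setIntegral_const,
      RCLike.real_smul_eq_coe_mul, mul_div_cancel₀ _ hV, sub_self]
  · calc ∫⁻ y, ‖(Q.indicator f - D.indicator fun _ => (∫ y in Q, f y ∂μ) / (μ.real D : 𝕜)) y‖ₑ ∂μ
        ≤ ∫⁻ y, (‖Q.indicator f y‖ₑ +
            ‖D.indicator (fun _ => (∫ y in Q, f y ∂μ) / (μ.real D : 𝕜)) y‖ₑ) ∂μ :=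
          lintegral_mono fun y => enorm_sub_le
      _ = ∫⁻ y in Q, ‖f y‖ₑ ∂μ + ‖(∫ y in Q, f y ∂μ) / (μ.real D : 𝕜)‖ₑ * μ D := by
          rw [lintegral_add_left' hi1.1.enorm]
          simp only [enorm_indicator_eq_indicator_enorm]
          rw [lintegral_indicator hQ, lintegral_indicator hD, setLIntegral_const]
      _ ≤ _ := by rw [two_mul]; gcongr

/-- The Calderón–Zygmund decomposition `f = g + ∑ b_x + e` of `f ∈ L¹ ∩ L²` at height `t`, with
finitely many atoms `b_x`. The sets `Q x ⊆ B(x, 5 r x)` are disjoint and cover the points where `|f|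
> t`, and `b_x` is `f 1_{Q x}` minus a constant on `B(x, r x)`; these smaller balls are disjoint,
which bounds `g`. The error `e`, the restriction of `f` to all but finitely many of the sets `Q x`,
is small in `L²`; it spares a limiting argument for an infinite sum of atoms. -/
theorem exists_calderonZygmund_decomposition {𝕜 : Type*} [RCLike 𝕜] {n : ℕ} (hn : 1 ≤ n)
    {f : Rn n → 𝕜} (h₁ : MemLp f 1 volume) (h₂ : MemLp f 2 volume) {t : ℝ} (ht : 0 < t)
    {ε : ℝ≥0∞} (hε : ε ≠ 0) :
    ∃ (F : Finset (Rn n)) (r : Rn n → ℝ) (b : Rn n → Rn n → 𝕜) (g e : Rn n → 𝕜),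
      f = g + ∑ x ∈ F, b x + e ∧ MemLp g 2 volume ∧
      ∫⁻ y, ‖g y‖ₑ ^ 2 ≤ ENNReal.ofReal ((1 + 5 ^ n) * t) * (2 * ∫⁻ y, ‖f y‖ₑ) ∧
      (∀ x ∈ F, 0 < r x ∧ MemLp (b x) 2 volume ∧ Integrable (b x) ∧ ∫ y, b x y = 0 ∧
        ∀ y ∉ Metric.closedBall x (5 * r x), b x y = 0) ∧
      ∑ x ∈ F, ∫⁻ y, ‖b x y‖ₑ ≤ 2 * ∫⁻ y, ‖f y‖ₑ ∧
      ENNReal.ofReal t * ∑ x ∈ F, volume (Metric.closedBall x (r x)) ≤ ∫⁻ y, ‖f y‖ₑ ∧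
      MemLp e 2 volume ∧ ∫⁻ y, ‖e y‖ₑ ^ 2 ≤ ε := by
  obtain ⟨u, r, huc, hr, hdisj, hlow, hup, hae⟩ :=
    exists_disjoint_closedBall_cover hn (memLp_one_iff_integrable.1 h₁) ht
  obtain ⟨Q, hQm, hQsub, hQd, hQU⟩ := huc.exists_pairwiseDisjoint_subset
    (D := fun x => Metric.closedBall x (5 * r x)) fun x _ => measurableSet_closedBall
  -- all but finitely many of the sets `Q x` carry little of the `L²` mass of `f`
  obtain ⟨F, hFu, hFε⟩ : ∃ F : Finset (Rn n), ↑F ⊆ u ∧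
      ∫⁻ y in ⋃ x ∈ u \ ↑F, Q x, ‖f y‖ₑ ^ 2 ≤ ε := by
    have hsum : ∑' x : u, ∫⁻ y in Q x, ‖f y‖ₑ ^ 2 ≠ ⊤ := by
      have : Countable u := huc.to_subtype
      rw [← lintegral_iUnion (fun x : u => hQm x x.2)
        (fun x y hxy => hQd x.2 y.2 fun h => hxy (Subtype.ext h))]
      refine ((setLIntegral_le_lintegral _ _).trans_lt ?_).ne
      rw [lintegral_enorm_sq_eq_eLpNorm]
      have := h₂.2
      finiteness
    obtain ⟨F₀, hF₀⟩ := ((ENNReal.tendsto_tsum_compl_atTop_zero hsum).eventually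
      (gt_mem_nhds (pos_iff_ne_zero.2 hε))).exists
    refine ⟨F₀.map (Function.Embedding.subtype _), ?_, ?_⟩
    · intro x hx
      simp only [Finset.coe_map, Function.Embedding.subtype_apply, mem_image] at hx
      obtain ⟨y, -, rfl⟩ := hx
      exact y.2
    · have hsubset : ⋃ x ∈ u \ ↑(F₀.map (Function.Embedding.subtype _)), Q x ⊆
          ⋃ x : {x : u // x ∉ F₀}, Q x := by
        intro z hz
        simp only [mem_iUnion, exists_prop] at hz ⊢
        obtain ⟨x, ⟨hxu, hxF⟩, hz⟩ := hz
        exact ⟨⟨⟨x, hxu⟩, fun h => hxF (by simpa using ⟨hxu, h⟩)⟩, hz⟩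
      have : Countable u := huc.to_subtype
      exact (lintegral_mono_set hsubset).trans ((lintegral_iUnion_le _ _).trans hF₀.le)
  have hBm : ∀ x, MeasurableSet (Metric.closedBall x (r x)) := fun x => measurableSet_closedBall
  have hcorr := fun x (hx : x ∈ u) => exists_mean_correction h₁ h₂ (hQm x hx) (hBm x)
    (Metric.measure_closedBall_pos volume x (hr x hx)).ne' measure_closedBall_lt_top.ne
  choose! c hc hb2 hb1 hb0 hbn using hcorr
  have hUm : MeasurableSet (⋃ x ∈ u, Q x) := MeasurableSet.biUnion huc hQm
  have hEm : MeasurableSet (⋃ x ∈ u \ ↑F, Q x) :=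
    MeasurableSet.biUnion (huc.mono sdiff_subset) fun x hx => hQm x hx.1
  have hQF : (F : Set (Rn n)).PairwiseDisjoint Q := hQd.subset hFu
  have hBF : (F : Set (Rn n)).PairwiseDisjoint fun x => Metric.closedBall x (r x) :=
    hdisj.subset hFu
  have hN : ∑ x ∈ F, ∫⁻ y in Q x, ‖f y‖ₑ ≤ ∫⁻ y, ‖f y‖ₑ := by
    rw [← lintegral_biUnion_finset hQF fun x hx => hQm x (hFu hx)]
    exact setLIntegral_le_lintegral _ _
  have hcle : ∀ x ∈ u, ‖c x‖ₑ ≤ ENNReal.ofReal (5 ^ n * t) := by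
    intro x hx
    have hB0 := (Metric.measure_closedBall_pos volume x (hr x hx)).ne'
    have h := (hc x hx).trans ((lintegral_mono_set (hQsub x hx)).trans (hup x hx))
    rw [volume_closedBall_mul x (by norm_num : (0 : ℝ) < 5), ← mul_assoc,
      ← ENNReal.ofReal_mul ht.le] at h
    rw [mul_comm]
    exact (ENNReal.mul_le_mul_iff_left hB0 measure_closedBall_lt_top.ne).1 h
  set g : Rn n → 𝕜 := (⋃ x ∈ u, Q x)ᶜ.indicator f +
    ∑ x ∈ F, (Metric.closedBall x (r x)).indicator (fun _ => c x) with hg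
  have hgL : MemLp g 2 volume := (h₂.indicator hUm.compl).add
    (memLp_finsetSum' _ fun x _ => memLp_indicator_const 2 (hBm x) _
      (Or.inr measure_closedBall_lt_top.ne))
  refine ⟨F, r, fun x => (Q x).indicator f - (Metric.closedBall x (r x)).indicator fun _ => c x,
    g, (⋃ x ∈ u \ ↑F, Q x).indicator f, ?_, hgL, ?_, fun x hx => ⟨hr x (hFu hx), hb2 x (hFu hx),
      hb1 x (hFu hx), hb0 x (hFu hx), fun y hy => ?_⟩, ?_, ?_, h₂.indicator hEm, ?_⟩
  · have e1 : ∑ x ∈ F, (Q x).indicator f = (⋃ x ∈ F, Q x).indicator f := by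
      rw [Finset.indicator_biUnion F Q hQF]
      ext z; simp
    have e2 : (⋃ x ∈ u, Q x) = (⋃ x ∈ F, Q x) ∪ ⋃ x ∈ u \ ↑F, Q x := by
      rw [← Finset.set_biUnion_coe, ← biUnion_union, union_sdiff_cancel hFu]
    have e3 : Disjoint (⋃ x ∈ F, Q x) (⋃ x ∈ u \ ↑F, Q x) := by
      rw [← Finset.set_biUnion_coe, disjoint_iUnion₂_left]
      intro x hx
      rw [disjoint_iUnion₂_right]
      intro y hy
      exact hQd (hFu hx) hy.1 fun h => hy.2 (h ▸ hx)
    have e5 : (⋃ x ∈ u, Q x).indicator f =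
        (⋃ x ∈ F, Q x).indicator f + (⋃ x ∈ u \ ↑F, Q x).indicator f := by
      rw [e2]; exact indicator_union_of_disjoint e3 f
    rw [Finset.sum_sub_distrib, e1, hg]
    nth_rw 1 [← indicator_compl_add_self (⋃ x ∈ u, Q x) f]
    rw [e5]
    abel
  · have hg1 : ∀ᵐ y, ‖g y‖ₑ ≤ ENNReal.ofReal ((1 + 5 ^ n) * t) := by
      filter_upwards [hae] with y hy
      have e4 : (∑ x ∈ F, (Metric.closedBall x (r x)).indicator (fun _ => c x)) y =
          ∑ x ∈ F, (Metric.closedBall x (r x)).indicator (fun _ => c x) y := by simp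
      rw [hg, Pi.add_apply, e4, add_mul, one_mul, ENNReal.ofReal_add ht.le (by positivity)]
      refine (enorm_add_le _ _).trans (add_le_add ?_ ?_)
      · by_cases hyU : y ∈ (⋃ x ∈ u, Q x)
        · rw [indicator_of_notMem (notMem_compl_iff.2 hyU), enorm_zero]
          exact zero_le
        · rw [indicator_of_mem (by exact hyU), ← ofReal_norm]
          exact ENNReal.ofReal_le_ofReal (hy (hQU ▸ hyU))
      · by_cases hyB : ∃ x ∈ F, y ∈ Metric.closedBall x (r x)
        · obtain ⟨x, hx, hyx⟩ := hyB
          rw [Finset.sum_eq_single_of_mem x hx]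
          · rw [indicator_of_mem hyx]; exact hcle x (hFu hx)
          · intro w hw hwx
            exact indicator_of_notMem
              (Set.disjoint_right.1 (hBF hw hx hwx) hyx) _
        · push Not at hyB
          rw [Finset.sum_eq_zero fun x hx => indicator_of_notMem (hyB x hx) _]
          simp
    have hg2 : ∫⁻ y, ‖g y‖ₑ ≤ 2 * ∫⁻ y, ‖f y‖ₑ := by
      calc ∫⁻ y, ‖g y‖ₑ ≤ ∫⁻ y, (‖f y‖ₑ +
            ∑ x ∈ F, (Metric.closedBall x (r x)).indicator (fun _ => ‖c x‖ₑ) y) := by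
            refine lintegral_mono fun y => ?_
            have e4 : (∑ x ∈ F, (Metric.closedBall x (r x)).indicator (fun _ => c x)) y =
              ∑ x ∈ F, (Metric.closedBall x (r x)).indicator (fun _ => c x) y := by simp
            rw [hg, Pi.add_apply, e4]
            refine (enorm_add_le _ _).trans (add_le_add ?_ ?_)
            · rw [enorm_indicator_eq_indicator_enorm]
              exact indicator_le_self _ _ _
            · refine (enorm_sum_le _ _).trans (le_of_eq (Finset.sum_congr rfl fun x _ => ?_))
              rw [enorm_indicator_eq_indicator_enorm]
        _ = (∫⁻ y, ‖f y‖ₑ) + ∑ x ∈ F, ‖c x‖ₑ * volume (Metric.closedBall x (r x)) := by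
            rw [lintegral_add_left' h₁.1.enorm, lintegral_finsetSum _ fun x _ =>
              measurable_const.indicator (hBm x)]
            simp only [lintegral_indicator (hBm _), setLIntegral_const]
        _ ≤ (∫⁻ y, ‖f y‖ₑ) + ∑ x ∈ F, ∫⁻ y in Q x, ‖f y‖ₑ := by
            gcongr with x hx
            exact hc x (hFu hx)
        _ ≤ _ := by rw [two_mul]; gcongr
    calc ∫⁻ y, ‖g y‖ₑ ^ 2 ≤ ∫⁻ y, ENNReal.ofReal ((1 + 5 ^ n) * t) * ‖g y‖ₑ := by
          refine lintegral_mono_ae ?_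
          filter_upwards [hg1] with y hy
          rw [sq]
          gcongr
      _ ≤ _ := by
          rw [lintegral_const_mul' _ _ ENNReal.ofReal_ne_top]
          gcongr
  · have h1 : y ∉ Q x := fun h => hy (hQsub x (hFu hx) h)
    have h2 : y ∉ Metric.closedBall x (r x) := fun h => hy
      (Metric.closedBall_subset_closedBall (by have := hr x (hFu hx); linarith) h)
    simp [h1, h2]
  · calc _ ≤ ∑ x ∈ F, 2 * ∫⁻ y in Q x, ‖f y‖ₑ := Finset.sum_le_sum fun x hx => hbn x (hFu hx)
      _ ≤ _ := by rw [← Finset.mul_sum]; gcongr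
  · rw [Finset.mul_sum]
    calc _ ≤ ∑ x ∈ F, ∫⁻ y in Metric.closedBall x (r x), ‖f y‖ₑ :=
          Finset.sum_le_sum fun x hx => hlow x (hFu hx)
      _ = ∫⁻ y in ⋃ x ∈ F, Metric.closedBall x (r x), ‖f y‖ₑ :=
          (lintegral_biUnion_finset hBF (fun x _ => hBm x) _).symm
      _ ≤ _ := setLIntegral_le_lintegral _ _
  · refine le_trans (le_of_eq ?_) hFε
    rw [← lintegral_indicator hEm]
    refine lintegral_congr fun y => ?_
    rw [enorm_indicator_eq_indicator_enorm]
    by_cases hy : y ∈ ⋃ x ∈ u \ ↑F, Q x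
    · rw [indicator_of_mem hy, indicator_of_mem hy]
    · rw [indicator_of_notMem hy, indicator_of_notMem hy]; simp

/-! ### The weak-type bound -/

/-- A bounded operator on `L²` associated with a jointly measurable standard kernel, in the
strong sense of `IsAssociated`. -/
structure IsCZOperator {𝕜 : Type*} [RCLike 𝕜] {n : ℕ} (A : Rn n → Rn n → 𝕜) (α B : ℝ)
    (T : LpRn 𝕜 n 2 →L[𝕜] LpRn 𝕜 n 2) : Prop where
  measurable : StronglyMeasurable fun p : Rn n × Rn n => A p.1 p.2
  standard : IsStandardKernel A α B
  bounded : ‖T‖ ≤ B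
  associated : IsAssociated A T

theorem IsCZOperator.nonneg {𝕜 : Type*} [RCLike 𝕜] {n : ℕ} {A : Rn n → Rn n → 𝕜} {α B : ℝ}
    {T : LpRn 𝕜 n 2 →L[𝕜] LpRn 𝕜 n 2} (h : IsCZOperator A α B T) : 0 ≤ B :=
  (norm_nonneg _).trans h.bounded

theorem IsCZOperator.eLpNorm_two_le {𝕜 : Type*} [RCLike 𝕜] {n : ℕ} {A : Rn n → Rn n → 𝕜}
    {α B : ℝ} {T : LpRn 𝕜 n 2 →L[𝕜] LpRn 𝕜 n 2} (h : IsCZOperator A α B T) {f : Rn n → 𝕜}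
    (hf : MemLp f 2 volume) :
    eLpNorm (T (hf.toLp f)) 2 volume ≤ ENNReal.ofReal B * eLpNorm f 2 volume := by
  have h1 : ‖T (hf.toLp f)‖ₑ ≤ ENNReal.ofReal B * ‖hf.toLp f‖ₑ := by
    rw [← ofReal_norm, ← ofReal_norm, ← ENNReal.ofReal_mul h.nonneg]
    exact ENNReal.ofReal_le_ofReal ((T.le_opNorm _).trans (by gcongr; exact h.bounded))
  rwa [Lp.enorm_def, Lp.enorm_toLp] at h1

theorem IsCZOperator.lintegral_sq_le {𝕜 : Type*} [RCLike 𝕜] {n : ℕ} {A : Rn n → Rn n → 𝕜}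
    {α B : ℝ} {T : LpRn 𝕜 n 2 →L[𝕜] LpRn 𝕜 n 2} (h : IsCZOperator A α B T) {f : Rn n → 𝕜}
    (hf : MemLp f 2 volume) :
    ∫⁻ z, ‖T (hf.toLp f) z‖ₑ ^ 2 ≤ ENNReal.ofReal (B ^ 2) * ∫⁻ z, ‖f z‖ₑ ^ 2 := by
  rw [lintegral_enorm_sq_eq_eLpNorm, lintegral_enorm_sq_eq_eLpNorm, ENNReal.ofReal_pow h.nonneg,
    ← mul_pow]
  gcongr
  exact h.eLpNorm_two_le hf

theorem IsCZOperator.mul_volume_lt_le {𝕜 : Type*} [RCLike 𝕜] {n : ℕ} {A : Rn n → Rn n → 𝕜}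
    {α B : ℝ} {T : LpRn 𝕜 n 2 →L[𝕜] LpRn 𝕜 n 2} (h : IsCZOperator A α B T) {f : Rn n → 𝕜}
    (hf : MemLp f 2 volume) {τ : ℝ} (hτ : 0 < τ) :
    ENNReal.ofReal τ * volume {z | τ < ‖T (hf.toLp f) z‖} ≤
      ENNReal.ofReal (B ^ 2 / τ) * ∫⁻ z, ‖f z‖ₑ ^ 2 := by
  have h1 : ENNReal.ofReal (τ ^ 2) * volume {z | τ < ‖T (hf.toLp f) z‖} ≤
      ENNReal.ofReal (B ^ 2) * ∫⁻ z, ‖f z‖ₑ ^ 2 := by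
    refine le_trans ?_ ((mul_meas_ge_le_lintegral₀
      ((Lp.aestronglyMeasurable (T (hf.toLp f))).enorm.pow_const 2)
      (ENNReal.ofReal (τ ^ 2))).trans
      (h.lintegral_sq_le hf))
    refine mul_le_mul_right (measure_mono fun z hz => ?_) _
    have hz' : τ < ‖T (hf.toLp f) z‖ := hz
    simp only [mem_ofPred_eq]
    rw [← ofReal_norm, ← ENNReal.ofReal_pow (norm_nonneg _)]
    exact ENNReal.ofReal_le_ofReal (by gcongr)
  calc _ = ENNReal.ofReal τ⁻¹ * (ENNReal.ofReal (τ ^ 2) *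
        volume {z | τ < ‖T (hf.toLp f) z‖}) := by
        rw [← mul_assoc, ← ENNReal.ofReal_mul (by positivity)]
        congr 2; field_simp
    _ ≤ ENNReal.ofReal τ⁻¹ * (ENNReal.ofReal (B ^ 2) * ∫⁻ z, ‖f z‖ₑ ^ 2) := by gcongr
    _ = _ := by
        rw [← mul_assoc, ← ENNReal.ofReal_mul (by positivity), div_eq_inv_mul]

/-- The Hörmander condition for standard kernels. -/
theorem exists_setLIntegral_kernel_sub_center_le (𝕜 : Type*) [RCLike 𝕜] (n : ℕ) {α : ℝ}
    (hα : 0 < α) :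
    ∃ C : ℝ, 0 < C ∧ ∀ (A : Rn n → Rn n → 𝕜) (B : ℝ), 0 ≤ B → IsStandardKernel A α B →
      ∀ (c w : Rn n) (r : ℝ), 0 < r → ‖w - c‖ ≤ r →
      ∫⁻ z in (Metric.ball c (2 * r))ᶜ, ‖A z w - A z c‖ₑ ≤ ENNReal.ofReal (C * B) := by
  obtain ⟨C, hC, h⟩ := exists_setLIntegral_compl_ball_rpow_le (n := n) hα
  refine ⟨C, hC, fun A B hB hA c w r hr hw => ?_⟩
  calc ∫⁻ z in (Metric.ball c (2 * r))ᶜ, ‖A z w - A z c‖ₑ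
      ≤ ∫⁻ z in (Metric.ball c (2 * r))ᶜ, ENNReal.ofReal (B * r ^ α) *
          ENNReal.ofReal (‖z - c‖ ^ (-α - n)) := by
        refine setLIntegral_mono' measurableSet_ball.compl fun z hz => ?_
        have hz' : 2 * r ≤ ‖z - c‖ := by simpa [dist_eq_norm] using hz
        have hzc : z ≠ c := by rintro rfl; simp at hz'; linarith
        have h1 := hA.regularity_right z c (w - c) hzc (by linarith)
        rw [add_sub_cancel] at h1
        rw [← ofReal_norm, ← ENNReal.ofReal_mul (by positivity)]
        refine ENNReal.ofReal_le_ofReal (h1.trans ?_)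
        rw [show -α - (n : ℝ) = -(n + α) by ring, Real.rpow_neg (norm_nonneg _),
          ← div_eq_mul_inv]
        gcongr
    _ = ENNReal.ofReal (B * r ^ α) * ∫⁻ z in (Metric.ball c (2 * r))ᶜ,
          ENNReal.ofReal (‖z - c‖ ^ (-α - n)) := lintegral_const_mul' _ _ ENNReal.ofReal_ne_top
    _ ≤ ENNReal.ofReal (B * r ^ α) * ENNReal.ofReal (C * (2 * r) ^ (-α)) := by
        gcongr
        exact h c _ (by positivity)
    _ ≤ _ := by
        rw [← ENNReal.ofReal_mul (by positivity)]
        refine ENNReal.ofReal_le_ofReal ?_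
        have h2 : (2 * r) ^ (-α) ≤ r ^ (-α) :=
          Real.rpow_le_rpow_of_nonpos hr (by linarith) (by linarith)
        calc B * r ^ α * (C * (2 * r) ^ (-α)) ≤ B * r ^ α * (C * r ^ (-α)) := by gcongr
          _ = C * B * (r ^ α * r ^ (-α)) := by ring
          _ = C * B := by rw [← Real.rpow_add hr]; simp

theorem ae_operator_add {𝕜 : Type*} [RCLike 𝕜] {n : ℕ} (T : LpRn 𝕜 n 2 →L[𝕜] LpRn 𝕜 n 2)
    {f g k : Rn n → 𝕜} (hf : MemLp f 2 volume) (hg : MemLp g 2 volume) (hk : MemLp k 2 volume)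
    (h : k =ᵐ[volume] f + g) :
    ∀ᵐ z, T (hk.toLp k) z = T (hf.toLp f) z + T (hg.toLp g) z := by
  have : hk.toLp k = hf.toLp f + hg.toLp g := by
    rw [← MemLp.toLp_add, MemLp.toLp_eq_toLp_iff]; exact h
  rw [this, map_add]
  exact Lp.coeFn_add _ _

theorem ae_operator_eq_zero {𝕜 : Type*} [RCLike 𝕜] {n : ℕ} (T : LpRn 𝕜 n 2 →L[𝕜] LpRn 𝕜 n 2)
    {k : Rn n → 𝕜} (hk : MemLp k 2 volume) (h : k =ᵐ[volume] 0) :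
    ∀ᵐ z, T (hk.toLp k) z = 0 := by
  have : hk.toLp k = 0 := (Lp.eq_zero_iff_ae_eq_zero).2 (hk.coeFn_toLp.trans h)
  rw [this, map_zero]
  exact Lp.coeFn_zero _ _ _

/-- Away from its ball, an atom is mapped to an integrable function: the mean of `b` is zero, so the
kernel `A z w` may be replaced by `A z w - A z c`, and the Hörmander condition applies. -/
theorem exists_setLIntegral_operator_atom_le (𝕜 : Type*) [RCLike 𝕜] {n : ℕ} (hn : 1 ≤ n)
    {α : ℝ} (hα : 0 < α) :
    ∃ C : ℝ, 0 < C ∧ ∀ (A : Rn n → Rn n → 𝕜) (B : ℝ) (T : LpRn 𝕜 n 2 →L[𝕜] LpRn 𝕜 n 2),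
      IsCZOperator A α B T → ∀ (b : Rn n → 𝕜) (hb : MemLp b 2 volume), Integrable b →
      ∫ w, b w = 0 → ∀ (c : Rn n) (r : ℝ), 0 < r → (∀ w ∉ Metric.closedBall c r, b w = 0) →
      ∫⁻ z in (Metric.ball c (2 * r))ᶜ, ‖T (hb.toLp b) z‖ₑ ≤
        ENNReal.ofReal (C * B) * ∫⁻ w, ‖b w‖ₑ := by
  obtain ⟨C, hC, h⟩ := exists_setLIntegral_kernel_sub_center_le 𝕜 n hα
  refine ⟨C, hC, fun A B T hT b hb hbi hb0 c r hr hbs => ?_⟩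
  have hm : Measurable fun p : Rn n × Rn n => A p.1 p.2 - A p.1 c :=
    hT.measurable.measurable.sub (hT.measurable.measurable.comp
      (measurable_fst.prodMk measurable_const))
  calc ∫⁻ z in (Metric.ball c (2 * r))ᶜ, ‖T (hb.toLp b) z‖ₑ
      ≤ ∫⁻ z in (Metric.ball c (2 * r))ᶜ, ∫⁻ w, ‖A z w - A z c‖ₑ * ‖b w‖ₑ := by
        refine setLIntegral_mono_ae' measurableSet_ball.compl ?_
        filter_upwards [hT.associated b hb _ Metric.isClosed_closedBall hbs] with z hz hzc
        have hz' : z ∉ Metric.closedBall c r := fun hmem => hzc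
          (Metric.closedBall_subset_ball (by linarith) hmem)
        rw [hz hz']
        have hi := integrable_kernel_mul hn hT.nonneg hT.measurable hT.standard.size hb
          Metric.isClosed_closedBall hbs hz'
        have e : ∫ w, A z w * b w = ∫ w, (A z w - A z c) * b w := by
          simp only [sub_mul]
          rw [integral_sub hi (hbi.const_mul _), integral_const_mul, hb0, mul_zero, sub_zero]
        rw [e]
        refine (enorm_integral_le_lintegral_enorm _).trans (le_of_eq ?_)
        simp only [enorm_mul]
    _ = ∫⁻ w, ∫⁻ z in (Metric.ball c (2 * r))ᶜ, ‖A z w - A z c‖ₑ * ‖b w‖ₑ := by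
        rw [lintegral_lintegral_swap]
        refine (hm.enorm.aemeasurable).mul ?_
        exact (AEStronglyMeasurable.comp_snd hb.1).enorm
    _ ≤ ∫⁻ w, ENNReal.ofReal (C * B) * ‖b w‖ₑ := by
        refine lintegral_mono fun w => ?_
        rw [lintegral_mul_const' _ _ (by finiteness)]
        by_cases hw : w ∈ Metric.closedBall c r
        · gcongr
          exact h A B hT.nonneg hT.standard c w r hr (by simpa [dist_eq_norm] using hw)
        · simp [hbs w hw]
    _ = _ := lintegral_const_mul' _ _ ENNReal.ofReal_ne_top

theorem exists_setLIntegral_operator_sum_atoms_le (𝕜 : Type*) [RCLike 𝕜] {n : ℕ} (hn : 1 ≤ n)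
    {α : ℝ} (hα : 0 < α) :
    ∃ C : ℝ, 0 < C ∧ ∀ (A : Rn n → Rn n → 𝕜) (B : ℝ) (T : LpRn 𝕜 n 2 →L[𝕜] LpRn 𝕜 n 2),
      IsCZOperator A α B T → ∀ (F : Finset (Rn n)) (r : Rn n → ℝ) (b : Rn n → Rn n → 𝕜),
      (∀ x ∈ F, 0 < r x ∧ MemLp (b x) 2 volume ∧ Integrable (b x) ∧ ∫ y, b x y = 0 ∧
        ∀ y ∉ Metric.closedBall x (r x), b x y = 0) →
      ∀ (hS : MemLp (∑ x ∈ F, b x) 2 volume) (S : Set (Rn n)),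
      (∀ x ∈ F, S ⊆ (Metric.ball x (2 * r x))ᶜ) →
      ∫⁻ z in S, ‖T (hS.toLp _) z‖ₑ ≤ ENNReal.ofReal (C * B) * ∑ x ∈ F, ∫⁻ w, ‖b x w‖ₑ := by
  obtain ⟨C, hC, h⟩ := exists_setLIntegral_operator_atom_le 𝕜 hn hα
  refine ⟨C, hC, fun A B T hT F => ?_⟩
  classical
  induction F using Finset.induction_on with
  | empty =>
    intro r b _ hS S _
    refine le_trans (le_of_eq ?_) zero_le
    rw [lintegral_congr_ae (g := fun _ => 0), lintegral_zero]
    filter_upwards [ae_restrict_of_ae (ae_operator_eq_zero T hS (by simp))] with z hz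
    rw [hz, enorm_zero]
  | insert a F ha ih =>
    intro r b hb hS S hSsub
    have hbF := fun x (hx : x ∈ F) => hb x (Finset.mem_insert_of_mem hx)
    obtain ⟨hra, hba2, hba1, hba0, hbas⟩ := hb a (Finset.mem_insert_self _ _)
    have hSF : MemLp (∑ x ∈ F, b x) 2 volume := memLp_finsetSum' _ fun x hx => (hbF x hx).2.1
    have hadd := ae_operator_add T hba2 hSF hS (by rw [Finset.sum_insert ha])
    calc ∫⁻ z in S, ‖T (hS.toLp _) z‖ₑ
        ≤ ∫⁻ z in S, (‖T (hba2.toLp _) z‖ₑ + ‖T (hSF.toLp _) z‖ₑ) := by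
          refine lintegral_mono_ae (ae_restrict_of_ae ?_)
          filter_upwards [hadd] with z hz
          rw [hz]
          exact enorm_add_le _ _
      _ = (∫⁻ z in S, ‖T (hba2.toLp _) z‖ₑ) + ∫⁻ z in S, ‖T (hSF.toLp _) z‖ₑ :=
          lintegral_add_left' (Lp.aestronglyMeasurable _).restrict.enorm _
      _ ≤ (ENNReal.ofReal (C * B) * ∫⁻ w, ‖b a w‖ₑ) +
            ENNReal.ofReal (C * B) * ∑ x ∈ F, ∫⁻ w, ‖b x w‖ₑ := by
          refine add_le_add ?_ (ih r b hbF hSF S fun x hx => hSsub x (Finset.mem_insert_of_mem hx))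
          exact (lintegral_mono_set (hSsub a (Finset.mem_insert_self _ _))).trans
            (h A B T hT _ hba2 hba1 hba0 a (r a) hra hbas)
      _ = _ := by rw [Finset.sum_insert ha, mul_add]

/-- The weak-type `(1,1)` bound on `L¹ ∩ L²`. The decomposition is taken at height `t / B`, which
makes the constant linear in `B`; the case `B = 0`, in which `T = 0`, is separate. -/
theorem exists_mul_volume_operator_le (𝕜 : Type*) [RCLike 𝕜] {n : ℕ} (hn : 1 ≤ n) {α : ℝ}
    (hα : 0 < α) :
    ∃ C : ℝ, 0 < C ∧ ∀ (A : Rn n → Rn n → 𝕜) (B : ℝ) (T : LpRn 𝕜 n 2 →L[𝕜] LpRn 𝕜 n 2),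
      IsCZOperator A α B T → ∀ (f : Rn n → 𝕜), MemLp f 1 volume →
      ∀ (h₂ : MemLp f 2 volume) (t : ℝ), 0 < t →
      ENNReal.ofReal t * volume {z | t < ‖T (h₂.toLp f) z‖} ≤
        ENNReal.ofReal (C * B) * ∫⁻ z, ‖f z‖ₑ := by
  obtain ⟨C, hC, hat⟩ := exists_setLIntegral_operator_sum_atoms_le 𝕜 hn hα
  refine ⟨18 * (1 + 5 ^ n) + 10 ^ n + 6 * C, by positivity, fun A B T hT f h₁ h₂ t ht => ?_⟩
  rcases hT.nonneg.eq_or_lt with hB0 | hB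
  · have hT0 : T = 0 := norm_le_zero_iff.1 (hT.bounded.trans hB0.ge)
    refine le_trans (le_of_eq ?_) zero_le
    have : volume {z | t < ‖T (h₂.toLp f) z‖} = 0 := by
      rw [hT0, ← nonpos_iff_eq_zero]
      refine le_of_le_of_eq (measure_mono_ae ?_) measure_empty
      filter_upwards [Lp.coeFn_zero 𝕜 2 (volume : Measure (Rn n))] with z hz hzt
      have hzt' : t < ‖(0 : LpRn 𝕜 n 2) z‖ := hzt
      rw [hz] at hzt'
      simp at hzt'
      linarith
    rw [this, mul_zero]
  set N := ∫⁻ z, ‖f z‖ₑ with hN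
  refine ENNReal.le_of_forall_pos_le_add fun ε hε _ => ?_
  -- an `L²` error of this size contributes at most `ε`
  set ε' : ℝ≥0∞ := ENNReal.ofReal (t / (9 * B ^ 2) * ε) with hε'
  have hε0 : ε' ≠ 0 := by
    rw [hε', ne_eq, ENNReal.ofReal_eq_zero, not_le]; positivity
  obtain ⟨F, r, b, g, e, hdec, hg2, hgn, hb, hbn, hball, he2, hen⟩ :=
    exists_calderonZygmund_decomposition hn h₁ h₂ (t := t / B) (by positivity) hε0
  have hS : MemLp (∑ x ∈ F, b x) 2 volume := memLp_finsetSum' _ fun x hx => (hb x hx).2.1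
  have hgS : MemLp (g + ∑ x ∈ F, b x) 2 volume := hg2.add hS
  set U : Set (Rn n) := ⋃ x ∈ F, Metric.ball x (2 * (5 * r x)) with hU
  have hsub : ∀ᵐ z, z ∈ {z | t < ‖T (h₂.toLp f) z‖} → z ∈
      {z | t / 3 < ‖T (hg2.toLp g) z‖} ∪ (U ∪ {z | t / 3 < ‖T (hS.toLp _) z‖} ∩ Uᶜ) ∪
        {z | t / 3 < ‖T (he2.toLp e) z‖} := by
    filter_upwards [ae_operator_add T hgS he2 h₂ (by rw [← hdec]),
      ae_operator_add T hg2 hS hgS (by rfl)] with z h1 h2 hz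
    have hz' : t < ‖T (h₂.toLp f) z‖ := hz
    rw [h1, h2] at hz'
    by_contra hcon
    simp only [mem_union, mem_inter_iff, mem_ofPred_eq, not_or, not_and, mem_compl_iff, not_lt]
      at hcon
    obtain ⟨⟨k1, k2, k3⟩, k4⟩ := hcon
    have k3' : ‖T (hS.toLp _) z‖ ≤ t / 3 := by
      by_contra! hlt
      exact k3 hlt k2
    have := norm_add₃_le (a := T (hg2.toLp g) z) (b := T (hS.toLp _) z) (c := T (he2.toLp e) z)
    linarith
  have hUv : ENNReal.ofReal t * volume U ≤ ENNReal.ofReal (10 ^ n * B) * N := by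
    calc ENNReal.ofReal t * volume U
        ≤ ENNReal.ofReal t * ∑ x ∈ F, ENNReal.ofReal (10 ^ n) *
            volume (Metric.closedBall x (r x)) := by
          gcongr
          refine (measure_biUnion_finset_le _ _).trans (Finset.sum_le_sum fun x _ => ?_)
          rw [← volume_closedBall_mul x (by norm_num : (0 : ℝ) < 10)]
          refine measure_mono (Metric.ball_subset_closedBall.trans (le_of_eq ?_))
          congr 1; ring
      _ = ENNReal.ofReal (10 ^ n * B) * (ENNReal.ofReal (t / B) *
            ∑ x ∈ F, volume (Metric.closedBall x (r x))) := by
          rw [← Finset.mul_sum, ← mul_assoc, ← mul_assoc, ← ENNReal.ofReal_mul ht.le,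
            ← ENNReal.ofReal_mul (by positivity)]
          congr 2; field_simp
      _ ≤ _ := by gcongr
  have hG : ENNReal.ofReal t * volume {z | t / 3 < ‖T (hg2.toLp g) z‖} ≤
      ENNReal.ofReal (18 * (1 + 5 ^ n) * B) * N := by
    calc ENNReal.ofReal t * volume {z | t / 3 < ‖T (hg2.toLp g) z‖}
        = ENNReal.ofReal 3 * (ENNReal.ofReal (t / 3) *
            volume {z | t / 3 < ‖T (hg2.toLp g) z‖}) := by
          rw [← mul_assoc, ← ENNReal.ofReal_mul (by norm_num)]
          congr 2; ring
      _ ≤ ENNReal.ofReal 3 * (ENNReal.ofReal (B ^ 2 / (t / 3)) *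
            (ENNReal.ofReal ((1 + 5 ^ n) * (t / B)) * (2 * N))) := by
          gcongr ENNReal.ofReal 3 * ?_
          exact (hT.mul_volume_lt_le hg2 (by positivity)).trans (by gcongr)
      _ = _ := by
          rw [show (2 : ℝ≥0∞) = ENNReal.ofReal 2 by simp]
          simp only [← mul_assoc]
          rw [← ENNReal.ofReal_mul (by positivity), ← ENNReal.ofReal_mul (by positivity),
            ← ENNReal.ofReal_mul (by positivity)]
          congr 2; field_simp; ring
  have hE : ENNReal.ofReal t * volume {z | t / 3 < ‖T (he2.toLp e) z‖} ≤ ε := by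
    calc ENNReal.ofReal t * volume {z | t / 3 < ‖T (he2.toLp e) z‖}
        = ENNReal.ofReal 3 * (ENNReal.ofReal (t / 3) *
            volume {z | t / 3 < ‖T (he2.toLp e) z‖}) := by
          rw [← mul_assoc, ← ENNReal.ofReal_mul (by norm_num)]
          congr 2; ring
      _ ≤ ENNReal.ofReal 3 * (ENNReal.ofReal (B ^ 2 / (t / 3)) * ε') := by
          gcongr ENNReal.ofReal 3 * ?_
          exact (hT.mul_volume_lt_le he2 (by positivity)).trans (by gcongr)
      _ = ε := by
          rw [hε', ← ENNReal.ofReal_mul (by positivity), ← ENNReal.ofReal_mul (by positivity),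
            ← ENNReal.ofReal_coe_nnreal]
          congr 1; field_simp; norm_num
  have hBd : ENNReal.ofReal t * volume ({z | t / 3 < ‖T (hS.toLp _) z‖} ∩ Uᶜ) ≤
      ENNReal.ofReal (6 * C * B) * N := by
    have hUm : MeasurableSet Uᶜ := (Finset.measurableSet_biUnion _ fun x _ =>
      measurableSet_ball).compl
    have h1 : ENNReal.ofReal (t / 3) * volume ({z | t / 3 < ‖T (hS.toLp _) z‖} ∩ Uᶜ) ≤
        ∫⁻ z in Uᶜ, ‖T (hS.toLp _) z‖ₑ := by
      rw [← Measure.restrict_apply' hUm]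
      refine le_trans ?_ (mul_meas_ge_le_lintegral₀
        (Lp.aestronglyMeasurable (T (hS.toLp _))).restrict.enorm
        (ENNReal.ofReal (t / 3)))
      refine mul_le_mul_right (measure_mono fun z hz => ?_) _
      have hz' : t / 3 < ‖T (hS.toLp _) z‖ := hz
      simp only [mem_ofPred_eq]
      rw [← ofReal_norm]
      exact ENNReal.ofReal_le_ofReal hz'.le
    have h2 := hat A B T hT F (fun x => 5 * r x) b (fun x hx => by
      obtain ⟨k1, k2⟩ := hb x hx
      exact ⟨by positivity, k2⟩) hS Uᶜ fun x hx => compl_subset_compl.2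
        (subset_biUnion_of_mem (u := fun x => Metric.ball x (2 * (5 * r x))) hx)
    calc _ = ENNReal.ofReal 3 * (ENNReal.ofReal (t / 3) *
            volume ({z | t / 3 < ‖T (hS.toLp _) z‖} ∩ Uᶜ)) := by
          rw [← mul_assoc, ← ENNReal.ofReal_mul (by norm_num)]
          congr 2; ring
      _ ≤ ENNReal.ofReal 3 * (ENNReal.ofReal (C * B) * (2 * N)) := by
          gcongr ENNReal.ofReal 3 * ?_
          exact h1.trans (h2.trans (by gcongr))
      _ = _ := by
          rw [show (2 : ℝ≥0∞) = ENNReal.ofReal 2 by simp]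
          simp only [← mul_assoc]
          rw [← ENNReal.ofReal_mul (by positivity), ← ENNReal.ofReal_mul (by positivity)]
          congr 2; ring
  calc ENNReal.ofReal t * volume {z | t < ‖T (h₂.toLp f) z‖}
      ≤ ENNReal.ofReal t * (volume {z | t / 3 < ‖T (hg2.toLp g) z‖} +
          (volume U + volume ({z | t / 3 < ‖T (hS.toLp _) z‖} ∩ Uᶜ)) +
          volume {z | t / 3 < ‖T (he2.toLp e) z‖}) := by
        gcongr
        refine (measure_mono_ae hsub).trans ((measure_union_le _ _).trans ?_)
        gcongr
        refine (measure_union_le _ _).trans ?_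
        gcongr
        exact measure_union_le _ _
    _ ≤ ENNReal.ofReal (18 * (1 + 5 ^ n) * B) * N + (ENNReal.ofReal (10 ^ n * B) * N +
          ENNReal.ofReal (6 * C * B) * N) + ε := by
        rw [mul_add, mul_add, mul_add]
        exact add_le_add (add_le_add hG (add_le_add hUv hBd)) hE
    _ = _ := by
        rw [← add_mul, ← ENNReal.ofReal_add (by positivity) (by positivity), ← add_mul,
          ← ENNReal.ofReal_add (by positivity) (by positivity)]
        congr 3; ring

/-! ### Extension to `L¹` -/

theorem weakL1Norm_le_iff {𝕜 : Type*} [RCLike 𝕜] {n : ℕ} {g : Rn n → 𝕜} {c : ℝ≥0∞} :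
    weakL1Norm g ≤ c ↔ ∀ t : ℝ, 0 < t → ENNReal.ofReal t * volume {x | t < ‖g x‖} ≤ c := by
  simp [weakL1Norm]

theorem mul_volume_lt_le_weakL1Norm {𝕜 : Type*} [RCLike 𝕜] {n : ℕ} (g : Rn n → 𝕜) {t : ℝ}
    (ht : 0 < t) : ENNReal.ofReal t * volume {x | t < ‖g x‖} ≤ weakL1Norm g :=
  weakL1Norm_le_iff.1 le_rfl t ht

theorem weakL1Norm_mono_ae {𝕜 : Type*} [RCLike 𝕜] {n : ℕ} {f g : Rn n → 𝕜}
    (h : ∀ᵐ x, ‖f x‖ ≤ ‖g x‖) : weakL1Norm f ≤ weakL1Norm g := by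
  refine weakL1Norm_le_iff.2 fun t ht => le_trans ?_ (mul_volume_lt_le_weakL1Norm g ht)
  refine mul_le_mul_right (measure_mono_ae ?_) _
  filter_upwards [h] with x hx hxt
  exact lt_of_lt_of_le hxt hx

/-- The weak `L¹` norm satisfies the triangle inequality only up to the factor `2`. -/
theorem weakL1Norm_le_of_norm_le_add {𝕜 : Type*} [RCLike 𝕜] {n : ℕ} {k f g : Rn n → 𝕜}
    (h : ∀ᵐ x, ‖k x‖ ≤ ‖f x‖ + ‖g x‖) :
    weakL1Norm k ≤ 2 * (weakL1Norm f + weakL1Norm g) := by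
  refine weakL1Norm_le_iff.2 fun t ht => ?_
  have ht2 : 0 < t / 2 := by positivity
  calc ENNReal.ofReal t * volume {x | t < ‖k x‖}
      ≤ ENNReal.ofReal t * (volume {x | t / 2 < ‖f x‖} + volume {x | t / 2 < ‖g x‖}) := by
        refine mul_le_mul_right ((measure_mono_ae ?_).trans (measure_union_le _ _)) _
        filter_upwards [h] with x hx hxt
        have hxt' : t < ‖k x‖ := hxt
        by_contra hcon
        rcases not_or.1 hcon with ⟨h1, h2⟩
        have h1' : ‖f x‖ ≤ t / 2 := not_lt.1 h1
        have h2' : ‖g x‖ ≤ t / 2 := not_lt.1 h2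
        linarith
    _ = 2 * (ENNReal.ofReal (t / 2) * volume {x | t / 2 < ‖f x‖} +
          ENNReal.ofReal (t / 2) * volume {x | t / 2 < ‖g x‖}) := by
        rw [← mul_add, ← mul_assoc]
        congr 1
        rw [show (2 : ℝ≥0∞) = ENNReal.ofReal 2 by simp, ← ENNReal.ofReal_mul (by norm_num)]
        congr 1; ring
    _ ≤ _ := by
        gcongr
        · exact mul_volume_lt_le_weakL1Norm f ht2
        · exact mul_volume_lt_le_weakL1Norm g ht2

theorem weakL1Norm_const_mul_le {𝕜 : Type*} [RCLike 𝕜] {n : ℕ} (c : 𝕜) (g : Rn n → 𝕜) :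
    weakL1Norm (fun x => c * g x) ≤ ‖c‖ₑ * weakL1Norm g := by
  rcases eq_or_ne c 0 with rfl | hc
  · refine weakL1Norm_le_iff.2 fun t ht => ?_
    have : {x : Rn n | t < ‖(0 : 𝕜) * g x‖} = ∅ := by
      ext x; simp [ht.le]
    rw [this, measure_empty, mul_zero]
    exact zero_le
  have hc' : 0 < ‖c‖ := norm_pos_iff.2 hc
  refine weakL1Norm_le_iff.2 fun t ht => ?_
  calc ENNReal.ofReal t * volume {x | t < ‖c * g x‖}
      = ‖c‖ₑ * (ENNReal.ofReal (t / ‖c‖) * volume {x | t / ‖c‖ < ‖g x‖}) := by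
        rw [← mul_assoc, ← ofReal_norm, ← ENNReal.ofReal_mul (norm_nonneg _),
          mul_div_cancel₀ _ hc'.ne']
        congr 3
        ext x
        rw [norm_mul, div_lt_iff₀ hc', mul_comm]
    _ ≤ _ := by
        gcongr
        exact mul_volume_lt_le_weakL1Norm g (by positivity)

theorem ae_eq_zero_of_weakL1Norm_eq_zero {𝕜 : Type*} [RCLike 𝕜] {n : ℕ} {g : Rn n → 𝕜}
    (h : weakL1Norm g = 0) : ∀ᵐ x, g x = 0 := by
  have h1 : ∀ k : ℕ, ∀ᵐ x, ‖g x‖ ≤ 1 / ((k : ℝ) + 1) := by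
    intro k
    have hk : (0 : ℝ) < 1 / ((k : ℝ) + 1) := by positivity
    have := (mul_volume_lt_le_weakL1Norm g hk).trans h.le
    rw [nonpos_iff_eq_zero, mul_eq_zero] at this
    rcases this with h0 | h0
    · rw [ENNReal.ofReal_eq_zero] at h0; linarith
    · rw [ae_iff]; simpa only [not_le] using h0
  filter_upwards [ae_all_iff.2 h1] with x hx
  rw [← norm_le_zero_iff]
  exact ge_of_tendsto' tendsto_one_div_add_atTop_nhds_zero_nat hx

/-- Fatou's lemma for the weak quasi-norm. -/
theorem weakL1Norm_le_of_tendsto {𝕜 : Type*} [RCLike 𝕜] {n : ℕ} {g : Rn n → 𝕜}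
    {h : ℕ → Rn n → 𝕜} {c : ℝ≥0∞} (hlim : ∀ᵐ x, Filter.Tendsto (fun j => h j x) Filter.atTop
      (nhds (g x))) (hc : ∀ᶠ j in Filter.atTop, weakL1Norm (h j) ≤ c) : weakL1Norm g ≤ c := by
  refine weakL1Norm_le_iff.2 fun t ht => ?_
  obtain ⟨N, hN⟩ := Filter.eventually_atTop.1 hc
  set S : ℕ → Set (Rn n) := fun m => ⋂ j ≥ m, {x | t < ‖h j x‖} with hS
  have hmono : Monotone S := fun a b hab =>
    biInter_subset_biInter_left fun j (hj : b ≤ j) => hab.trans hj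
  calc ENNReal.ofReal t * volume {x | t < ‖g x‖}
      ≤ ENNReal.ofReal t * volume (⋃ m, S m) := by
        refine mul_le_mul_right (measure_mono_ae ?_) _
        filter_upwards [hlim] with x hx hxt
        obtain ⟨m, hm⟩ := Filter.eventually_atTop.1 (hx.norm.eventually_const_lt hxt)
        exact mem_iUnion.2 ⟨m, mem_iInter₂.2 fun j hj => hm j hj⟩
    _ = ⨆ m, ENNReal.ofReal t * volume (S m) := by
        rw [hmono.measure_iUnion, ENNReal.mul_iSup]
    _ ≤ c := by
        refine iSup_le fun m => ?_
        refine le_trans (mul_le_mul_right (measure_mono ?_) _)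
          ((mul_volume_lt_le_weakL1Norm (h (max m N)) ht).trans (hN _ (le_max_right _ _)))
        exact iInter₂_subset (max m N) (le_max_left _ _)

/-- A sequence that is rapidly Cauchy for the weak quasi-norm converges a.e.: the set where the
`k`-th difference exceeds `2^{-k}` has measure at most `D 2^{-k}`, and the Borel–Cantelli lemma
applies. -/
theorem exists_ae_tendsto_of_weakL1Norm_le {𝕜 : Type*} [RCLike 𝕜] {n : ℕ} {h : ℕ → Rn n → 𝕜}
    (hm : ∀ k, AEStronglyMeasurable (h k) volume) {D : ℝ} (hD : 0 ≤ D)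
    (hc : ∀ k, weakL1Norm (h (k + 1) - h k) ≤ ENNReal.ofReal (D * (1 / 4) ^ k)) :
    ∃ g : Rn n → 𝕜, StronglyMeasurable g ∧
      ∀ᵐ x, Filter.Tendsto (fun j => h j x) Filter.atTop (nhds (g x)) := by
  refine exists_stronglyMeasurable_limit_of_tendsto_ae hm ?_
  have hsum : ∑' k, volume {x | (1 / 2 : ℝ) ^ k < ‖(h (k + 1) - h k) x‖} ≠ ⊤ := by
    have hle : ∀ k, volume {x | (1 / 2 : ℝ) ^ k < ‖(h (k + 1) - h k) x‖} ≤
        ENNReal.ofReal (D * (1 / 2) ^ k) := by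
      intro k
      have hk : (0 : ℝ) < (1 / 2) ^ k := by positivity
      have h1 := (mul_volume_lt_le_weakL1Norm (h (k + 1) - h k) hk).trans (hc k)
      have h2 : ENNReal.ofReal (D * (1 / 4) ^ k) =
          ENNReal.ofReal ((1 / 2) ^ k) * ENNReal.ofReal (D * (1 / 2) ^ k) := by
        rw [← ENNReal.ofReal_mul hk.le, show (1 / 4 : ℝ) = 1 / 2 * (1 / 2) by norm_num, mul_pow]
        congr 1; ring
      rw [h2] at h1
      exact (ENNReal.mul_le_mul_iff_right (by simp) ENNReal.ofReal_ne_top).1 h1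
    refine ((ENNReal.tsum_le_tsum hle).trans_lt ?_).ne
    rw [← ENNReal.ofReal_tsum_of_nonneg (fun k => by positivity)
      (summable_geometric_two.mul_left D)]
    exact ENNReal.ofReal_lt_top
  filter_upwards [ae_eventually_notMem hsum] with x hx
  refine cauchySeq_tendsto_of_complete (cauchySeq_of_summable_dist
    (Summable.of_norm_bounded_eventually_nat summable_geometric_two ?_))
  filter_upwards [hx] with k hk
  have hk' : ‖(h (k + 1) - h k) x‖ ≤ (1 / 2) ^ k := not_lt.1 hk
  rwa [Real.norm_of_nonneg dist_nonneg, dist_comm, dist_eq_norm]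

theorem exists_memLp_eLpNorm_sub_le {𝕜 : Type*} [RCLike 𝕜] {n : ℕ} {p : ℝ≥0∞} (hp : p ≠ ⊤)
    {f : Rn n → 𝕜} (hf : MemLp f p volume) {ε : ℝ≥0∞} (hε : ε ≠ 0) :
    ∃ u : Rn n → 𝕜, MemLp u p volume ∧ MemLp u 2 volume ∧ eLpNorm (f - u) p volume ≤ ε := by
  obtain ⟨u, hc, hu, hcont, hup⟩ := hf.exists_hasCompactSupport_eLpNorm_sub_le hp hε
  exact ⟨u, hup, hcont.memLp_of_hasCompactSupport hc, hu⟩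

theorem ae_operator_sub {𝕜 : Type*} [RCLike 𝕜] {n : ℕ} (T : LpRn 𝕜 n 2 →L[𝕜] LpRn 𝕜 n 2)
    {f g : Rn n → 𝕜} (hf : MemLp f 2 volume) (hg : MemLp g 2 volume) :
    ∀ᵐ z, T ((hf.sub hg).toLp _) z = T (hf.toLp f) z - T (hg.toLp g) z := by
  rw [MemLp.toLp_sub, map_sub]
  exact Lp.coeFn_sub _ _

theorem ae_operator_smul {𝕜 : Type*} [RCLike 𝕜] {n : ℕ} (T : LpRn 𝕜 n 2 →L[𝕜] LpRn 𝕜 n 2)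
    (c : 𝕜) {f : Rn n → 𝕜} (hf : MemLp f 2 volume) :
    ∀ᵐ z, T ((hf.const_smul c).toLp _) z = c * T (hf.toLp f) z := by
  rw [MemLp.toLp_const_smul, map_smul]
  exact Lp.coeFn_smul _ _

/-- The image `g` of `f ∈ L¹`, as a limit of images of functions in `L¹ ∩ L²`. The final bound
determines `g` a.e., and the linearity of `f ↦ g` is read off from it. -/
theorem exists_weakL1Norm_sub_operator_le {𝕜 : Type*} [RCLike 𝕜] {n : ℕ}
    {T : LpRn 𝕜 n 2 →L[𝕜] LpRn 𝕜 n 2} {D : ℝ} (hD : 0 ≤ D)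
    (hT : ∀ (u : Rn n → 𝕜), MemLp u 1 volume → ∀ (h₂ : MemLp u 2 volume),
      weakL1Norm (T (h₂.toLp u)) ≤ ENNReal.ofReal D * eLpNorm u 1 volume)
    {f : Rn n → 𝕜} (hf : MemLp f 1 volume) :
    ∃ g : Rn n → 𝕜, StronglyMeasurable g ∧ ∀ (u : Rn n → 𝕜), MemLp u 1 volume →
      ∀ (h₂ : MemLp u 2 volume),
      weakL1Norm (g - ⇑(T (h₂.toLp u))) ≤ ENNReal.ofReal D * eLpNorm (f - u) 1 volume := by
  have hTsub : ∀ (u v : Rn n → 𝕜), MemLp u 1 volume → MemLp v 1 volume →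
      ∀ (hu : MemLp u 2 volume) (hv : MemLp v 2 volume),
      weakL1Norm (⇑(T (hu.toLp u)) - ⇑(T (hv.toLp v))) ≤
        ENNReal.ofReal D * eLpNorm (u - v) 1 volume := by
    intro u v hu1 hv1 hu hv
    refine (weakL1Norm_mono_ae ?_).trans (hT _ (hu1.sub hv1) (hu.sub hv))
    filter_upwards [ae_operator_sub T hu hv] with z hz
    rw [hz, Pi.sub_apply]
  have happ : ∀ k : ℕ, ∃ u : Rn n → 𝕜, MemLp u 1 volume ∧ MemLp u 2 volume ∧
      eLpNorm (f - u) 1 volume ≤ ENNReal.ofReal ((1 / 4) ^ k) := fun k =>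
    exists_memLp_eLpNorm_sub_le (by simp) hf (by
      rw [ne_eq, ENNReal.ofReal_eq_zero, not_le]; positivity)
  choose u hu1 hu2 hu using happ
  obtain ⟨g, hg, hlim⟩ := exists_ae_tendsto_of_weakL1Norm_le (D := D * 2)
    (h := fun k => T ((hu2 k).toLp (u k))) (fun k => Lp.aestronglyMeasurable _) (by positivity)
    fun k => by
      refine (hTsub _ _ (hu1 _) (hu1 _) (hu2 _) (hu2 _)).trans ?_
      have e : u (k + 1) - u k = (f - u k) - (f - u (k + 1)) := by abel
      rw [e, mul_assoc, ENNReal.ofReal_mul hD, two_mul, ENNReal.ofReal_add (by positivity)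
        (by positivity)]
      gcongr
      refine (eLpNorm_sub_le (hf.1.sub (hu1 k).1) (hf.1.sub (hu1 (k + 1)).1) le_rfl).trans
        (add_le_add (hu k) ((hu (k + 1)).trans (ENNReal.ofReal_le_ofReal ?_)))
      exact pow_le_pow_of_le_one (by norm_num) (by norm_num) (Nat.le_succ k)
  refine ⟨g, hg, fun v hv1 hv2 => ?_⟩
  refine ENNReal.le_of_forall_pos_le_add fun ε hε _ => ?_
  refine weakL1Norm_le_of_tendsto (h := fun j => ⇑(T ((hu2 j).toLp (u j))) - ⇑(T (hv2.toLp v)))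
    ?_ ?_
  · filter_upwards [hlim] with x hx
    exact hx.sub_const _
  · have hev : ∀ᶠ j : ℕ in Filter.atTop, D * (1 / 4) ^ j < ε := by
      have : Filter.Tendsto (fun j : ℕ => D * (1 / 4 : ℝ) ^ j) Filter.atTop (nhds (D * 0)) :=
        (tendsto_pow_atTop_nhds_zero_of_lt_one (by norm_num) (by norm_num)).const_mul D
      rw [mul_zero] at this
      exact this.eventually_lt_const (by exact_mod_cast hε)
    filter_upwards [hev] with j hj
    refine (hTsub _ _ (hu1 j) hv1 (hu2 j) hv2).trans ?_
    have e : u j - v = (f - v) - (f - u j) := by abel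
    rw [e]
    calc ENNReal.ofReal D * eLpNorm ((f - v) - (f - u j)) 1 volume
        ≤ ENNReal.ofReal D * (eLpNorm (f - v) 1 volume + ENNReal.ofReal ((1 / 4) ^ j)) := by
          gcongr
          exact (eLpNorm_sub_le (hf.1.sub hv1.1) (hf.1.sub (hu1 j).1) le_rfl).trans
            (add_le_add le_rfl (hu j))
      _ ≤ _ := by
          rw [mul_add, ← ENNReal.ofReal_mul hD]
          gcongr
          rw [← ENNReal.ofReal_coe_nnreal]
          exact ENNReal.ofReal_le_ofReal hj.le

/-- The extension to `L¹` of an operator with a weak bound on `L¹ ∩ L²`. Weak `L¹` is not normed, so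
the extension theorems for normed spaces do not apply, and linearity is verified by approximation.
-/
theorem boundedWeakL1_of_forall_weakL1Norm_le {𝕜 : Type*} [RCLike 𝕜] {n : ℕ}
    {T : LpRn 𝕜 n 2 →L[𝕜] LpRn 𝕜 n 2} {D : ℝ} (hD : 0 ≤ D)
    (hT : ∀ (u : Rn n → 𝕜), MemLp u 1 volume → ∀ (h₂ : MemLp u 2 volume),
      weakL1Norm (T (h₂.toLp u)) ≤ ENNReal.ofReal D * eLpNorm u 1 volume) :
    BoundedWeakL1 T D := by
  choose! G hGm hG using fun f : LpRn 𝕜 n 1 =>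
    exists_weakL1Norm_sub_operator_le hD hT (Lp.memLp f)
  -- two functions vanish simultaneously if their difference is controlled by any `ε`
  have hzero : ∀ k : Rn n → 𝕜, (∃ M : ℝ, 0 ≤ M ∧ ∀ ε : ℝ, 0 < ε →
      weakL1Norm k ≤ ENNReal.ofReal (M * ε)) → ∀ᵐ x, k x = 0 := by
    rintro k ⟨M, hM, hk⟩
    refine ae_eq_zero_of_weakL1Norm_eq_zero (nonpos_iff_eq_zero.1 ?_)
    refine ENNReal.le_of_forall_pos_le_add fun ε hε _ => ?_
    have hε' : (0 : ℝ) < ε := by exact_mod_cast hε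
    rw [zero_add]
    refine (hk (ε / (M + 1)) (by positivity)).trans ?_
    rw [← ENNReal.ofReal_coe_nnreal]
    refine ENNReal.ofReal_le_ofReal ?_
    rw [mul_div_assoc', div_le_iff₀ (by positivity)]
    nlinarith
  have happ : ∀ (f : LpRn 𝕜 n 1) (ε : ℝ), 0 < ε → ∃ u : Rn n → 𝕜, MemLp u 1 volume ∧
      MemLp u 2 volume ∧ eLpNorm (⇑f - u) 1 volume ≤ ENNReal.ofReal ε := fun f ε hε =>
    exists_memLp_eLpNorm_sub_le (by simp) (Lp.memLp f) (by
      rw [ne_eq, ENNReal.ofReal_eq_zero, not_le]; exact hε)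
  have hGle : ∀ (f : LpRn 𝕜 n 1) (u : Rn n → 𝕜) (h1 : MemLp u 1 volume)
      (h2 : MemLp u 2 volume) (ε : ℝ), eLpNorm (⇑f - u) 1 volume ≤ ENNReal.ofReal ε →
      weakL1Norm (G f - ⇑(T (h2.toLp u))) ≤ ENNReal.ofReal (D * ε) := by
    intro f u h1 h2 ε h
    refine (hG f u h1 h2).trans ?_
    rw [ENNReal.ofReal_mul hD]
    gcongr
  have htwo : ∀ a b : ℝ, 0 ≤ a → 0 ≤ b →
      2 * (ENNReal.ofReal a + ENNReal.ofReal b) = ENNReal.ofReal (2 * (a + b)) := by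
    intro a b ha hb
    rw [← ENNReal.ofReal_add ha hb, ENNReal.ofReal_mul (by norm_num)]
    simp
  refine ⟨{ toFun := fun f => AEEqFun.mk (G f) (hGm f).aestronglyMeasurable
            map_add' := ?_
            map_smul' := ?_ }, ?_, ?_⟩
  · intro f f'
    rw [AEEqFun.mk_add_mk, AEEqFun.mk_eq_mk]
    suffices h : ∀ᵐ x, (G (f + f') - (G f + G f')) x = 0 by
      filter_upwards [h] with x hx
      exact sub_eq_zero.1 hx
    refine hzero _ ⟨12 * D, by positivity, fun ε hε => ?_⟩
    obtain ⟨u, hu1, hu2, hu⟩ := happ f ε hε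
    obtain ⟨u', hu1', hu2', hu'⟩ := happ f' ε hε
    have hsum : eLpNorm (⇑(f + f') - (u + u')) 1 volume ≤ ENNReal.ofReal (2 * ε) := by
      rw [two_mul, ENNReal.ofReal_add hε.le hε.le]
      refine le_trans (le_of_eq ?_) ((eLpNorm_add_le ((Lp.memLp f).1.sub hu1.1)
        ((Lp.memLp f').1.sub hu1'.1) le_rfl).trans (add_le_add hu hu'))
      refine eLpNorm_congr_ae ?_
      filter_upwards [Lp.coeFn_add f f'] with x hx
      simp only [Pi.sub_apply, Pi.add_apply, hx]
      ring
    have k1 := hGle (f + f') (u + u') (hu1.add hu1') (hu2.add hu2') _ hsum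
    have k2 := hGle f u hu1 hu2 ε hu
    have k3 := hGle f' u' hu1' hu2' ε hu'
    have hst : weakL1Norm ((G f - ⇑(T (hu2.toLp u))) + (G f' - ⇑(T (hu2'.toLp u')))) ≤
        ENNReal.ofReal (4 * (D * ε)) := by
      refine (weakL1Norm_le_of_norm_le_add (Filter.Eventually.of_forall fun x =>
        norm_add_le _ _)).trans ((mul_le_mul_right (add_le_add k2 k3) 2).trans ?_)
      rw [htwo _ _ (by positivity) (by positivity)]
      exact ENNReal.ofReal_le_ofReal (by linarith)
    refine (weakL1Norm_le_of_norm_le_add (f := G (f + f') - ⇑(T ((hu2.add hu2').toLp _)))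
      (g := (G f - ⇑(T (hu2.toLp u))) + (G f' - ⇑(T (hu2'.toLp u')))) ?_).trans
      ((mul_le_mul_right (add_le_add k1 hst) 2).trans ?_)
    · filter_upwards [ae_operator_add T hu2 hu2' (hu2.add hu2') (by rfl)] with x hx
      refine le_trans (le_of_eq ?_) (norm_sub_le _ _)
      simp only [Pi.sub_apply, Pi.add_apply, hx]
      congr 1; ring
    · rw [htwo _ _ (by positivity) (by positivity)]
      exact ENNReal.ofReal_le_ofReal (by linarith)
  · intro c f
    rw [RingHom.id_apply, AEEqFun.smul_mk, AEEqFun.mk_eq_mk]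
    suffices h : ∀ᵐ x, (G (c • f) - c • G f) x = 0 by
      filter_upwards [h] with x hx
      exact sub_eq_zero.1 hx
    refine hzero _ ⟨4 * (‖c‖ * D), by positivity, fun ε hε => ?_⟩
    obtain ⟨u, hu1, hu2, hu⟩ := happ f ε hε
    have hsm : eLpNorm (⇑(c • f) - c • u) 1 volume ≤ ENNReal.ofReal (‖c‖ * ε) := by
      rw [ENNReal.ofReal_mul (norm_nonneg _), ofReal_norm]
      refine le_trans (le_of_eq ?_) ((eLpNorm_const_smul_le (c := c) (f := ⇑f - u)).trans
        (mul_le_mul_right hu _))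
      refine eLpNorm_congr_ae ?_
      filter_upwards [Lp.coeFn_smul c f] with x hx
      simp only [Pi.sub_apply, Pi.smul_apply, hx, smul_sub]
    have k1 := hGle (c • f) (c • u) (hu1.const_smul c) (hu2.const_smul c) _ hsm
    have k2 : weakL1Norm (fun x => c * (G f - ⇑(T (hu2.toLp u))) x) ≤
        ENNReal.ofReal (‖c‖ * (D * ε)) := by
      refine (weakL1Norm_const_mul_le c _).trans ?_
      rw [ENNReal.ofReal_mul (norm_nonneg _), ofReal_norm]
      exact mul_le_mul_right (hGle f u hu1 hu2 ε hu) _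
    refine (weakL1Norm_le_of_norm_le_add (f := G (c • f) - ⇑(T ((hu2.const_smul c).toLp _)))
      (g := fun x => c * (G f - ⇑(T (hu2.toLp u))) x) ?_).trans
      ((mul_le_mul_right (add_le_add k1 k2) 2).trans ?_)
    · filter_upwards [ae_operator_smul T c hu2] with x hx
      refine le_trans (le_of_eq ?_) (norm_sub_le _ _)
      simp only [Pi.sub_apply, Pi.smul_apply, hx, smul_eq_mul]
      congr 1; ring
    · rw [htwo _ _ (by positivity) (by positivity)]
      exact ENNReal.ofReal_le_ofReal (by linarith)
  · intro f h1 h2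
    refine (AEEqFun.coeFn_mk _ _).trans ?_
    have h := hG (h1.toLp f) f h1 h2
    have h0 : eLpNorm (⇑(h1.toLp f) - f) 1 volume = 0 := by
      rw [eLpNorm_congr_ae (g := 0)]
      · simp
      · filter_upwards [h1.coeFn_toLp] with x hx
        simp [hx]
    rw [h0, mul_zero, nonpos_iff_eq_zero] at h
    filter_upwards [ae_eq_zero_of_weakL1Norm_eq_zero h] with x hx
    exact sub_eq_zero.1 hx
  · intro f
    have h := hG f 0 MemLp.zero MemLp.zero
    rw [sub_zero] at h
    have hnorm : eLpNorm f 1 volume = ENNReal.ofReal ‖f‖ := by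
      rw [Lp.norm_def, ENNReal.ofReal_toReal (Lp.memLp f).2.ne]
    rw [ENNReal.ofReal_mul hD, ← hnorm]
    refine (weakL1Norm_mono_ae ?_).trans h
    filter_upwards [AEEqFun.coeFn_mk (G f) (hGm f).aestronglyMeasurable,
      ae_operator_eq_zero T MemLp.zero (by rfl)] with x h1 h2
    refine le_of_eq ?_
    rw [Pi.sub_apply, h2, sub_zero]
    exact congrArg _ h1

/-! ### `L^p` bounds -/

theorem setLIntegral_Ioo_rpow_le {a b : ℝ} (ha : -1 < a) (hb : 0 ≤ b) :
    ∫⁻ t in Ioo 0 b, ENNReal.ofReal (t ^ a) ≤ ENNReal.ofReal (b ^ (a + 1) / (a + 1)) := by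
  refine (lintegral_mono_set Ioo_subset_Ioc_self).trans (le_of_eq ?_)
  rw [← ofReal_integral_eq_lintegral_ofReal]
  · rw [← intervalIntegral.integral_of_le hb, integral_rpow (Or.inl ha),
      Real.zero_rpow (by linarith), sub_zero]
  · exact (intervalIntegrable_iff_integrableOn_Ioc_of_le hb).1
      (intervalIntegral.intervalIntegrable_rpow' ha)
  · filter_upwards [ae_restrict_mem measurableSet_Ioc] with t ht
    exact Real.rpow_nonneg ht.1.le _

theorem setLIntegral_Ioi_rpow_le {a b : ℝ} (ha : a < -1) (hb : 0 < b) :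
    ∫⁻ t in Ioi b, ENNReal.ofReal (t ^ a) ≤ ENNReal.ofReal (b ^ (a + 1) / (-a - 1)) := by
  refine le_of_eq ?_
  rw [← ofReal_integral_eq_lintegral_ofReal (integrableOn_Ioi_rpow_of_lt ha hb),
    integral_Ioi_rpow_of_lt ha hb]
  · congr 1
    rw [show -a - 1 = -(a + 1) by ring, div_neg, neg_div]
  · filter_upwards [ae_restrict_mem measurableSet_Ioi] with t ht
    exact Real.rpow_nonneg (hb.trans ht).le _

/-- A function in `L²`, cut where it exceeds `a > 0`, is integrable. -/
theorem memLp_one_indicator_lt {𝕜 : Type*} [RCLike 𝕜] {n : ℕ} {f : Rn n → 𝕜}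
    (hf : MemLp f 2 volume) (hfm : StronglyMeasurable f) {a : ℝ} (ha : 0 < a) :
    MemLp ({x | a < ‖f x‖}.indicator f) 1 volume := by
  have hm : MeasurableSet {x | a < ‖f x‖} := measurableSet_lt measurable_const hfm.norm.measurable
  have hg : Integrable (fun x => a⁻¹ * ‖f x‖ ^ 2) := (hf.integrable_norm_pow (by simp)).const_mul _
  rw [memLp_one_iff_integrable]
  refine hg.mono (hf.1.indicator hm) (Filter.Eventually.of_forall fun x => ?_)
  by_cases hx : x ∈ {x | a < ‖f x‖}
  · have hx' : a < ‖f x‖ := hx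
    rw [indicator_of_mem hx, Real.norm_of_nonneg (by positivity), inv_mul_eq_div,
      le_div_iff₀ ha]
    nlinarith [norm_nonneg (f x)]
  · rw [indicator_of_notMem hx, norm_zero]
    positivity

/-- The contribution of the part of `f` above the height `t / B` to the interpolated bound; here
`φ = |f|`. -/
theorem lintegral_rpow_mul_setLIntegral_lt_le {α : Type*} [MeasurableSpace α] {μ : Measure α}
    [SFinite μ] {φ : α → ℝ} (hφ : Measurable φ) (h0 : ∀ x, 0 ≤ φ x) {p B : ℝ} (hp : 1 < p)
    (hB : 0 < B) :
    ∫⁻ t in Ioi (0 : ℝ), ENNReal.ofReal (t ^ (p - 2)) *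
        ∫⁻ x in {x | t < B * φ x}, ENNReal.ofReal (φ x) ∂μ ≤
      ENNReal.ofReal (B ^ (p - 1) / (p - 1)) * ∫⁻ x, ENNReal.ofReal (φ x ^ p) ∂μ := by
  have hS : MeasurableSet {q : ℝ × α | q.1 < B * φ q.2} :=
    measurableSet_lt measurable_fst ((hφ.comp measurable_snd).const_mul B)
  have hm : Measurable fun q : ℝ × α => {q : ℝ × α | q.1 < B * φ q.2}.indicator
      (fun q => ENNReal.ofReal (q.1 ^ (p - 2)) * ENNReal.ofReal (φ q.2)) q := by
    refine Measurable.indicator ?_ hS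
    exact (by fun_prop : Measurable fun q : ℝ × α => ENNReal.ofReal (q.1 ^ (p - 2))).mul
      (hφ.comp measurable_snd).ennreal_ofReal
  calc _ = ∫⁻ t in Ioi (0 : ℝ), ∫⁻ x, {q : ℝ × α | q.1 < B * φ q.2}.indicator
          (fun q => ENNReal.ofReal (q.1 ^ (p - 2)) * ENNReal.ofReal (φ q.2)) (t, x) ∂μ := by
        refine lintegral_congr fun t => ?_
        rw [← lintegral_const_mul' _ _ ENNReal.ofReal_ne_top, ← lintegral_indicator
          (measurableSet_lt measurable_const (hφ.const_mul B))]
        rfl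
    _ = ∫⁻ x, (∫⁻ t in Ioi (0 : ℝ), {q : ℝ × α | q.1 < B * φ q.2}.indicator
          (fun q => ENNReal.ofReal (q.1 ^ (p - 2)) * ENNReal.ofReal (φ q.2)) (t, x)) ∂μ :=
        lintegral_lintegral_swap hm.aemeasurable
    _ ≤ ∫⁻ x, ENNReal.ofReal (B ^ (p - 1) / (p - 1)) * ENNReal.ofReal (φ x ^ p) ∂μ := by
        refine lintegral_mono fun x => ?_
        calc _ = ∫⁻ t in Ioi (0 : ℝ), (Iio (B * φ x)).indicator
              (fun t => ENNReal.ofReal (t ^ (p - 2)) * ENNReal.ofReal (φ x)) t := rfl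
          _ = (∫⁻ t in Ioo 0 (B * φ x), ENNReal.ofReal (t ^ (p - 2))) *
                ENNReal.ofReal (φ x) := by
              rw [setLIntegral_indicator measurableSet_Iio, inter_comm, Ioi_inter_Iio,
                lintegral_mul_const' _ _ ENNReal.ofReal_ne_top]
          _ ≤ ENNReal.ofReal ((B * φ x) ^ (p - 2 + 1) / (p - 2 + 1)) * ENNReal.ofReal (φ x) := by
              gcongr
              exact setLIntegral_Ioo_rpow_le (by linarith) (mul_nonneg hB.le (h0 x))
          _ = _ := by
              have hp1 : 0 < p - 1 := by linarith
              rw [show p - 2 + 1 = p - 1 by ring, ← ENNReal.ofReal_mul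
                (div_nonneg (Real.rpow_nonneg (mul_nonneg hB.le (h0 x)) _) hp1.le),
                ← ENNReal.ofReal_mul (by positivity), Real.mul_rpow hB.le (h0 x)]
              congr 1
              have : φ x ^ p = φ x ^ (p - 1) * φ x := by
                conv_lhs => rw [show p = (p - 1) + 1 by ring]
                rw [Real.rpow_add_one' (h0 x) (by linarith)]
              rw [this]; ring
    _ = _ := lintegral_const_mul' _ _ ENNReal.ofReal_ne_top

/-- The contribution of the part of `f` below the height `t / B` to the interpolated bound; here
`φ = |f|`. -/
theorem lintegral_rpow_mul_setLIntegral_ge_le {α : Type*} [MeasurableSpace α] {μ : Measure α}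
    [SFinite μ] {φ : α → ℝ} (hφ : Measurable φ) (h0 : ∀ x, 0 ≤ φ x) {p B : ℝ} (hp : p < 2)
    (hB : 0 < B) :
    ∫⁻ t in Ioi (0 : ℝ), ENNReal.ofReal (t ^ (p - 3)) *
        ∫⁻ x in {x | B * φ x ≤ t}, ENNReal.ofReal (φ x ^ 2) ∂μ ≤
      ENNReal.ofReal (B ^ (p - 2) / (2 - p)) * ∫⁻ x, ENNReal.ofReal (φ x ^ p) ∂μ := by
  have hS : MeasurableSet {q : ℝ × α | B * φ q.2 ≤ q.1} :=
    measurableSet_le ((hφ.comp measurable_snd).const_mul B) measurable_fst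
  have hm : Measurable fun q : ℝ × α => {q : ℝ × α | B * φ q.2 ≤ q.1}.indicator
      (fun q => ENNReal.ofReal (q.1 ^ (p - 3)) * ENNReal.ofReal (φ q.2 ^ 2)) q := by
    refine Measurable.indicator ?_ hS
    exact (by fun_prop : Measurable fun q : ℝ × α => ENNReal.ofReal (q.1 ^ (p - 3))).mul
      ((hφ.comp measurable_snd).pow_const 2).ennreal_ofReal
  calc _ = ∫⁻ t in Ioi (0 : ℝ), ∫⁻ x, {q : ℝ × α | B * φ q.2 ≤ q.1}.indicator
          (fun q => ENNReal.ofReal (q.1 ^ (p - 3)) * ENNReal.ofReal (φ q.2 ^ 2)) (t, x) ∂μ := by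
        refine lintegral_congr fun t => ?_
        rw [← lintegral_const_mul' _ _ ENNReal.ofReal_ne_top, ← lintegral_indicator
          (measurableSet_le (hφ.const_mul B) measurable_const)]
        rfl
    _ = ∫⁻ x, (∫⁻ t in Ioi (0 : ℝ), {q : ℝ × α | B * φ q.2 ≤ q.1}.indicator
          (fun q => ENNReal.ofReal (q.1 ^ (p - 3)) * ENNReal.ofReal (φ q.2 ^ 2)) (t, x)) ∂μ :=
        lintegral_lintegral_swap hm.aemeasurable
    _ ≤ ∫⁻ x, ENNReal.ofReal (B ^ (p - 2) / (2 - p)) * ENNReal.ofReal (φ x ^ p) ∂μ := by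
        refine lintegral_mono fun x => ?_
        rcases (h0 x).eq_or_lt with hx | hx
        · refine le_trans (le_of_eq ?_) zero_le
          simp [← hx, indicator]
        have hBx : 0 < B * φ x := by positivity
        calc _ = ∫⁻ t in Ioi (0 : ℝ), (Ici (B * φ x)).indicator
              (fun t => ENNReal.ofReal (t ^ (p - 3)) * ENNReal.ofReal (φ x ^ 2)) t := rfl
          _ = (∫⁻ t in Ioi (B * φ x), ENNReal.ofReal (t ^ (p - 3))) *
                ENNReal.ofReal (φ x ^ 2) := by
              have hI : Ici (B * φ x) ∩ Ioi 0 = Ici (B * φ x) :=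
                inter_eq_left.2 (Ici_subset_Ioi.2 hBx)
              rw [setLIntegral_indicator measurableSet_Ici, hI,
                setLIntegral_congr Ioi_ae_eq_Ici.symm,
                lintegral_mul_const' _ _ ENNReal.ofReal_ne_top]
          _ ≤ ENNReal.ofReal ((B * φ x) ^ (p - 3 + 1) / (-(p - 3) - 1)) *
                ENNReal.ofReal (φ x ^ 2) := by
              gcongr
              exact setLIntegral_Ioi_rpow_le (by linarith) hBx
          _ = _ := by
              have hp1 : 0 < 2 - p := by linarith
              rw [show p - 3 + 1 = p - 2 by ring, show -(p - 3) - 1 = 2 - p by ring,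
                ← ENNReal.ofReal_mul (by positivity),
                ← ENNReal.ofReal_mul (by positivity), Real.mul_rpow hB.le (h0 x)]
              congr 1
              have : φ x ^ p = φ x ^ (p - 2) * φ x ^ 2 := by
                rw [← Real.rpow_natCast, ← Real.rpow_add hx]
                congr 1; push_cast; ring
              rw [this]; ring
    _ = _ := lintegral_const_mul' _ _ ENNReal.ofReal_ne_top

/-- Marcinkiewicz interpolation between the weak `(1,1)` bound and the bound on `L²`: `f` is cut
at the height `t / B`, which makes the bound scale correctly in `B`. -/
theorem lintegral_operator_rpow_le_of_weak {𝕜 : Type*} [RCLike 𝕜] {n : ℕ}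
    {T : LpRn 𝕜 n 2 →L[𝕜] LpRn 𝕜 n 2} {B C : ℝ} (hB : 0 < B) (hC : 0 ≤ C)
    (hw : ∀ (u : Rn n → 𝕜), MemLp u 1 volume → ∀ (h₂ : MemLp u 2 volume) (t : ℝ), 0 < t →
      ENNReal.ofReal t * volume {z | t < ‖T (h₂.toLp u) z‖} ≤
        ENNReal.ofReal (C * B) * ∫⁻ z, ‖u z‖ₑ)
    (hs : ∀ (u : Rn n → 𝕜) (h₂ : MemLp u 2 volume) (t : ℝ), 0 < t →
      ENNReal.ofReal t * volume {z | t < ‖T (h₂.toLp u) z‖} ≤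
        ENNReal.ofReal (B ^ 2 / t) * ∫⁻ z, ‖u z‖ₑ ^ 2)
    {p : ℝ} (hp : p ∈ Ioo (1 : ℝ) 2) {f : Rn n → 𝕜} (hfm : StronglyMeasurable f)
    (hf : MemLp f 2 volume) :
    ∫⁻ z, ‖T (hf.toLp f) z‖ₑ ^ p ≤
      ENNReal.ofReal (p * (2 * C / (p - 1) + 4 / (2 - p)) * B ^ p) * ∫⁻ z, ‖f z‖ₑ ^ p := by
  have hp0 : 0 < p := by linarith [hp.1]
  have hp1 : 0 < p - 1 := by linarith [hp.1]
  have hp2 : 0 < 2 - p := by linarith [hp.2]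
  have hφ : Measurable fun x => ‖f x‖ := hfm.norm.measurable
  have henorm : ∀ (u : Rn n → 𝕜) z, ‖u z‖ₑ ^ p = ENNReal.ofReal (‖u z‖ ^ p) := fun u z => by
    rw [← ofReal_norm, ENNReal.ofReal_rpow_of_nonneg (norm_nonneg _) hp0.le]
  have key : ∀ t : ℝ, 0 < t → volume {z | t < ‖T (hf.toLp f) z‖} * ENNReal.ofReal (t ^ (p - 1)) ≤
      ENNReal.ofReal (2 * C * B) * (ENNReal.ofReal (t ^ (p - 2)) *
        ∫⁻ x in {x | t < B * ‖f x‖}, ENNReal.ofReal ‖f x‖) +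
      ENNReal.ofReal (4 * B ^ 2) * (ENNReal.ofReal (t ^ (p - 3)) *
        ∫⁻ x in {x | B * ‖f x‖ ≤ t}, ENNReal.ofReal (‖f x‖ ^ 2)) := by
    intro t ht
    have ht2 : 0 < t / 2 := by positivity
    set S : Set (Rn n) := {x | t < B * ‖f x‖} with hS
    have hSm : MeasurableSet S := measurableSet_lt measurable_const (hφ.const_mul B)
    have hSc : Sᶜ = {x | B * ‖f x‖ ≤ t} := by ext x; simp [hS]
    have hS' : S = {x | t / B < ‖f x‖} := by
      ext x; simp only [hS, mem_ofPred_eq]; rw [div_lt_iff₀ hB, mul_comm]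
    have hf1 : MemLp (S.indicator f) 1 volume := by
      rw [hS']; exact memLp_one_indicator_lt hf hfm (by positivity)
    have hf2 : MemLp (S.indicator f) 2 volume := hf.indicator hSm
    have hf3 : MemLp (Sᶜ.indicator f) 2 volume := hf.indicator hSm.compl
    have k1 := hw _ hf1 hf2 (t / 2) ht2
    have k2 := hs _ hf3 (t / 2) ht2
    have e1 : ∫⁻ z, ‖S.indicator f z‖ₑ = ∫⁻ x in S, ENNReal.ofReal ‖f x‖ := by
      rw [← lintegral_indicator hSm]
      refine lintegral_congr fun z => ?_
      rw [enorm_indicator_eq_indicator_enorm]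
      simp only [ofReal_norm]
    have e2 : ∫⁻ z, ‖Sᶜ.indicator f z‖ₑ ^ 2 =
        ∫⁻ x in {x | B * ‖f x‖ ≤ t}, ENNReal.ofReal (‖f x‖ ^ 2) := by
      rw [← hSc, ← lintegral_indicator hSm.compl]
      refine lintegral_congr fun z => ?_
      by_cases hz : z ∈ Sᶜ
      · rw [indicator_of_mem hz, indicator_of_mem hz, ENNReal.ofReal_pow (norm_nonneg _),
          ofReal_norm]
      · rw [indicator_of_notMem hz, indicator_of_notMem hz]; simp
    rw [e1] at k1
    rw [e2] at k2
    have hsub : volume {z | t < ‖T (hf.toLp f) z‖} ≤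
        volume {z | t / 2 < ‖T (hf2.toLp _) z‖} + volume {z | t / 2 < ‖T (hf3.toLp _) z‖} := by
      refine (measure_mono_ae ?_).trans (measure_union_le _ _)
      filter_upwards [ae_operator_add T hf2 hf3 hf (by rw [indicator_self_add_compl])] with z hz hzt
      have hzt' : t < ‖T (hf.toLp f) z‖ := hzt
      rw [hz] at hzt'
      by_contra hcon
      rcases not_or.1 hcon with ⟨h1, h2⟩
      have h1' : ‖T (hf2.toLp _) z‖ ≤ t / 2 := not_lt.1 h1
      have h2' : ‖T (hf3.toLp _) z‖ ≤ t / 2 := not_lt.1 h2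
      have := norm_add_le (T (hf2.toLp _) z) (T (hf3.toLp _) z)
      linarith
    have hsplit : ENNReal.ofReal (t ^ (p - 1)) =
        ENNReal.ofReal (2 * t ^ (p - 2)) * ENNReal.ofReal (t / 2) := by
      rw [← ENNReal.ofReal_mul (by positivity), show p - 1 = (p - 2) + 1 by ring,
        Real.rpow_add_one ht.ne']
      congr 1; ring
    calc _ ≤ (volume {z | t / 2 < ‖T (hf2.toLp _) z‖} +
            volume {z | t / 2 < ‖T (hf3.toLp _) z‖}) * ENNReal.ofReal (t ^ (p - 1)) := by gcongr
      _ = ENNReal.ofReal (2 * t ^ (p - 2)) *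
            (ENNReal.ofReal (t / 2) * volume {z | t / 2 < ‖T (hf2.toLp _) z‖}) +
          ENNReal.ofReal (2 * t ^ (p - 2)) *
            (ENNReal.ofReal (t / 2) * volume {z | t / 2 < ‖T (hf3.toLp _) z‖}) := by
          rw [hsplit]; ring
      _ ≤ ENNReal.ofReal (2 * t ^ (p - 2)) * (ENNReal.ofReal (C * B) *
            ∫⁻ x in S, ENNReal.ofReal ‖f x‖) +
          ENNReal.ofReal (2 * t ^ (p - 2)) * (ENNReal.ofReal (B ^ 2 / (t / 2)) *
            ∫⁻ x in {x | B * ‖f x‖ ≤ t}, ENNReal.ofReal (‖f x‖ ^ 2)) :=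
          add_le_add (mul_le_mul_right k1 _) (mul_le_mul_right k2 _)
      _ = _ := by
          simp only [← mul_assoc]
          rw [← ENNReal.ofReal_mul (by positivity), ← ENNReal.ofReal_mul (by positivity),
            ← ENNReal.ofReal_mul (by positivity), ← ENNReal.ofReal_mul (by positivity)]
          congr 3
          · ring
          · rw [show p - 2 = (p - 3) + 1 by ring, Real.rpow_add_one ht.ne']
            field_simp; ring
  have hmT : AEMeasurable (fun z => ‖T (hf.toLp f) z‖) volume :=
    (Lp.aestronglyMeasurable _).norm.aemeasurable
  have hm1 : Measurable fun t : ℝ => ENNReal.ofReal (2 * C * B) * (ENNReal.ofReal (t ^ (p - 2)) *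
      ∫⁻ x in {x | t < B * ‖f x‖}, ENNReal.ofReal ‖f x‖) := by
    refine Measurable.const_mul (Measurable.mul (by fun_prop) ?_) _
    refine Antitone.measurable fun a b hab => lintegral_mono_set fun x (hx : b < B * ‖f x‖) => ?_
    exact lt_of_le_of_lt hab hx
  calc ∫⁻ z, ‖T (hf.toLp f) z‖ₑ ^ p
      = ENNReal.ofReal p * ∫⁻ t in Ioi (0 : ℝ), volume {z | t < ‖T (hf.toLp f) z‖} *
          ENNReal.ofReal (t ^ (p - 1)) := by
        rw [← lintegral_rpow_eq_lintegral_meas_lt_mul volume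
          (Filter.Eventually.of_forall fun z => norm_nonneg _) hmT hp0]
        simp only [henorm]
    _ ≤ ENNReal.ofReal p * (ENNReal.ofReal (2 * C * B) * (ENNReal.ofReal (B ^ (p - 1) / (p - 1)) *
          ∫⁻ x, ENNReal.ofReal (‖f x‖ ^ p)) + ENNReal.ofReal (4 * B ^ 2) *
          (ENNReal.ofReal (B ^ (p - 2) / (2 - p)) * ∫⁻ x, ENNReal.ofReal (‖f x‖ ^ p))) := by
        gcongr
        refine (setLIntegral_mono' measurableSet_Ioi fun t ht => key t ht).trans ?_
        rw [lintegral_add_left hm1, lintegral_const_mul' _ _ ENNReal.ofReal_ne_top,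
          lintegral_const_mul' _ _ ENNReal.ofReal_ne_top]
        gcongr
        · exact lintegral_rpow_mul_setLIntegral_lt_le hφ (fun x => norm_nonneg _) hp.1 hB
        · exact lintegral_rpow_mul_setLIntegral_ge_le hφ (fun x => norm_nonneg _) hp.2 hB
    _ = _ := by
        simp only [henorm, ← mul_assoc]
        rw [← add_mul, ← ENNReal.ofReal_mul (by positivity), ← ENNReal.ofReal_mul (by positivity),
          ← ENNReal.ofReal_add (by positivity) (by positivity), ← mul_assoc,
          ← ENNReal.ofReal_mul (by positivity)]
        congr 2
        have h1 : B ^ p = B ^ (p - 1) * B := by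
          rw [← Real.rpow_add_one hB.ne']; congr 1; ring
        have h2 : B ^ p = B ^ (p - 2) * B ^ 2 := by
          rw [← Real.rpow_natCast, ← Real.rpow_add hB]; congr 1; push_cast; ring
        have h3 : p * (2 * C / (p - 1) + 4 / (2 - p)) * B ^ p =
            p * (2 * C / (p - 1)) * B ^ p + p * (4 / (2 - p)) * B ^ p := by ring
        rw [h3]
        nth_rw 1 [h1]
        rw [h2]
        ring

theorem IsCZOperator.operator_eq_zero {𝕜 : Type*} [RCLike 𝕜] {n : ℕ} {A : Rn n → Rn n → 𝕜}
    {α : ℝ} {T : LpRn 𝕜 n 2 →L[𝕜] LpRn 𝕜 n 2} (h : IsCZOperator A α 0 T) : T = 0 :=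
  norm_le_zero_iff.1 h.bounded

theorem exists_eLpNorm'_operator_le_of_lt_two (𝕜 : Type*) [RCLike 𝕜] {n : ℕ} (hn : 1 ≤ n)
    {α : ℝ} (hα : 0 < α) {p : ℝ} (hp : p ∈ Ioo (1 : ℝ) 2) :
    ∃ C : ℝ, 0 < C ∧ ∀ (A : Rn n → Rn n → 𝕜) (B : ℝ) (T : LpRn 𝕜 n 2 →L[𝕜] LpRn 𝕜 n 2),
      IsCZOperator A α B T → ∀ (f : Rn n → 𝕜) (hf : MemLp f 2 volume),
      eLpNorm' (T (hf.toLp f)) p volume ≤ ENNReal.ofReal (C * B) * eLpNorm' f p volume := by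
  obtain ⟨C, hC, hw⟩ := exists_mul_volume_operator_le 𝕜 hn hα
  have hp0 : 0 < p := by linarith [hp.1]
  have hp1 : 0 < p - 1 := by linarith [hp.1]
  have hp2 : 0 < 2 - p := by linarith [hp.2]
  set D := p * (2 * C / (p - 1) + 4 / (2 - p)) with hD
  have hD0 : 0 < D := by positivity
  refine ⟨D ^ (1 / p), by positivity, fun A B T hT f hf => ?_⟩
  rcases hT.nonneg.eq_or_lt with rfl | hB
  · rw [hT.operator_eq_zero, _root_.zero_apply, eLpNorm'_congr_ae (Lp.coeFn_zero _ _ _),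
      eLpNorm'_zero hp0]
    exact zero_le
  have hm : StronglyMeasurable (hf.toLp f : Rn n → 𝕜) := Lp.stronglyMeasurable _
  have hf' : MemLp (hf.toLp f : Rn n → 𝕜) 2 volume := Lp.memLp _
  have h := lintegral_operator_rpow_le_of_weak hB hC.le (hw A B T hT)
    (fun u h₂ t ht => hT.mul_volume_lt_le h₂ ht) hp hm hf'
  rw [Lp.toLp_coeFn] at h
  rw [← eLpNorm'_congr_ae hf.coeFn_toLp]
  simp only [eLpNorm']
  have hDB : ENNReal.ofReal (D ^ (1 / p) * B) = ENNReal.ofReal (D * B ^ p) ^ (1 / p) := by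
    rw [ENNReal.ofReal_rpow_of_nonneg (by positivity) (by positivity),
      Real.mul_rpow hD0.le (by positivity), ← Real.rpow_mul hB.le, mul_one_div_cancel hp0.ne',
      Real.rpow_one]
  rw [hDB, ← ENNReal.mul_rpow_of_nonneg _ _ (by positivity)]
  exact ENNReal.rpow_le_rpow h (by positivity)

/-- The dual function `φ = |g|^{p-2} ḡ` of `g`, cut off to the set `{|g| ≤ k}`. The truncation puts
`φ` in `L²` and makes the integral of `|g|^p` finite, so that it can be cancelled in the duality
argument. -/
theorem exists_dual_function {𝕜 : Type*} [RCLike 𝕜] {α : Type*} [MeasurableSpace α]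
    {μ : Measure α} {p q : ℝ} (hpq : p.HolderConjugate q) (hp : 2 < p) {g : α → 𝕜}
    (hgm : StronglyMeasurable g) (hg : MemLp g 2 μ) (k : ℕ) :
    ∃ φ : α → 𝕜, MemLp φ 2 μ ∧ Integrable (fun z => g z * φ z) μ ∧
      ‖∫ z, g z * φ z ∂μ‖ₑ = ∫⁻ z in {z | ‖g z‖ ≤ k}, ‖g z‖ₑ ^ p ∂μ ∧
      ∫⁻ z in {z | ‖g z‖ ≤ k}, ‖g z‖ₑ ^ p ∂μ ≠ ⊤ ∧
      ∫⁻ z, ‖φ z‖ₑ ^ q ∂μ = ∫⁻ z in {z | ‖g z‖ ≤ k}, ‖g z‖ₑ ^ p ∂μ := by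
  have hp0 : 0 < p := by linarith
  have hq0 : 0 < q := hpq.symm.pos
  set E : Set α := {z | ‖g z‖ ≤ k} with hE
  have hEm : MeasurableSet E := measurableSet_le hgm.norm.measurable measurable_const
  set φ : α → 𝕜 := E.indicator fun z => ((‖g z‖ ^ (p - 2) : ℝ) : 𝕜) * starRingEnd 𝕜 (g z) with hφ
  have hφm : StronglyMeasurable φ := by
    refine StronglyMeasurable.indicator (StronglyMeasurable.mul ?_ hgm.star) hEm
    exact (RCLike.continuous_ofReal.measurable.comp
      (hgm.norm.measurable.pow_const (p - 2))).stronglyMeasurable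
  have hpow : ∀ z, ‖g z‖ ^ (p - 2) * ‖g z‖ = ‖g z‖ ^ (p - 1) := fun z => by
    rw [← Real.rpow_add_one' (norm_nonneg _) (by linarith)]; congr 1; ring
  have hφn : ∀ z ∈ E, ‖φ z‖ = ‖g z‖ ^ (p - 1) := fun z hz => by
    rw [hφ, indicator_of_mem hz, norm_mul, RCLike.norm_ofReal, abs_of_nonneg (by positivity),
      RCLike.norm_conj, hpow]
  have hφ2 : MemLp φ 2 μ := by
    refine MemLp.of_le_mul (c := (k : ℝ) ^ (p - 2)) hg hφm.aestronglyMeasurable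
      (Filter.Eventually.of_forall fun z => ?_)
    by_cases hz : z ∈ E
    · rw [hφn z hz, ← hpow]
      have hz' : ‖g z‖ ≤ k := hz
      gcongr
    · rw [hφ, indicator_of_notMem hz, norm_zero]; positivity
  have hi : Integrable (fun z => g z * φ z) μ := hg.integrable_mul hφ2
  have hgφ : ∀ z, g z * φ z = ((‖g z * φ z‖ : ℝ) : 𝕜) := by
    intro z
    by_cases hz : z ∈ E
    · rw [norm_mul, hφn z hz, hφ, indicator_of_mem hz, mul_left_comm, RCLike.mul_conj,
        ← hpow]
      push_cast; ring
    · rw [hφ, indicator_of_notMem hz]; simp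
  have hle : ∫⁻ z, ‖g z * φ z‖ₑ ∂μ = ∫⁻ z in E, ‖g z‖ₑ ^ p ∂μ := by
    rw [← lintegral_indicator hEm]
    refine lintegral_congr fun z => ?_
    by_cases hz : z ∈ E
    · rw [indicator_of_mem hz, ← ofReal_norm, norm_mul, hφn z hz, ← ofReal_norm,
        ENNReal.ofReal_rpow_of_nonneg (norm_nonneg _) hp0.le]
      congr 1
      conv_rhs => rw [show p = 1 + (p - 1) by ring]
      rw [Real.rpow_add' (norm_nonneg _) (by linarith), Real.rpow_one]
    · rw [indicator_of_notMem hz, hφ, indicator_of_notMem hz]; simp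
  refine ⟨φ, hφ2, hi, ?_, ?_, ?_⟩
  · rw [← hle, integral_congr_ae (Filter.Eventually.of_forall hgφ), integral_ofReal,
      ← ofReal_norm, RCLike.norm_ofReal, abs_of_nonneg (integral_nonneg fun z => norm_nonneg _),
      ofReal_integral_norm_eq_lintegral_enorm hi]
  · rw [← hle]; exact hi.2.ne
  · rw [← lintegral_indicator hEm]
    refine lintegral_congr fun z => ?_
    by_cases hz : z ∈ E
    · rw [indicator_of_mem hz, ← ofReal_norm, hφn z hz, ← ofReal_norm,
        ENNReal.ofReal_rpow_of_nonneg (by positivity) hq0.le,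
        ENNReal.ofReal_rpow_of_nonneg (norm_nonneg _) hp0.le, ← Real.rpow_mul (norm_nonneg _),
        hpq.sub_one_mul_conj]
    · rw [indicator_of_notMem hz, hφ, indicator_of_notMem hz]
      simp [hq0]

/-- A bound for the transpose on `L^q` gives the bound on `L^p` for the conjugate exponent. -/
theorem eLpNorm'_operator_le_of_transpose {𝕜 : Type*} [RCLike 𝕜] {n : ℕ}
    {T T' : LpRn 𝕜 n 2 →L[𝕜] LpRn 𝕜 n 2}
    (hTT : ∀ (f φ : Rn n → 𝕜) (hf : MemLp f 2 volume) (hφ : MemLp φ 2 volume),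
      ∫ z, T (hf.toLp f) z * φ z = ∫ z, f z * T' (hφ.toLp φ) z)
    {p q : ℝ} (hpq : p.HolderConjugate q) (hp : 2 < p) {D : ℝ≥0∞}
    (hD : ∀ (φ : Rn n → 𝕜) (hφ : MemLp φ 2 volume),
      eLpNorm' (T' (hφ.toLp φ)) q volume ≤ D * eLpNorm' φ q volume)
    {f : Rn n → 𝕜} (hf : MemLp f 2 volume) :
    eLpNorm' (T (hf.toLp f)) p volume ≤ D * eLpNorm' f p volume := by
  have hp0 : 0 < p := by linarith
  have hq0 : 0 < q := hpq.symm.pos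
  set g : Rn n → 𝕜 := ⇑(T (hf.toLp f)) with hg
  have hgm : StronglyMeasurable g := Lp.stronglyMeasurable _
  have hk : ∀ k : ℕ, ∫⁻ z in {z | ‖g z‖ ≤ k}, ‖g z‖ₑ ^ p ≤ (D * eLpNorm' f p volume) ^ p := by
    intro k
    obtain ⟨φ, hφ2, hi, he, hfin, hφq⟩ := exists_dual_function hpq hp hgm
      (Lp.memLp (T (hf.toLp f))) k
    set J := ∫⁻ z in {z | ‖g z‖ ≤ k}, ‖g z‖ₑ ^ p with hJ
    have h1 : J ≤ D * eLpNorm' f p volume * J ^ (1 / q) := by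
      calc J = ‖∫ z, f z * T' (hφ2.toLp φ) z‖ₑ := by rw [← he, hg, hTT f φ hf hφ2]
        _ ≤ ∫⁻ z, ‖f z * T' (hφ2.toLp φ) z‖ₑ := enorm_integral_le_lintegral_enorm _
        _ = ∫⁻ z, ((fun z => ‖f z‖ₑ) * fun z => ‖T' (hφ2.toLp φ) z‖ₑ) z := by
            simp only [enorm_mul, Pi.mul_apply]
        _ ≤ eLpNorm' f p volume * eLpNorm' (T' (hφ2.toLp φ)) q volume :=
            ENNReal.lintegral_mul_le_Lp_mul_Lq volume hpq hf.1.enorm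
              (Lp.aestronglyMeasurable _).enorm
        _ ≤ eLpNorm' f p volume * (D * eLpNorm' φ q volume) := by gcongr; exact hD φ hφ2
        _ = _ := by rw [eLpNorm', eLpNorm', hφq]; ring
    rcases eq_or_ne J 0 with h0 | h0
    · rw [h0]; exact zero_le
    have h2 : J = J ^ (1 / p) * J ^ (1 / q) := by
      rw [← ENNReal.rpow_add _ _ h0 hfin, one_div, one_div, hpq.inv_add_inv_eq_one,
        ENNReal.rpow_one]
    have h3 : J ^ (1 / p) ≤ D * eLpNorm' f p volume := by
      rw [h2] at h1
      have hne : J ^ (1 / q) ≠ 0 := by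
        rw [ne_eq, ENNReal.rpow_eq_zero_iff]
        simp [h0, hfin]
      have hnt : J ^ (1 / q) ≠ ⊤ := ENNReal.rpow_ne_top_of_nonneg (by positivity) hfin
      rw [← h2] at h1
      nth_rw 1 [h2] at h1
      exact (ENNReal.mul_le_mul_iff_left hne hnt).1 h1
    calc J = (J ^ (1 / p)) ^ p := by
          rw [← ENNReal.rpow_mul, one_div_mul_cancel hp0.ne', ENNReal.rpow_one]
      _ ≤ _ := ENNReal.rpow_le_rpow h3 hp0.le
  have hU : ⋃ k : ℕ, {z | ‖g z‖ ≤ k} = univ := by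
    rw [eq_univ_iff_forall]
    intro z
    obtain ⟨k, hk⟩ := exists_nat_ge ‖g z‖
    exact mem_iUnion.2 ⟨k, hk⟩
  have hdir : Directed (· ⊆ ·) fun k : ℕ => {z | ‖g z‖ ≤ k} := by
    refine Monotone.directed_le fun a b hab z (hz : ‖g z‖ ≤ a) => ?_
    exact hz.trans (by exact_mod_cast hab)
  have hall : ∫⁻ z, ‖g z‖ₑ ^ p ≤ (D * eLpNorm' f p volume) ^ p := by
    rw [← setLIntegral_univ, ← hU, setLIntegral_iUnion_of_directed _ hdir]
    exact iSup_le hk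
  calc eLpNorm' g p volume = (∫⁻ z, ‖g z‖ₑ ^ p) ^ (1 / p) := rfl
    _ ≤ ((D * eLpNorm' f p volume) ^ p) ^ (1 / p) := ENNReal.rpow_le_rpow hall (by positivity)
    _ = _ := by rw [← ENNReal.rpow_mul, mul_one_div_cancel hp0.ne', ENNReal.rpow_one]

/-- A bound on `L² ∩ L^p` extends to `L^p` by density. -/
theorem boundedLp_of_forall_eLpNorm_le {𝕜 : Type*} [RCLike 𝕜] {n : ℕ}
    {T : LpRn 𝕜 n 2 →L[𝕜] LpRn 𝕜 n 2} {p : ℝ≥0∞} [Fact (1 ≤ p)] (hp : p ≠ ⊤) {D : ℝ} (hD : 0 ≤ D)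
    (h : ∀ (f : Rn n → 𝕜), MemLp f p volume → ∀ (h₂ : MemLp f 2 volume),
      eLpNorm (T (h₂.toLp f)) p volume ≤ ENNReal.ofReal D * eLpNorm f p volume) :
    BoundedLp T p D := by
  let S : Submodule 𝕜 (LpRn 𝕜 n p) :=
    { carrier := {f | MemLp f 2 volume}
      add_mem' := fun {f g} hf hg => (hf.add hg).ae_eq (Lp.coeFn_add f g).symm
      zero_mem' := (MemLp.zero (ε := 𝕜)).ae_eq (Lp.coeFn_zero 𝕜 p volume).symm
      smul_mem' := fun c f hf => (hf.const_smul c).ae_eq (Lp.coeFn_smul c f).symm }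
  have hS : ∀ f : S, MemLp (f : LpRn 𝕜 n p) 2 volume := fun f => f.2
  have hTp : ∀ f : S, MemLp (T ((hS f).toLp _)) p volume := fun f =>
    ⟨Lp.aestronglyMeasurable _, (h _ (Lp.memLp _) (hS f)).trans_lt
      (ENNReal.mul_lt_top ENNReal.ofReal_lt_top (Lp.memLp (f : LpRn 𝕜 n p)).2)⟩
  let T₀ : S →ₗ[𝕜] LpRn 𝕜 n p :=
    { toFun := fun f => (hTp f).toLp _
      map_add' := fun f g => by
        rw [← MemLp.toLp_add, MemLp.toLp_eq_toLp_iff]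
        exact ae_operator_add T (hS f) (hS g) (hS (f + g)) (Lp.coeFn_add _ _)
      map_smul' := fun c f => by
        rw [RingHom.id_apply, ← MemLp.toLp_const_smul, MemLp.toLp_eq_toLp_iff]
        have e : (hS (c • f)).toLp _ = ((hS f).const_smul c).toLp _ :=
          MemLp.toLp_congr _ _ (Lp.coeFn_smul c (f : LpRn 𝕜 n p))
        have := ae_operator_smul T c (hS f)
        rw [← e] at this
        exact this }
  have hnorm : ∀ f : S, ‖T₀ f‖ ≤ D * ‖S.subtype f‖ := by
    intro f
    have h1 := h _ (Lp.memLp (f : LpRn 𝕜 n p)) (hS f)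
    have h2 : ‖T₀ f‖ = (eLpNorm (T ((hS f).toLp _)) p volume).toReal := Lp.norm_toLp _ (hTp f)
    rw [h2, Submodule.subtype_apply, Lp.norm_def]
    refine ENNReal.toReal_le_of_le_ofReal (by positivity) (h1.trans_eq ?_)
    rw [ENNReal.ofReal_mul hD, ENNReal.ofReal_toReal (Lp.memLp _).2.ne]
  have hdense : DenseRange S.subtype := by
    rw [Metric.denseRange_iff]
    intro f r hr
    obtain ⟨u, hup, hu2, hu⟩ := exists_memLp_eLpNorm_sub_le hp (Lp.memLp f)
      (ε := ENNReal.ofReal (r / 2)) (by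
        rw [ne_eq, ENNReal.ofReal_eq_zero, not_le]; positivity)
    refine ⟨⟨hup.toLp u, hu2.ae_eq hup.coeFn_toLp.symm⟩, ?_⟩
    rw [Submodule.subtype_apply, dist_eq_norm, Lp.norm_def]
    refine lt_of_le_of_lt (ENNReal.toReal_le_of_le_ofReal (by positivity) ?_) (half_lt_self hr)
    refine le_trans (le_of_eq (eLpNorm_congr_ae ?_)) hu
    filter_upwards [Lp.coeFn_sub f (hup.toLp u), hup.coeFn_toLp] with x h1 h2
    rw [h1, Pi.sub_apply, Pi.sub_apply, h2]
  refine ⟨T₀.extendOfNorm S.subtype, fun f hfp h₂ => ?_,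
    fun f => T₀.norm_extendOfNorm_apply_le hdense D hnorm f⟩
  have hmem : hfp.toLp f ∈ S := h₂.ae_eq hfp.coeFn_toLp.symm
  have e1 : T₀.extendOfNorm S.subtype (hfp.toLp f) = T₀ ⟨hfp.toLp f, hmem⟩ :=
    T₀.extendOfNorm_eq hdense ⟨D, hnorm⟩ ⟨hfp.toLp f, hmem⟩
  have e2 : (hS ⟨hfp.toLp f, hmem⟩).toLp _ = h₂.toLp f :=
    MemLp.toLp_congr _ _ hfp.coeFn_toLp
  rw [e1]
  refine (hTp ⟨hfp.toLp f, hmem⟩).coeFn_toLp.trans ?_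
  rw [e2]

/-! ### Bounded functions -/

theorem IsStandardKernel.swap {𝕜 : Type*} [RCLike 𝕜] {n : ℕ} {A : Rn n → Rn n → 𝕜} {α B : ℝ}
    (h : IsStandardKernel A α B) : IsStandardKernel (fun z w => A w z) α B where
  size z w hzw := by rw [norm_sub_rev z w]; exact h.size w z hzw.symm
  regularity_left z w k hzw hk := by
    rw [norm_sub_rev z w] at hk ⊢; exact h.regularity_right w z k hzw.symm hk
  regularity_right z w k hzw hk := by
    rw [norm_sub_rev z w] at hk ⊢; exact h.regularity_left w z k hzw.symm hk

/-- The tail integral in the definition of `T f` for bounded `f` is controlled by the Hörmander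
condition of the transposed kernel. -/
theorem exists_integrableOn_kernel_sub_mul (𝕜 : Type*) [RCLike 𝕜] (n : ℕ) {α : ℝ} (hα : 0 < α) :
    ∃ C : ℝ, 0 < C ∧ ∀ (A : Rn n → Rn n → 𝕜) (B : ℝ) (T : LpRn 𝕜 n 2 →L[𝕜] LpRn 𝕜 n 2),
      IsCZOperator A α B T → ∀ (f : Rn n → 𝕜), MemLp f ∞ volume → ∀ (c z : Rn n) (r : ℝ), 0 < r →
      ‖z - c‖ ≤ r →
      IntegrableOn (fun w => (A z w - A c w) * f w) (Metric.ball c (2 * r))ᶜ volume ∧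
      ‖∫ w in (Metric.ball c (2 * r))ᶜ, (A z w - A c w) * f w‖ₑ ≤
        ENNReal.ofReal (C * B) * eLpNorm f ∞ volume := by
  obtain ⟨C, hC, h⟩ := exists_setLIntegral_kernel_sub_center_le 𝕜 n hα
  refine ⟨C, hC, fun A B T hT f hf c z r hr hz => ?_⟩
  have hm : ∀ z, StronglyMeasurable fun w => A z w := fun z =>
    hT.measurable.comp_measurable measurable_prodMk_left
  have hle : ∫⁻ w in (Metric.ball c (2 * r))ᶜ, ‖(A z w - A c w) * f w‖ₑ ≤
      ENNReal.ofReal (C * B) * eLpNorm f ∞ volume := by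
    calc ∫⁻ w in (Metric.ball c (2 * r))ᶜ, ‖(A z w - A c w) * f w‖ₑ
        ≤ ∫⁻ w in (Metric.ball c (2 * r))ᶜ, ‖A z w - A c w‖ₑ * eLpNorm f ∞ volume := by
          refine lintegral_mono_ae (ae_restrict_of_ae ?_)
          filter_upwards [ae_le_eLpNormEssSup (f := f) (μ := volume)] with w hw
          rw [enorm_mul]
          gcongr
          exact hw
      _ = (∫⁻ w in (Metric.ball c (2 * r))ᶜ, ‖A z w - A c w‖ₑ) * eLpNorm f ∞ volume :=
          lintegral_mul_const' _ _ hf.2.ne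
      _ ≤ _ := by
          gcongr
          exact h _ B hT.nonneg hT.standard.swap c z r hr hz
  refine ⟨⟨(((hm z).sub (hm c)).aestronglyMeasurable.mul hf.1).restrict, hle.trans_lt ?_⟩,
    (enorm_integral_le_lintegral_enorm _).trans hle⟩
  have := hf.2
  finiteness

theorem memLp_two_indicator_of_subset_ball {𝕜 : Type*} [RCLike 𝕜] {n : ℕ} {f : Rn n → 𝕜}
    (hf : MemLp f ∞ volume) {S : Set (Rn n)} (hS : MeasurableSet S) {c : Rn n} {R : ℝ}
    (hSR : S ⊆ Metric.ball c R) : MemLp (S.indicator f) 2 volume := by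
  rw [memLp_indicator_iff_restrict hS]
  have : IsFiniteMeasure ((volume : Measure (Rn n)).restrict S) :=
    ⟨by simpa using (measure_mono hSR).trans_lt measure_ball_lt_top⟩
  exact (hf.restrict _).mono_exponent le_top

theorem memLp_two_indicator_ball' {𝕜 : Type*} [RCLike 𝕜] {n : ℕ} {f : Rn n → 𝕜}
    (hf : MemLp f ∞ volume) (c : Rn n) (R : ℝ) :
    MemLp ((Metric.ball c R).indicator f) 2 volume :=
  memLp_two_indicator_of_subset_ball hf measurableSet_ball subset_rfl

/-- The image of `f ∈ L^∞` under `T`, normalised to be given near `c` by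
`T (f 1_{B(c,2r)})(z) + ∫_{|w - c| ≥ 2r} (A(z,w) - A(c,w)) f(w) dw`. -/
noncomputable def localImage {𝕜 : Type*} [RCLike 𝕜] {n : ℕ} (A : Rn n → Rn n → 𝕜)
    (T : LpRn 𝕜 n 2 →L[𝕜] LpRn 𝕜 n 2) {f : Rn n → 𝕜} (hf : MemLp f ∞ volume) (c : Rn n) (r : ℝ)
    (z : Rn n) : 𝕜 :=
  T ((memLp_two_indicator_ball' hf c (2 * r)).toLp _) z +
    ∫ w in (Metric.ball c (2 * r))ᶜ, (A z w - A c w) * f w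

/-- The kernel representation on an open set `U` for a function carried by a set `S` disjoint from
`U`. -/
theorem IsCZOperator.ae_operator_indicator {𝕜 : Type*} [RCLike 𝕜] {n : ℕ} (hn : 1 ≤ n)
    {A : Rn n → Rn n → 𝕜} {α B : ℝ} {T : LpRn 𝕜 n 2 →L[𝕜] LpRn 𝕜 n 2} (hT : IsCZOperator A α B T)
    {f : Rn n → 𝕜} {S U : Set (Rn n)} (hS : MeasurableSet S) (hU : IsOpen U) (hSU : Disjoint S U)
    (hf : MemLp (S.indicator f) 2 volume) :
    (∀ z ∈ U, IntegrableOn (fun w => A z w * f w) S volume) ∧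
      ∀ᵐ z, z ∈ U → T (hf.toLp _) z = ∫ w in S, A z w * f w := by
  have hoff : ∀ w ∉ Uᶜ, S.indicator f w = 0 := fun w hw =>
    indicator_of_notMem (fun hwS => Set.disjoint_left.1 hSU hwS (not_not.1 hw)) _
  have e : ∀ z, (fun w => A z w * S.indicator f w) = S.indicator fun w => A z w * f w := by
    intro z; funext w; by_cases hw : w ∈ S <;> simp [hw]
  refine ⟨fun z hz => ?_, ?_⟩
  · have := integrable_kernel_mul hn hT.nonneg hT.measurable hT.standard.size hf
      hU.isClosed_compl hoff (not_not.2 hz)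
    rwa [e, integrable_indicator_iff hS] at this
  · filter_upwards [hT.associated _ hf _ hU.isClosed_compl hoff] with z hz hzU
    rw [hz (not_not.2 hzU), e, integral_indicator hS]

/-- Passing to a smaller ball changes the local image by a constant: the part of `f` between the two
balls moves from the operator to the integral, at the cost of `∫ A(c,w) f(w) dw` over it, and the
base point of the kernel moves from `c₀` to `c`. -/
theorem exists_localImage_eq_add {𝕜 : Type*} [RCLike 𝕜] {n : ℕ} (hn : 1 ≤ n)
    {A : Rn n → Rn n → 𝕜} {α B : ℝ} (hα : 0 < α) {T : LpRn 𝕜 n 2 →L[𝕜] LpRn 𝕜 n 2}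
    (hT : IsCZOperator A α B T) {f : Rn n → 𝕜} (hf : MemLp f ∞ volume) {c₀ c : Rn n} {R r : ℝ}
    (hr : 0 < r) (hR : 0 < R) (hc : ‖c - c₀‖ ≤ R)
    (hsub : Metric.ball c (2 * r) ⊆ Metric.ball c₀ (2 * R)) :
    ∃ κ : 𝕜, ∀ᵐ z, z ∈ Metric.ball c r → localImage A T hf c₀ R z = localImage A T hf c r z + κ := by
  obtain ⟨C, hC, hint⟩ := exists_integrableOn_kernel_sub_mul 𝕜 n hα
  set D := Metric.ball c₀ (2 * R) with hD
  set E := Metric.ball c (2 * r) with hE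
  have hDm : MeasurableSet D := measurableSet_ball
  have hEm : MeasurableSet E := measurableSet_ball
  have hS : MemLp ((D \ E).indicator f) 2 volume :=
    memLp_two_indicator_of_subset_ball hf (hDm.diff hEm) sdiff_subset
  obtain ⟨hi, hae⟩ := hT.ae_operator_indicator hn (hDm.diff hEm) Metric.isOpen_ball
    (disjoint_sdiff_left : Disjoint (D \ E) E) hS
  have hcE : c ∈ E := Metric.mem_ball_self (by positivity)
  have hEc : Eᶜ = (D \ E) ∪ Dᶜ := by
    ext w
    simp only [mem_compl_iff, mem_union, mem_sdiff]
    have := @hsub w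
    tauto
  have hdisj : Disjoint (D \ E) Dᶜ :=
    disjoint_compl_right.mono_left sdiff_subset
  refine ⟨(∫ w in D \ E, A c w * f w) + ∫ w in Dᶜ, (A c w - A c₀ w) * f w, ?_⟩
  have hDE : D.indicator f = E.indicator f + (D \ E).indicator f := by
    have := indicator_union_of_disjoint (disjoint_sdiff_right : Disjoint E (D \ E)) f
    rwa [union_sdiff_cancel hsub] at this
  filter_upwards [hae, ae_operator_add T (memLp_two_indicator_ball' hf c (2 * r)) hS
    (memLp_two_indicator_ball' hf c₀ (2 * R)) (by rw [← hD, ← hE, hDE])] with z h1 h2 hz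
  have hzE : z ∈ E := Metric.ball_subset_ball (by linarith) hz
  have hzc : ‖z - c‖ ≤ r := by rw [← dist_eq_norm]; exact (Metric.mem_ball.1 hz).le
  have i1 := (hint A B T hT f hf c z r hr hzc).1
  have i2 := (hint A B T hT f hf c₀ c R hR hc).1
  have i3 : IntegrableOn (fun w => (A z w - A c w) * f w) Dᶜ volume :=
    i1.mono_set (compl_subset_compl.2 hsub)
  have i4 : IntegrableOn (fun w => (A z w - A c w) * f w) (D \ E) volume :=
    i1.mono_set (by rw [← hE, hEc]; exact subset_union_left)
  have e1 : ∫ w in Eᶜ, (A z w - A c w) * f w = (∫ w in D \ E, (A z w - A c w) * f w) +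
      ∫ w in Dᶜ, (A z w - A c w) * f w := by
    rw [hEc, setIntegral_union hdisj hDm.compl i4 i3]
  have e2 : ∫ w in D \ E, (A z w - A c w) * f w =
      (∫ w in D \ E, A z w * f w) - ∫ w in D \ E, A c w * f w := by
    rw [← integral_sub (hi z hzE) (hi c hcE)]
    simp only [sub_mul]
  have e3 : ∫ w in Dᶜ, (A z w - A c₀ w) * f w = (∫ w in Dᶜ, (A z w - A c w) * f w) +
      ∫ w in Dᶜ, (A c w - A c₀ w) * f w := by
    rw [← integral_add i3 i2]
    congr 1; funext w; ring
  change _ + (∫ w in Dᶜ, (A z w - A c₀ w) * f w) =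
    _ + (∫ w in Eᶜ, (A z w - A c w) * f w) + _
  rw [e1, e2, e3, h2, h1 hzE]
  ring

/-- A ball is not a null set, so a statement without `z` that holds a.e. on it holds. -/
theorem of_ae_mem_ball {n : ℕ} {p : Prop} {c : Rn n} {r : ℝ} (hr : 0 < r)
    (h : ∀ᵐ z : Rn n, z ∈ Metric.ball c r → p) : p := by
  by_contra hp
  refine (Metric.measure_ball_pos volume c hr).ne' (measure_mono_null (fun z hz => ?_) h)
  exact fun h => hp (h hz)

/-- The image of a bounded function: a function that agrees with each local image up to a constant.
It is glued from the local images of the balls `B(0,j+1)`, the one for `j = ⌊|z|⌋` being used at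
`z`, after subtracting the constants by which they differ from the local image of the unit ball. -/
theorem exists_forall_eq_localImage_add {𝕜 : Type*} [RCLike 𝕜] {n : ℕ} (hn : 1 ≤ n)
    {A : Rn n → Rn n → 𝕜} {α B : ℝ} (hα : 0 < α) {T : LpRn 𝕜 n 2 →L[𝕜] LpRn 𝕜 n 2}
    (hT : IsCZOperator A α B T) {f : Rn n → 𝕜} (hf : MemLp f ∞ volume) :
    ∃ g : Rn n → 𝕜, ∀ (c : Rn n) (r : ℝ), 0 < r → ∃ κ : 𝕜, ∀ᵐ z, z ∈ Metric.ball c r →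
      g z = localImage A T hf c r z + κ := by
  have hpos : ∀ k : ℕ, (0 : ℝ) < (k : ℝ) + 1 := fun k => by positivity
  have hκ : ∀ j k : ℕ, j ≤ k → ∃ κ : 𝕜, ∀ᵐ z, z ∈ Metric.ball (0 : Rn n) ((j : ℝ) + 1) →
      localImage A T hf 0 ((k : ℝ) + 1) z = localImage A T hf 0 ((j : ℝ) + 1) z + κ := by
    intro j k hjk
    have : (j : ℝ) ≤ k := by exact_mod_cast hjk
    exact exists_localImage_eq_add hn hα hT hf (hpos j) (hpos k) (by simpa using (hpos k).le)
      (Metric.ball_subset_ball (by linarith))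
  choose! κ hκ using hκ
  -- the constants are consistent, since the three identities hold on the unit ball
  have hadd : ∀ j k : ℕ, j ≤ k → κ 0 k = κ 0 j + κ j k := by
    intro j k hjk
    refine of_ae_mem_ball (c := (0 : Rn n)) (r := 1) one_pos ?_
    filter_upwards [hκ 0 k (Nat.zero_le _), hκ 0 j (Nat.zero_le _), hκ j k hjk] with z h1 h2 h3 hz
    have hz0 : z ∈ Metric.ball (0 : Rn n) (((0 : ℕ) : ℝ) + 1) := by simpa using hz
    have hzj : z ∈ Metric.ball (0 : Rn n) ((j : ℝ) + 1) :=
      Metric.ball_subset_ball (by have : (0 : ℝ) ≤ j := Nat.cast_nonneg j; linarith) hz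
    have e := h1 hz0
    rw [h3 hzj, h2 hz0, add_assoc] at e
    exact (add_left_cancel e).symm
  refine ⟨fun z => localImage A T hf 0 ((⌊‖z‖⌋₊ : ℝ) + 1) z - κ 0 ⌊‖z‖⌋₊, fun c r hr => ?_⟩
  obtain ⟨k, hk⟩ := exists_nat_ge (‖c‖ + 2 * r)
  have hcn : 0 ≤ ‖c‖ := norm_nonneg c
  obtain ⟨κ', hκ'⟩ := exists_localImage_eq_add hn hα hT hf (c₀ := 0) (R := (k : ℝ) + 1) hr (hpos k)
    (c := c) (by rw [sub_zero]; linarith) (Metric.ball_subset_ball' (by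
      rw [dist_zero_right]; linarith))
  refine ⟨κ' - κ 0 k, ?_⟩
  filter_upwards [hκ', ae_all_iff.2 fun j => ae_all_iff.2 fun k => ae_all_iff.2 (hκ j k)]
    with z h1 h2 hz
  have hzk : ‖z‖ ≤ k := by
    have hd : dist z c < r := hz
    have := norm_le_norm_add_norm_sub' z c
    rw [← dist_eq_norm] at this
    linarith
  have hjk : ⌊‖z‖⌋₊ ≤ k := Nat.floor_le_of_le hzk
  have hzj : z ∈ Metric.ball (0 : Rn n) ((⌊‖z‖⌋₊ : ℝ) + 1) := by
    rw [mem_ball_zero_iff]; exact Nat.lt_floor_add_one _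
  have e := h2 _ _ hjk hzj
  rw [h1 hz] at e
  rw [hadd _ _ hjk]
  linear_combination -e

theorem volume_cube {n : ℕ} (a : Rn n) (l : ℝ) : volume (cube a l) = ENNReal.ofReal l ^ n := by
  have h : cube a l = (WithLp.ofLp : Rn n → Fin n → ℝ) ⁻¹'
      Icc (fun i => a i) (fun i => a i + l) := by
    ext x
    simp only [cube, mem_ofPred_eq, mem_preimage, mem_Icc, Pi.le_def, forall_and]
  rw [h, (PiLp.volume_preserving_ofLp (Fin n)).measure_preimage
    measurableSet_Icc.nullMeasurableSet, Real.volume_Icc_pi]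
  simp

theorem measurableSet_cube {n : ℕ} (a : Rn n) (l : ℝ) : MeasurableSet (cube a l) := by
  have : cube a l = ⋂ i, {x : Rn n | x i ∈ Icc (a i) (a i + l)} := by
    ext x; simp [cube]
  rw [this]
  refine MeasurableSet.iInter fun i => ?_
  exact measurableSet_Icc.preimage (by fun_prop : Measurable fun x : Rn n => x i)

theorem cube_subset_ball {n : ℕ} (a : Rn n) {l : ℝ} (hl : 0 < l) :
    cube a l ⊆ Metric.ball a ((√n + 1) * l) := by
  intro x hx
  rw [Metric.mem_ball, dist_eq_norm, EuclideanSpace.norm_eq]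
  have h1 : ∑ i, ‖(x - a) i‖ ^ 2 ≤ n * l ^ 2 := by
    calc ∑ i, ‖(x - a) i‖ ^ 2 ≤ ∑ _i : Fin n, l ^ 2 := by
          refine Finset.sum_le_sum fun i _ => ?_
          have h := hx i
          have h' : ‖(x - a) i‖ ≤ l := by
            rw [PiLp.sub_apply, Real.norm_eq_abs, abs_le]
            constructor <;> linarith [h.1, h.2]
          gcongr
      _ = n * l ^ 2 := by simp
  calc √(∑ i, ‖(x - a) i‖ ^ 2) ≤ √(n * l ^ 2) := Real.sqrt_le_sqrt h1
    _ = √n * l := by rw [Real.sqrt_mul (by positivity), Real.sqrt_sq hl.le]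
    _ < _ := by rw [add_mul, one_mul]; linarith

/-- The mean oscillation is at most twice the mean deviation from any constant. -/
theorem setLIntegral_sub_average_le {𝕜 : Type*} [RCLike 𝕜] {α : Type*} [MeasurableSpace α]
    {μ : Measure α} {g : α → 𝕜} {Q : Set α} (hg : IntegrableOn g Q μ) (hQ0 : μ Q ≠ 0)
    (hQ : μ Q ≠ ⊤) (e : 𝕜) :
    ∫⁻ x in Q, ‖g x - ⨍ y in Q, g y ∂μ‖ₑ ∂μ ≤ 2 * ∫⁻ x in Q, ‖g x - e‖ₑ ∂μ := by
  have : IsFiniteMeasure (μ.restrict Q) := ⟨by simpa using hQ.lt_top⟩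
  have hV : μ.real Q ≠ 0 := (ENNReal.toReal_pos hQ0 hQ).ne'
  have h1 : ‖e - ⨍ y in Q, g y ∂μ‖ₑ * μ Q ≤ ∫⁻ x in Q, ‖g x - e‖ₑ ∂μ := by
    have h2 : μ.real Q • (⨍ y in Q, g y ∂μ - e) = ∫ y in Q, (g y - e) ∂μ := by
      rw [integral_sub hg (integrable_const _), setIntegral_const, smul_sub, setAverage_eq,
        smul_inv_smul₀ hV]
    calc ‖e - ⨍ y in Q, g y ∂μ‖ₑ * μ Q = ‖μ.real Q • (⨍ y in Q, g y ∂μ - e)‖ₑ := by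
          rw [enorm_smul, Real.enorm_of_nonneg measureReal_nonneg, ofReal_measureReal hQ,
            mul_comm, ← enorm_neg, neg_sub]
      _ ≤ _ := by rw [h2]; exact enorm_integral_le_lintegral_enorm _
  calc ∫⁻ x in Q, ‖g x - ⨍ y in Q, g y ∂μ‖ₑ ∂μ
      ≤ ∫⁻ x in Q, (‖g x - e‖ₑ + ‖e - ⨍ y in Q, g y ∂μ‖ₑ) ∂μ := by
        refine lintegral_mono fun x => ?_
        refine le_trans (le_of_eq ?_) (enorm_add_le _ _)
        congr 1; ring
    _ = (∫⁻ x in Q, ‖g x - e‖ₑ ∂μ) + ‖e - ⨍ y in Q, g y ∂μ‖ₑ * μ Q := by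
        rw [lintegral_add_right _ measurable_const, setLIntegral_const]
    _ ≤ _ := by rw [two_mul]; gcongr

/-- The mean of the local image over a subset `Q` of the ball of comparable measure. By
Cauchy–Schwarz the `L²` bound controls the operator term, with the factor `√Λ` coming from
`|B(c,2r)| ≤ Λ |Q|`. -/
theorem exists_setLIntegral_localImage_le (𝕜 : Type*) [RCLike 𝕜] (n : ℕ) {α : ℝ} (hα : 0 < α) :
    ∃ C : ℝ, 0 < C ∧ ∀ (A : Rn n → Rn n → 𝕜) (B : ℝ) (T : LpRn 𝕜 n 2 →L[𝕜] LpRn 𝕜 n 2),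
      IsCZOperator A α B T → ∀ (f : Rn n → 𝕜) (hf : MemLp f ∞ volume) (c : Rn n) (r Λ : ℝ),
      0 < r → ∀ Q : Set (Rn n), MeasurableSet Q → Q ⊆ Metric.ball c r →
      volume (Metric.ball c (2 * r)) ≤ ENNReal.ofReal Λ * volume Q →
      ∫⁻ z in Q, ‖localImage A T hf c r z‖ₑ ≤
        ENNReal.ofReal ((√Λ + C) * B) * eLpNorm f ∞ volume * volume Q := by
  obtain ⟨C, hC, hint⟩ := exists_integrableOn_kernel_sub_mul 𝕜 n hα
  refine ⟨C, hC, fun A B T hT f hf c r Λ hr Q hQm hQ hΛ => ?_⟩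
  set E := Metric.ball c (2 * r) with hE
  set N := eLpNorm f ∞ volume with hN
  have hfE := memLp_two_indicator_ball' hf c (2 * r)
  have h1 : ∫⁻ z in Q, ‖T (hfE.toLp _) z‖ₑ ≤ ENNReal.ofReal (√Λ * B) * N * volume Q := by
    have k1 := eLpNorm_le_eLpNorm_mul_rpow_measure_univ (μ := volume.restrict Q) (p := 1) (q := 2)
      (by norm_num) (Lp.aestronglyMeasurable (T (hfE.toLp _))).restrict
    have k2 := eLpNorm_le_eLpNorm_mul_rpow_measure_univ (μ := volume.restrict E) (p := 2) (q := ∞)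
      le_top hf.1.restrict
    have e1 : (1 : ℝ) / (1 : ℝ≥0∞).toReal - 1 / (2 : ℝ≥0∞).toReal = 1 / 2 := by norm_num
    have e2 : (1 : ℝ) / (2 : ℝ≥0∞).toReal - 1 / (∞ : ℝ≥0∞).toReal = 1 / 2 := by simp
    rw [eLpNorm_one_eq_lintegral_enorm, Measure.restrict_apply_univ, e1] at k1
    rw [Measure.restrict_apply_univ, e2, ← eLpNorm_indicator_eq_eLpNorm_restrict
      measurableSet_ball] at k2
    have k3 : volume E ^ (1 / 2 : ℝ) ≤ ENNReal.ofReal √Λ * volume Q ^ (1 / 2 : ℝ) := by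
      refine (ENNReal.rpow_le_rpow hΛ (by norm_num)).trans (le_of_eq ?_)
      rw [ENNReal.mul_rpow_of_nonneg _ _ (by norm_num)]
      congr 1
      rcases le_total 0 Λ with h0 | h0
      · rw [ENNReal.ofReal_rpow_of_nonneg h0 (by norm_num), Real.sqrt_eq_rpow]
      · rw [ENNReal.ofReal_of_nonpos h0, Real.sqrt_eq_zero_of_nonpos h0]; simp
    calc ∫⁻ z in Q, ‖T (hfE.toLp _) z‖ₑ
        ≤ eLpNorm (T (hfE.toLp _)) 2 (volume.restrict Q) * volume Q ^ (1 / 2 : ℝ) := k1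
      _ ≤ ENNReal.ofReal B * (N * (ENNReal.ofReal √Λ * volume Q ^ (1 / 2 : ℝ))) *
            volume Q ^ (1 / 2 : ℝ) := by
          gcongr
          refine (eLpNorm_mono_measure _ Measure.restrict_le_self).trans
            ((hT.eLpNorm_two_le hfE).trans ?_)
          gcongr
          refine k2.trans (mul_le_mul' (eLpNorm_mono_measure _ Measure.restrict_le_self) k3)
      _ = ENNReal.ofReal (√Λ * B) * N * (volume Q ^ (1 / 2 : ℝ) * volume Q ^ (1 / 2 : ℝ)) := by
          rw [ENNReal.ofReal_mul (Real.sqrt_nonneg _)]; ring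
      _ = _ := by
          congr 1
          rw [← ENNReal.rpow_add_of_nonneg _ _ (by norm_num) (by norm_num)]
          norm_num
  calc ∫⁻ z in Q, ‖localImage A T hf c r z‖ₑ
      ≤ ∫⁻ z in Q, (‖T (hfE.toLp _) z‖ₑ + ENNReal.ofReal (C * B) * N) := by
        refine setLIntegral_mono' hQm fun z hz => (enorm_add_le _ _).trans ?_
        gcongr
        exact (hint A B T hT f hf c z r hr (by
          rw [← dist_eq_norm]; exact (Metric.mem_ball.1 (hQ hz)).le)).2
    _ = (∫⁻ z in Q, ‖T (hfE.toLp _) z‖ₑ) + ENNReal.ofReal (C * B) * N * volume Q := by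
        rw [lintegral_add_right _ measurable_const, setLIntegral_const]
    _ ≤ ENNReal.ofReal (√Λ * B) * N * volume Q + ENNReal.ofReal (C * B) * N * volume Q := by
        gcongr
    _ = _ := by
        have := hT.nonneg
        rw [add_mul √Λ, ENNReal.ofReal_add (by positivity) (by positivity)]; ring

theorem integrableOn_localImage {𝕜 : Type*} [RCLike 𝕜] {n : ℕ} {A : Rn n → Rn n → 𝕜} {α B : ℝ}
    (hα : 0 < α) {T : LpRn 𝕜 n 2 →L[𝕜] LpRn 𝕜 n 2} (hT : IsCZOperator A α B T) {f : Rn n → 𝕜}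
    (hf : MemLp f ∞ volume) (c : Rn n) {r : ℝ} (hr : 0 < r) :
    IntegrableOn (localImage A T hf c r) (Metric.ball c r) volume := by
  obtain ⟨C, hC, hle⟩ := exists_setLIntegral_localImage_le 𝕜 n hα
  have hm : AEStronglyMeasurable (localImage A T hf c r) volume := by
    refine (Lp.aestronglyMeasurable _).add ?_
    refine AEStronglyMeasurable.integral_prod_right'
      (f := fun p : Rn n × Rn n => (A p.1 p.2 - A c p.2) * f p.2) ?_
    exact (hT.measurable.sub (hT.measurable.comp_measurable
      (measurable_const.prodMk measurable_snd))).aestronglyMeasurable.mul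
      (AEStronglyMeasurable.comp_snd hf.1.restrict)
  refine ⟨hm.restrict, (hle A B T hT f hf c r (2 ^ n) hr _ measurableSet_ball subset_rfl
    ?_).trans_lt ?_⟩
  · rw [Measure.addHaar_ball_mul_of_pos volume c (by norm_num : (0 : ℝ) < 2),
      finrank_euclideanSpace_fin, Measure.addHaar_ball_center volume c]
  · have := hf.2
    have : volume (Metric.ball c r) < ⊤ := measure_ball_lt_top
    finiteness

/-- On `L² ∩ L^∞` the local images differ from the original image by constants. -/
theorem exists_localImage_eq_operator_add {𝕜 : Type*} [RCLike 𝕜] {n : ℕ} (hn : 1 ≤ n)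
    {A : Rn n → Rn n → 𝕜} {α B : ℝ} {T : LpRn 𝕜 n 2 →L[𝕜] LpRn 𝕜 n 2}
    (hT : IsCZOperator A α B T) {f : Rn n → 𝕜} (hf : MemLp f ∞ volume) (h₂ : MemLp f 2 volume)
    (c : Rn n) {r : ℝ} (hr : 0 < r) :
    ∃ κ : 𝕜, ∀ᵐ z, z ∈ Metric.ball c r → localImage A T hf c r z = T (h₂.toLp f) z + κ := by
  have hS : MemLp ((Metric.ball c (2 * r))ᶜ.indicator f) 2 volume :=
    h₂.indicator measurableSet_ball.compl
  obtain ⟨hi, hae⟩ := hT.ae_operator_indicator hn measurableSet_ball.compl Metric.isOpen_ball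
    (disjoint_compl_left : Disjoint (Metric.ball c (2 * r))ᶜ (Metric.ball c (2 * r))) hS
  refine ⟨-∫ w in (Metric.ball c (2 * r))ᶜ, A c w * f w, ?_⟩
  filter_upwards [hae, ae_operator_add T (memLp_two_indicator_ball' hf c (2 * r)) hS h₂
    (by rw [indicator_self_add_compl])] with z h1 h2 hz
  have hz2 : z ∈ Metric.ball c (2 * r) := Metric.ball_subset_ball (by linarith) hz
  have e : ∫ w in (Metric.ball c (2 * r))ᶜ, (A z w - A c w) * f w =
      (∫ w in (Metric.ball c (2 * r))ᶜ, A z w * f w) -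
        ∫ w in (Metric.ball c (2 * r))ᶜ, A c w * f w := by
    rw [← integral_sub (hi z hz2) (hi c (Metric.mem_ball_self (by positivity)))]
    simp only [sub_mul]
  rw [localImage, e, h2, h1 hz2]
  ring

/-- A cube of side `l` lies in the ball of radius `(√n + 1) l` about its corner, and its mean
oscillation is estimated through the local image of that ball. -/
theorem exists_boundedLinftyBMO (𝕜 : Type*) [RCLike 𝕜] {n : ℕ} (hn : 1 ≤ n) {α : ℝ}
    (hα : 0 < α) :
    ∃ C : ℝ, 0 < C ∧ ∀ (A : Rn n → Rn n → 𝕜) (B : ℝ) (T : LpRn 𝕜 n 2 →L[𝕜] LpRn 𝕜 n 2),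
      IsCZOperator A α B T → BoundedLinftyBMO A T (C * B) := by
  obtain ⟨C₀, hC₀, hint⟩ := exists_integrableOn_kernel_sub_mul 𝕜 n hα
  obtain ⟨C, hC, hloc⟩ := exists_setLIntegral_localImage_le 𝕜 n hα
  set V := (volume : Measure (Rn n)).real (Metric.ball 0 1) with hV
  -- the measure of the ball of radius `2 (√n + 1) l` is `Λ` times that of the cube of side `l`
  set Λ := (2 * (√n + 1)) ^ n * V with hΛ
  refine ⟨2 * (√Λ + C), by positivity, fun A B T hT f hf => ?_⟩
  obtain ⟨g, hg⟩ := exists_forall_eq_localImage_add hn hα hT hf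
  have hgi : ∀ (c : Rn n) (r : ℝ), 0 < r → IntegrableOn g (Metric.ball c r) volume := by
    intro c r hr
    obtain ⟨κ, hκ⟩ := hg c r hr
    have h1 : IntegrableOn (fun z => localImage A T hf c r z + κ) (Metric.ball c r) volume :=
      (integrableOn_localImage hα hT hf c hr).add (integrableOn_const measure_ball_lt_top.ne)
    refine h1.congr ?_
    rw [Filter.EventuallyEq, ae_restrict_iff' measurableSet_ball]
    filter_upwards [hκ] with z hz hzm
    exact (hz hzm).symm
  refine ⟨g, ?_, fun R hR => ?_, fun h₂ => ?_, ?_⟩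
  · rw [locallyIntegrable_iff]
    intro S hS
    obtain ⟨R, hR, hSR⟩ := hS.isBounded.subset_ball_lt 0 0
    exact (hgi 0 R hR).mono_set hSR
  · obtain ⟨κ, hκ⟩ := hg 0 R hR
    refine ⟨κ, ?_⟩
    filter_upwards [hκ] with z hz hzR
    exact ⟨(hint A B T hT f hf 0 z R hR (by rw [sub_zero]; exact hzR.le)).1,
      hz (mem_ball_zero_iff.2 hzR)⟩
  · have hk : ∀ k : ℕ, ∃ κ : 𝕜, ∀ᵐ z, z ∈ Metric.ball (0 : Rn n) ((k : ℝ) + 1) →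
        g z = T (h₂.toLp f) z + κ := by
      intro k
      have hk0 : (0 : ℝ) < (k : ℝ) + 1 := by positivity
      obtain ⟨κ₁, h1⟩ := hg 0 _ hk0
      obtain ⟨κ₂, h2⟩ := exists_localImage_eq_operator_add hn hT hf h₂ 0 hk0
      refine ⟨κ₂ + κ₁, ?_⟩
      filter_upwards [h1, h2] with z h1 h2 hz
      rw [h1 hz, h2 hz, add_assoc]
    choose κ hκ using hk
    -- all the identities hold on the unit ball
    have hconst : ∀ k, κ k = κ 0 := by
      intro k
      refine of_ae_mem_ball (c := (0 : Rn n)) (r := 1) one_pos ?_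
      filter_upwards [hκ 0, hκ k] with z h1 h2 hz
      have e := h1 (by simpa using hz)
      rw [h2 (Metric.ball_subset_ball (by have : (0 : ℝ) ≤ k := Nat.cast_nonneg k; linarith) hz)]
        at e
      exact add_left_cancel e
    refine ⟨κ 0, ?_⟩
    filter_upwards [ae_all_iff.2 hκ] with z hz
    rw [hz ⌊‖z‖⌋₊ (mem_ball_zero_iff.2 (Nat.lt_floor_add_one _)), hconst]
  · refine iSup_le fun a => iSup_le fun l => iSup_le fun hl => ?_
    set Q := cube a l with hQ
    set r := (√n + 1) * l with hr
    have hr0 : 0 < r := by positivity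
    have hQsub : Q ⊆ Metric.ball a r := cube_subset_ball a hl
    have hQv : volume Q = ENNReal.ofReal l ^ n := volume_cube a l
    have hQ0 : volume Q ≠ 0 := by
      rw [hQv]; exact pow_ne_zero _ (by simpa using hl)
    have hQt : volume Q ≠ ⊤ := by rw [hQv]; finiteness
    have hE : volume (Metric.ball a (2 * r)) ≤ ENNReal.ofReal Λ * volume Q := by
      rw [Measure.addHaar_ball_of_pos volume a (by positivity), finrank_euclideanSpace_fin, hQv,
        ← ofReal_measureReal measure_ball_lt_top.ne, ← hV, ← ENNReal.ofReal_pow hl.le,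
        ← ENNReal.ofReal_mul (by positivity), ← ENNReal.ofReal_mul (by positivity), hΛ, hr]
      refine le_of_eq (congrArg _ ?_)
      rw [show 2 * ((√n + 1) * l) = 2 * (√n + 1) * l by ring, mul_pow _ l]
      ring
    obtain ⟨κ, hκ⟩ := hg a r hr0
    have hdev : ∫⁻ x in Q, ‖g x - κ‖ₑ ≤
        ENNReal.ofReal ((√Λ + C) * B) * eLpNorm f ∞ volume * volume Q := by
      refine le_trans (lintegral_mono_ae ?_)
        (hloc A B T hT f hf a r Λ hr0 Q (measurableSet_cube a l) hQsub hE)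
      rw [ae_restrict_iff' (measurableSet_cube a l)]
      filter_upwards [hκ] with z hz hzQ
      rw [hz (hQsub hzQ), add_sub_cancel_right]
    calc (volume Q)⁻¹ * ∫⁻ x in Q, ‖g x - ⨍ y in Q, g y‖ₑ
        ≤ (volume Q)⁻¹ * (2 * (ENNReal.ofReal ((√Λ + C) * B) * eLpNorm f ∞ volume *
            volume Q)) := by
          gcongr
          exact (setLIntegral_sub_average_le ((hgi a r hr0).mono_set hQsub) hQ0 hQt κ).trans
            (by gcongr)
      _ = (volume Q)⁻¹ * volume Q * (2 * ENNReal.ofReal ((√Λ + C) * B) *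
            eLpNorm f ∞ volume) := by ring
      _ = ENNReal.ofReal (2 * (√Λ + C) * B) * eLpNorm f ∞ volume := by
          rw [ENNReal.inv_mul_cancel hQ0 hQt, one_mul, mul_assoc (2 : ℝ) (√Λ + C) B,
            ENNReal.ofReal_mul (by norm_num : (0 : ℝ) ≤ 2)]
          simp

/-! ### Assembling the Calderón–Zygmund estimates -/

theorem IsStandardKernel.mono {𝕜 : Type*} [RCLike 𝕜] {n : ℕ} {A : Rn n → Rn n → 𝕜}
    {α B B' : ℝ} (h : IsStandardKernel A α B) (hB : B ≤ B') : IsStandardKernel A α B' where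
  size z₁ z₂ hz := (h.size z₁ z₂ hz).trans (by gcongr)
  regularity_left z₁ z₂ k hz hk := (h.regularity_left z₁ z₂ k hz hk).trans (by gcongr)
  regularity_right z₁ z₂ k hz hk := (h.regularity_right z₁ z₂ k hz hk).trans (by gcongr)

theorem BoundedLinftyBMO.mono {𝕜 : Type*} [RCLike 𝕜] {n : ℕ} {A : Rn n → Rn n → 𝕜}
    {T : LpRn 𝕜 n 2 →L[𝕜] LpRn 𝕜 n 2} {B B' : ℝ} (h : BoundedLinftyBMO A T B) (hB : B ≤ B') :
    BoundedLinftyBMO A T B' := fun f hf =>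
  let ⟨g, h₁, h₂, h₃, h₄⟩ := h f hf
  ⟨g, h₁, h₂, h₃, h₄.trans (by gcongr)⟩

theorem IsCZOperator.isCalderonZygmund {𝕜 : Type*} [RCLike 𝕜] {n : ℕ} (hn : 1 ≤ n)
    {A : Rn n → Rn n → 𝕜} {α B B' : ℝ} {T : LpRn 𝕜 n 2 →L[𝕜] LpRn 𝕜 n 2}
    (h : IsCZOperator A α B T) (hB : B ≤ B') : IsCalderonZygmund A α B' T where
  standard := h.standard.mono hB
  bounded := h.bounded.trans hB
  associated f hf _ := by
    have h0 : ∀ w ∉ tsupport f, f w = 0 := fun w hw => image_eq_zero_of_notMem_tsupport hw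
    filter_upwards [h.associated f hf _ (isClosed_tsupport f) h0] with z hz hzf
    exact ⟨integrable_kernel_mul hn h.nonneg h.measurable h.standard.size hf
      (isClosed_tsupport f) h0 hzf, hz hzf⟩

/-- The `L^p` bound of a Calderón–Zygmund operator whose transpose `T'` is also one: interpolation
for `p < 2`, and duality with `T'` for `p > 2`. -/
theorem exists_eLpNorm_operator_le (𝕜 : Type*) [RCLike 𝕜] {n : ℕ} (hn : 1 ≤ n) {α : ℝ}
    (hα : 0 < α) {p : ℝ≥0∞} (hp : 1 < p) (hp' : p < ⊤) :
    ∃ C : ℝ, 0 < C ∧ ∀ (A A' : Rn n → Rn n → 𝕜) (B : ℝ) (T T' : LpRn 𝕜 n 2 →L[𝕜] LpRn 𝕜 n 2),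
      IsCZOperator A α B T → IsCZOperator A' α B T' →
      (∀ (f φ : Rn n → 𝕜) (hf : MemLp f 2 volume) (hφ : MemLp φ 2 volume),
        ∫ z, T (hf.toLp f) z * φ z = ∫ z, f z * T' (hφ.toLp φ) z) →
      ∀ (f : Rn n → 𝕜) (hf : MemLp f 2 volume),
        eLpNorm (T (hf.toLp f)) p volume ≤ ENNReal.ofReal (C * B) * eLpNorm f p volume := by
  have hp0 : p ≠ 0 := (zero_lt_one.trans hp).ne'
  have hp1 : 1 < p.toReal := by
    simpa using (ENNReal.toReal_lt_toReal ENNReal.one_ne_top hp'.ne).2 hp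
  rcases lt_trichotomy p.toReal 2 with h2 | h2 | h2
  · obtain ⟨C, hC, hC'⟩ := exists_eLpNorm'_operator_le_of_lt_two 𝕜 hn hα ⟨hp1, h2⟩
    refine ⟨C, hC, fun A _ B T _ hT _ _ f hf => ?_⟩
    rw [eLpNorm_eq_eLpNorm' hp0 hp'.ne, eLpNorm_eq_eLpNorm' hp0 hp'.ne]
    exact hC' A B T hT f hf
  · have : p = 2 := by rw [← ENNReal.ofReal_toReal hp'.ne, h2]; simp
    subst this
    exact ⟨1, one_pos, fun A _ B T _ hT _ _ f hf => by
      rw [one_mul]; exact hT.eLpNorm_two_le hf⟩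
  · have hpq := Real.HolderConjugate.conjExponent hp1
    have hq : p.toReal.conjExponent ∈ Ioo (1 : ℝ) 2 := by
      refine ⟨hpq.symm.lt, ?_⟩
      rw [Real.conjExponent, div_lt_iff₀ (by linarith)]
      linarith
    obtain ⟨C, hC, hC'⟩ := exists_eLpNorm'_operator_le_of_lt_two 𝕜 hn hα hq
    refine ⟨C, hC, fun A A' B T T' _ hT' hTT f hf => ?_⟩
    rw [eLpNorm_eq_eLpNorm' hp0 hp'.ne, eLpNorm_eq_eLpNorm' hp0 hp'.ne]
    exact eLpNorm'_operator_le_of_transpose hTT hpq h2 (fun φ hφ => hC' A' B T' hT' φ hφ) hf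

/-- The operator with weight `K` and its transpose, which is the operator with the same weight and
the roles of `s₁` and `s₂` exchanged, are Calderón–Zygmund operators with a common constant. -/
theorem exists_isCZOperator_transpose (𝕜 : Type*) [RCLike 𝕜] {n : ℕ} (hn : 1 ≤ n) {s s₁ s₂ : ℝ}
    (hs₁ : s₁ ∈ Ioo (0 : ℝ) 1) (hs₂ : s₂ ∈ Ioo (0 : ℝ) 1) (hsum : s₁ + s₂ = 2 * s) :
    ∃ α C : ℝ, 0 < α ∧ 0 < C ∧ ∀ K : Rn n × Rn n → 𝕜, MemLp K ∞ volume →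
      ∃ T T' : LpRn 𝕜 n 2 →L[𝕜] LpRn 𝕜 n 2, IsOperatorT K s s₁ s₂ T ∧
        IsCZOperator (kernelA K s s₁ s₂) α (C * (eLpNorm K ∞ volume).toReal) T ∧
        IsCZOperator (kernelA K s s₂ s₁) α (C * (eLpNorm K ∞ volume).toReal) T' ∧
        ∀ (f φ : Rn n → 𝕜) (hf : MemLp f 2 volume) (hφ : MemLp φ 2 volume),
          ∫ z, T (hf.toLp f) z * φ z = ∫ z, f z * T' (hφ.toLp φ) z := by
  obtain ⟨α, C₁, hα, hC₁, hstd⟩ := exists_isStandardKernel_kernelA 𝕜 hn hs₁ hs₂ hsum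
  obtain ⟨C₂, hC₂, hop⟩ := exists_operator_isAssociated 𝕜 hn hs₁ hs₂ hsum
  obtain ⟨C₃, hC₃, hop'⟩ := exists_operator_isAssociated 𝕜 hn hs₂ hs₁ ((add_comm _ _).trans hsum)
  refine ⟨α, C₁ + C₂ + C₃, hα, by positivity, fun K hK => ?_⟩
  obtain ⟨T, hT, hform, hass⟩ := hop K hK
  obtain ⟨T', hT', hform', hass'⟩ := hop' K hK
  have hM : 0 ≤ (eLpNorm K ∞ volume).toReal := ENNReal.toReal_nonneg
  have hswap : (fun z w => kernelA K s s₁ s₂ w z) = kernelA K s s₂ s₁ := by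
    ext z w; exact kernelA_swap K s s₁ s₂ w z
  refine ⟨T, T', isOperatorT_of_pairIntegrand hn hs₁.1 hs₂.1 hform,
    ⟨stronglyMeasurable_kernelA hK.1 s s₁ s₂,
      (hstd K hK).mono (by gcongr; linarith), hT.trans (by gcongr; linarith), hass⟩,
    ⟨stronglyMeasurable_kernelA hK.1 s s₂ s₁,
      (hswap ▸ (hstd K hK).swap).mono (by gcongr; linarith),
      hT'.trans (by gcongr; linarith), hass'⟩, fun f φ hf hφ => ?_⟩
  simp_rw [mul_comm (f _)]
  rw [(hform f φ hf hφ).2, (hform' φ f hφ hf).2, pairIntegrand_swap]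

theorem theorem1p1 {𝕜 : Type*} [RCLike 𝕜] (n : ℕ) (hn : 1 ≤ n) (s s₁ s₂ : ℝ)
    (hs : s ∈ Ioo (0 : ℝ) 1) (hs₁ : s₁ ∈ Ioo (0 : ℝ) 1) (hs₂ : s₂ ∈ Ioo (0 : ℝ) 1)
    (hsum : s₁ + s₂ = 2 * s) :
    ∃ (α C : ℝ) (Cp : ℝ≥0∞ → ℝ), 0 < α ∧ 0 < C ∧ (∀ p, 0 < Cp p) ∧
      ∀ K : Rn n × Rn n → 𝕜, MemLp K ∞ volume →
        (∀ z₁ z₂ : Rn n, z₁ ≠ z₂ → Integrable (kernelIntegrand K s s₁ s₂ z₁ z₂) volume) ∧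
        ∃ T : LpRn 𝕜 n 2 →L[𝕜] LpRn 𝕜 n 2,
          IsOperatorT K s s₁ s₂ T ∧
          IsCalderonZygmund (kernelA K s s₁ s₂) α (C * (eLpNorm K ∞ volume).toReal) T ∧
          BoundedWeakL1 T (C * (eLpNorm K ∞ volume).toReal) ∧
          (∀ (p : ℝ≥0∞) [Fact (1 ≤ p)], 1 < p → p < ⊤ →
            BoundedLp T p (Cp p * (eLpNorm K ∞ volume).toReal)) ∧
          BoundedLinftyBMO (kernelA K s s₁ s₂) T (C * (eLpNorm K ∞ volume).toReal) := by
  obtain ⟨α, C₀, hα, hC₀, hCZ⟩ := exists_isCZOperator_transpose 𝕜 hn hs₁ hs₂ hsum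
  obtain ⟨Cw, hCw, hweak⟩ := exists_mul_volume_operator_le 𝕜 hn hα
  obtain ⟨Cb, hCb, hbmo⟩ := exists_boundedLinftyBMO 𝕜 hn hα
  obtain ⟨_, _, hker⟩ := exists_kernelA_size_le 𝕜 hn hs₁ hs₂ hsum
  have hLp : ∀ p : ℝ≥0∞, ∃ C : ℝ, 0 < C ∧ (1 < p → p < ⊤ →
      ∀ (A A' : Rn n → Rn n → 𝕜) (B : ℝ) (T T' : LpRn 𝕜 n 2 →L[𝕜] LpRn 𝕜 n 2),
      IsCZOperator A α B T → IsCZOperator A' α B T' →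
      (∀ (f φ : Rn n → 𝕜) (hf : MemLp f 2 volume) (hφ : MemLp φ 2 volume),
        ∫ z, T (hf.toLp f) z * φ z = ∫ z, f z * T' (hφ.toLp φ) z) →
      ∀ (f : Rn n → 𝕜) (hf : MemLp f 2 volume),
        eLpNorm (T (hf.toLp f)) p volume ≤ ENNReal.ofReal (C * B) * eLpNorm f p volume) := by
    intro p
    by_cases hp : 1 < p ∧ p < ⊤
    · obtain ⟨C, hC, hC'⟩ := exists_eLpNorm_operator_le 𝕜 hn hα hp.1 hp.2
      exact ⟨C, hC, fun _ _ => hC'⟩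
    -- nothing is claimed for other `p`, but `Cp p` has to be positive for all of them
    · exact ⟨1, one_pos, fun h₁ h₂ => absurd ⟨h₁, h₂⟩ hp⟩
  choose Cp hCp hCp' using hLp
  -- one constant for the kernel and `L²` bounds, the weak bound and the `BMO` bound
  refine ⟨α, C₀ + Cw * C₀ + Cb * C₀, fun p => Cp p * C₀, hα, by positivity,
    fun p => mul_pos (hCp p) hC₀, fun K hK => ⟨fun z₁ z₂ hz => (hker K hK z₁ z₂ hz).1, ?_⟩⟩
  obtain ⟨T, T', hop, hT, hT', hTT⟩ := hCZ K hK
  set M := (eLpNorm K ∞ volume).toReal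
  have hM : 0 ≤ M := ENNReal.toReal_nonneg
  have hw : 0 ≤ Cw * C₀ * M := by positivity
  have hb : 0 ≤ Cb * C₀ * M := by positivity
  have h0 : 0 ≤ C₀ * M := by positivity
  refine ⟨T, hop, hT.isCalderonZygmund hn (by linarith),
    boundedWeakL1_of_forall_weakL1Norm_le (by linarith) fun u hu h₂ => ?_,
    fun p _ hp hp' => boundedLp_of_forall_eLpNorm_le hp'.ne (mul_nonneg (mul_pos (hCp p) hC₀).le hM)
      fun f _ h₂ => ?_, (hbmo _ _ _ hT).mono (by linarith)⟩
  · refine weakL1Norm_le_iff.2 fun t ht => (hweak _ _ T hT u hu h₂ t ht).trans ?_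
    rw [eLpNorm_one_eq_lintegral_enorm]
    exact mul_le_mul_left (ENNReal.ofReal_le_ofReal (by linarith)) _
  · rw [mul_assoc]
    exact hCp' p hp hp' _ _ _ T T' hT hT' hTT f h₂
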